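/- Let $k$ be a field and let $(\mathscr C,\mathbb E,\mathfrak s)$ be an extriangulated category whose underlying category is $k$-linear, Hom-finite and Krull--Schmidt. Assume that $\mathscr C$ is reduced $0$-Auslander: it has enough projectives, every object $X$ has a conflation $P_1\rightarrowtail P_0\twoheadrightarrow X$ with $P_0,P_1$ projective, every projective $P$ has a conflation $P\rightarrowtail Q\twoheadrightarrow I$ with $Q$ projective-injective and $I$ injective, and $0$ is the only projective-injective object. Assume also that the class of projectives of $\mathscr C$ is $\operatorname{add}P$ for some object $P$. Objects are considered up to isomorphism. An object $U$ is presilting if $\mathbb E(U,U)=0$. For $U$ presilting put $\mathscr C_U=\{X\mid \mathbb E(U,X)=0=\mathbb E(X,U)\}$, and let $\widetilde{\mathscr C}_U=\mathscr C_U/[U]$ be its quotient by the ideal of morphisms factoring through $\operatorname{add}U$, with the induced extriangulated structure; the same notation is used with $\mathscr C$ replaced by one of these quotients. An object is basic if it is a finite direct sum of pairwise non-isomorphic indecomposables, and $|V|$ denotes the number of isomorphism classes of indecomposable direct summands of $V$. A tuple $(U_1,\dots,U_t)$ of indecomposable objects of a category $\mathscr D$ (either $\mathscr C$ or an iterated quotient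 as above) is a signed presilting sequence in $\mathscr D$ if $U_t$ is a non-injective presilting object, or $U_t$ is injective and there is a conflation $Q\rightarrowtail 0\twoheadrightarrow U_t$ in $\mathscr D$ with $Q$ indecomposable projective, and if moreover $U_1,\dots,U_{t-1}$ lie in $\mathscr D_{U_t}$ and $(U_1,\dots,U_{t-1})$ is a signed presilting sequence in $\widetilde{\mathscr D}_{U_t}$ (the empty sequence being signed presilting). The $\tau$-cluster morphism category $\mathfrak M(\mathscr C)$ has as objects the subcategories $\mathscr C_U$ with $U$ presilting. The morphisms $\mathscr B_1=\mathscr C_U\to\mathscr B_2$ are symbols $h_V^{\mathscr B_1}$, one for each isomorphism class of basic presilting objects $V\in\mathscr C_U$ with $\operatorname{add}V\cap\operatorname{add}U=0$ and $\mathscr B_2=(\mathscr B_1)_V:=\{Y\in\mathscr B_1\mid\mathbb E(V,Y)=0=\mathbb E(Y,V)\}$. Composition is $h_W^{\mathscr B_2}\circ h_V^{\mathscr B_1}=h_{V\oplus W}^{\mathscr B_1}$, and the identity of $\mathscr B$ is $h_0^{\mathscr B}$. A morphism $h$ is irreducible if it is not an identity and whenever $h=h_1\circ h_2$, one of $h_1,h_2$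 is an identity. Then the following hold. 1. Let $\mathscr B=\mathscr C_U$ be an object of $\mathfrak M(\mathscr C)$, put $\widetilde{\mathscr B}=\widetilde{\mathscr C}_U$, and let $V$ be a basic presilting object of $\widetilde{\mathscr B}$ with $|V|=t$. There is exactly one morphism of $\mathfrak M(\mathscr C)$ with source $\mathscr B$ and label isomorphic to $V$ in $\widetilde{\mathscr B}$; denote it by $h_V^{\mathscr B}$. There is a bijection between (a) the signed presilting sequences $(U_1,\dots,U_t)$ in $\widetilde{\mathscr B}$, up to isomorphism of the entries, with $V\cong U_1\oplus\dots\oplus U_t$ in $\widetilde{\mathscr B}$, and (b) the factorisations of $h_V^{\mathscr B}$ into compositions (of any finite length) of irreducible morphisms of $\mathfrak M(\mathscr C)$. It sends $(U_1,\dots,U_t)$ to a factorisation $h_{U'_1}^{\mathscr B_1}\circ\dots\circ h_{U'_t}^{\mathscr B_t}$ whose labels $U'_i\in\mathscr C_U$ become isomorphic to $U_i$ in $\widetilde{\mathscr B}$. 2. A morphism $h_V^{\mathscr B}$ of $\mathfrak M(\mathscr C)$ is irreducible if and only if $V$ is indecomposable. -/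

import Mathlib

open CategoryTheory CategoryTheory.Limits

universe w v u

attribute [local instance] hasBinaryBiproducts_of_finite_biproducts

namespace TauCluster

/-! ## Direct sums in additive categories -/

section Additive

variable {C : Type u} [Category.{v} C] [Preadditive C] [HasFiniteBiproducts C]

variable (C) in
/-- Every object is a finite direct sum of objects with local endomorphism rings. -/
class IsKrullSchmidt : Prop where
  exists_decomposition : ∀ X : C, ∃ (ι : Type) (_ : Finite ι) (F : ι → C),
    (∀ i, IsLocalRing (End (F i))) ∧ Nonempty (X ≅ ⨁ F)

/-- `X` lies in `add U`: it is a direct summand of a finite direct sum of copies of `U`. -/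
def InAdd (U X : C) : Prop :=
  ∃ n : ℕ, Nonempty (Retract X (⨁ fun _ : Fin n => U))

/-- `add U ∩ add V = 0`. -/
def AddDisjoint (U V : C) : Prop := ∀ X : C, InAdd U X → InAdd V X → IsZero X

/-- `V` is basic: a finite direct sum of pairwise non-isomorphic indecomposables. -/
def IsBasic (V : C) : Prop :=
  ∃ (ι : Type) (_ : Finite ι) (F : ι → C), (∀ i, Indecomposable (F i)) ∧
    (∀ i j, Nonempty (F i ≅ F j) → i = j) ∧ Nonempty (V ≅ ⨁ F)

variable (C) in
/-- The zero object, as an empty direct sum. -/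
noncomputable def zeroObj : C := ⨁ (Empty.elim : Empty → C)

lemma isZero_zeroObj : IsZero (zeroObj C) := by
  rw [IsZero.iff_id_eq_zero]
  apply biproduct.hom_ext
  exact fun i => i.elim

/-- The set of isomorphism classes of objects. -/
def IsoClass (D : Type u) [Category.{v} D] : Type u := _root_.Quotient (isIsomorphicSetoid D)

/-- The isomorphism class of an object. -/
def IsoClass.mk {D : Type u} [Category.{v} D] (X : D) : IsoClass D :=
  Quotient.mk (isIsomorphicSetoid D) X

/-- The isomorphism class of a direct sum. -/
noncomputable def IsoClass.sum {D : Type u} [Category.{v} D] [Preadditive D]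
    [HasFiniteBiproducts D] : IsoClass D → IsoClass D → IsoClass D :=
  Quotient.map₂ (fun X Y => X ⊞ Y) fun _ _ h _ _ h' =>
    h.elim fun e => h'.elim fun e' => ⟨biprod.mapIso e e'⟩

/-- `|V|`, the number of isomorphism classes of indecomposable direct summands of `V`. -/
noncomputable def numSummands (V : C) : ℕ :=
  {x : IsoClass C | ∃ X Y : C, x = IsoClass.mk X ∧ Indecomposable X ∧
    Nonempty (V ≅ X ⊞ Y)}.ncard

lemma inAdd_iff {U X : C} : InAdd U X ↔
    ∃ (n : ℕ) (s : Fin n → (X ⟶ U)) (r : Fin n → (U ⟶ X)), ∑ i, s i ≫ r i = 𝟙 X := by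
  constructor
  · rintro ⟨n, ⟨e⟩⟩
    refine ⟨n, fun i => e.i ≫ biproduct.π _ i, fun i => biproduct.ι (fun _ : Fin n => U) i ≫ e.r,
      ?_⟩
    have h := e.retract
    rw [← Category.id_comp e.r, ← biproduct.total, Preadditive.sum_comp,
      Preadditive.comp_sum] at h
    simpa using h
  · rintro ⟨n, s, r, h⟩
    exact ⟨n, ⟨⟨biproduct.lift s, biproduct.desc r, by rw [biproduct.lift_desc, h]⟩⟩⟩

lemma InAdd.of_retract {U X Y : C} (h : InAdd U X) (e : Retract Y X) : InAdd U Y := by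
  obtain ⟨n, ⟨e'⟩⟩ := h
  exact ⟨n, ⟨e.trans e'⟩⟩

lemma inAdd_self (U : C) : InAdd U U := inAdd_iff.2 ⟨1, fun _ => 𝟙 U, fun _ => 𝟙 U, by simp⟩

lemma InAdd.biprod {U X Y : C} (hX : InAdd U X) (hY : InAdd U Y) : InAdd U (X ⊞ Y) := by
  obtain ⟨n, s, r, h⟩ := inAdd_iff.1 hX
  obtain ⟨m, s', r', h'⟩ := inAdd_iff.1 hY
  refine inAdd_iff.2 ⟨n + m, Fin.addCases (fun i => biprod.fst ≫ s i) (fun i => biprod.snd ≫ s' i),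
    Fin.addCases (fun i => r i ≫ biprod.inl) (fun i => r' i ≫ biprod.inr), ?_⟩
  rw [Fin.sum_univ_add]
  simp only [Fin.addCases_left, Fin.addCases_right, Category.assoc]
  rw [← Preadditive.comp_sum, ← Preadditive.comp_sum]
  simp only [← Category.assoc]
  rw [← Preadditive.sum_comp, ← Preadditive.sum_comp]
  simp only [← Category.assoc, h, h']
  simp

lemma isZero_of_inAdd_isZero {Z X : C} (hZ : IsZero Z) (h : InAdd Z X) : IsZero X := by
  obtain ⟨n, s, r, h⟩ := inAdd_iff.1 h
  rw [IsZero.iff_id_eq_zero, ← h]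
  exact Finset.sum_eq_zero fun i _ => by rw [hZ.eq_of_tgt (s i) 0, zero_comp]

lemma AddDisjoint.symm {U V : C} (h : AddDisjoint U V) : AddDisjoint V U :=
  fun X hX hX' => h X hX' hX

lemma inAdd_biprod_left {V W X : C} (h : InAdd V X) : InAdd (V ⊞ W) X := by
  obtain ⟨n, s, r, h⟩ := inAdd_iff.1 h
  exact inAdd_iff.2 ⟨n, fun i => s i ≫ biprod.inl, fun i => biprod.fst ≫ r i, by simpa using h⟩

lemma inAdd_biprod_right {V W X : C} (h : InAdd W X) : InAdd (V ⊞ W) X := by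
  obtain ⟨n, s, r, h⟩ := inAdd_iff.1 h
  exact inAdd_iff.2 ⟨n, fun i => s i ≫ biprod.inr, fun i => biprod.snd ≫ r i, by simpa using h⟩

lemma inAdd_of_isIso_sum {V Y : C} {n : ℕ} (s : Fin n → (Y ⟶ V)) (r : Fin n → (V ⟶ Y))
    (h : IsIso (∑ i, s i ≫ r i)) : InAdd V Y :=
  inAdd_iff.2 ⟨n, s, fun i => r i ≫ inv (∑ i, s i ≫ r i), by
    simp only [← Category.assoc]
    rw [← Preadditive.sum_comp, IsIso.hom_inv_id]⟩

lemma addDisjoint_biprod [IsKrullSchmidt C] {V W U : C} (hV : AddDisjoint V U)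
    (hW : AddDisjoint W U) : AddDisjoint (V ⊞ W) U := by
  intro X hX hU
  obtain ⟨ι, _, F, hF, ⟨e⟩⟩ := IsKrullSchmidt.exists_decomposition X
  have key : ∀ _ : ι, False := by
    intro i
    have := hF i
    have eR : Retract (F i) X := ⟨biproduct.ι F i ≫ e.inv, e.hom ≫ biproduct.π F i, by simp⟩
    have hne : ¬ IsZero (F i) := fun h0 =>
      zero_ne_one (α := End (F i)) ((h0.eq_of_src (𝟙 (F i)) 0).symm)
    obtain ⟨n, s, r, h⟩ := inAdd_iff.1 (hX.of_retract eR)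
    have h' : (∑ j, (s j ≫ biprod.fst) ≫ (biprod.inl ≫ r j)) +
        (∑ j, (s j ≫ biprod.snd) ≫ (biprod.inr ≫ r j)) = 𝟙 (F i) := by
      rw [← h, ← Finset.sum_add_distrib]
      refine Finset.sum_congr rfl fun j _ => ?_
      have h2 : s j ≫ (biprod.fst ≫ biprod.inl + biprod.snd ≫ biprod.inr) ≫ r j = s j ≫ r j := by
        rw [biprod.total, Category.id_comp]
      simpa only [Preadditive.comp_add, Preadditive.add_comp, Category.assoc] using h2
    rcases IsLocalRing.isUnit_or_isUnit_of_add_one (R := End (F i)) h' with h1 | h1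
    · exact hne (hV _ (inAdd_of_isIso_sum _ _ ((isUnit_iff_isIso _).1 h1)) (hU.of_retract eR))
    · exact hne (hW _ (inAdd_of_isIso_sum _ _ ((isUnit_iff_isIso _).1 h1)) (hU.of_retract eR))
  rw [IsZero.iff_id_eq_zero, ← e.hom_inv_id]
  have : e.hom = 0 := by
    ext i
    exact (key i).elim
  rw [this, zero_comp]

/-- A direct sum over a disjoint union of index sets. -/
noncomputable def sumIso {ι κ : Type} [Finite ι] [Finite κ] (H : ι ⊕ κ → C) :
    (⨁ fun i => H (Sum.inl i)) ⊞ (⨁ fun i => H (Sum.inr i)) ≅ ⨁ H where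
  hom := biprod.desc (biproduct.desc fun i => biproduct.ι H (Sum.inl i))
    (biproduct.desc fun i => biproduct.ι H (Sum.inr i))
  inv := biproduct.desc fun x => match x with
    | Sum.inl i => biproduct.ι (fun i => H (Sum.inl i)) i ≫ biprod.inl
    | Sum.inr i => biproduct.ι (fun i => H (Sum.inr i)) i ≫ biprod.inr
  hom_inv_id := by
    apply biprod.hom_ext' <;> apply biproduct.hom_ext' <;> intro i <;> simp
  inv_hom_id := by
    apply biproduct.hom_ext'
    rintro (i | i) <;> simp

lemma isBasic_biprod {V W : C} (hV : IsBasic V) (hW : IsBasic W) (h : AddDisjoint V W) :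
    IsBasic (V ⊞ W) := by
  obtain ⟨ι, _, F, hF, hF', ⟨e⟩⟩ := hV
  obtain ⟨κ, _, G, hG, hG', ⟨e'⟩⟩ := hW
  have hFG : ∀ i j, IsEmpty (F i ≅ G j) := fun i j => ⟨fun a => (hF i).1 (h _
    ((inAdd_self V).of_retract ⟨biproduct.ι F i ≫ e.inv, e.hom ≫ biproduct.π F i, by simp⟩)
    ((inAdd_self W).of_retract ⟨a.hom ≫ biproduct.ι G j ≫ e'.inv,
      e'.hom ≫ biproduct.π G j ≫ a.inv, by simp⟩))⟩
  refine ⟨ι ⊕ κ, inferInstance, Sum.elim F G, ?_, ?_, ⟨biprod.mapIso e e' ≪≫ ?_⟩⟩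
  · rintro (i | i)
    · exact hF i
    · exact hG i
  · rintro (i | i) (j | j) hij
    · exact congrArg _ (hF' i j hij)
    · exact (hij.elim (hFG i j).false).elim
    · exact (hij.elim fun a => (hFG j i).false a.symm).elim
    · exact congrArg _ (hG' i j hij)
  · exact sumIso (Sum.elim F G)

lemma isBasic_of_isZero {Z : C} (hZ : IsZero Z) : IsBasic Z :=
  ⟨Empty, inferInstance, Empty.elim, fun i => i.elim, fun i => i.elim,
    ⟨hZ.iso (by
      rw [IsZero.iff_id_eq_zero]
      apply biproduct.hom_ext
      exact fun i => i.elim)⟩⟩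

lemma IsoClass.zero_sum (x : IsoClass C) :
    IsoClass.sum (IsoClass.mk (zeroObj C)) x = x := by
  induction x using Quotient.inductionOn with
  | h X => exact Quotient.sound ⟨(isoZeroBiprod isZero_zeroObj).symm⟩

lemma IsoClass.sum_zero (x : IsoClass C) :
    IsoClass.sum x (IsoClass.mk (zeroObj C)) = x := by
  induction x using Quotient.inductionOn with
  | h X => exact Quotient.sound ⟨(isoBiprodZero isZero_zeroObj).symm⟩

lemma IsoClass.sum_assoc (x y z : IsoClass C) :
    IsoClass.sum (IsoClass.sum x y) z = IsoClass.sum x (IsoClass.sum y z) := by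
  induction x using Quotient.inductionOn with
  | h X =>
    induction y using Quotient.inductionOn with
    | h Y =>
      induction z using Quotient.inductionOn with
      | h Z => exact Quotient.sound ⟨biprod.associator X Y Z⟩

end Additive

/-! ## Extriangulated categories -/

/-- The data `(𝔼, 𝔰)` of an additive bifunctor `𝔼 : Cᵒᵖ × C → Ab` and of a relation
"`A ⟶ B ⟶ Z` belongs to the class `𝔰 δ`" for `δ ∈ 𝔼(Z, A)`.
Here `push f = f_*` and `pull g = g^*`. -/
class ExtriangulatedData (C : Type u) [Category.{v} C] [Preadditive C] where
  /-- the group `𝔼(Z, A)` -/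
  Ext : C → C → Type w
  [addCommGroup : ∀ Z A : C, AddCommGroup (Ext Z A)]
  push : ∀ {Z A A' : C}, (A ⟶ A') → (Ext Z A →+ Ext Z A')
  pull : ∀ {Z Z' A : C}, (Z' ⟶ Z) → (Ext Z A →+ Ext Z' A)
  push_id : ∀ {Z A : C} (δ : Ext Z A), push (𝟙 A) δ = δ
  push_comp : ∀ {Z A A' A'' : C} (f : A ⟶ A') (f' : A' ⟶ A'') (δ : Ext Z A),
    push (f ≫ f') δ = push f' (push f δ)
  push_add : ∀ {Z A A' : C} (f f' : A ⟶ A') (δ : Ext Z A),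
    push (f + f') δ = push f δ + push f' δ
  pull_id : ∀ {Z A : C} (δ : Ext Z A), pull (𝟙 Z) δ = δ
  pull_comp : ∀ {Z Z' Z'' A : C} (g' : Z'' ⟶ Z') (g : Z' ⟶ Z) (δ : Ext Z A),
    pull (g' ≫ g) δ = pull g' (pull g δ)
  pull_add : ∀ {Z Z' A : C} (g g' : Z' ⟶ Z) (δ : Ext Z A),
    pull (g + g') δ = pull g δ + pull g' δ
  push_pull : ∀ {Z Z' A A' : C} (f : A ⟶ A') (g : Z' ⟶ Z) (δ : Ext Z A),
    push f (pull g δ) = pull g (push f δ)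
  /-- `Realizes δ i p` : the sequence `A ⟶ B ⟶ Z` lies in the class `𝔰 δ` -/
  Realizes : ∀ {Z A B : C}, Ext Z A → (A ⟶ B) → (B ⟶ Z) → Prop

open ExtriangulatedData

attribute [reducible, instance] ExtriangulatedData.addCommGroup

section

variable {C : Type u} [Category.{v} C] [Preadditive C] [ExtriangulatedData.{w} C]

lemma push_zero {Z A A' : C} (δ : Ext Z A) : push (0 : A ⟶ A') δ = 0 := by
  simpa using push_add (0 : A ⟶ A') 0 δ

lemma pull_zero {Z Z' A : C} (δ : Ext Z A) : pull (0 : Z' ⟶ Z) δ = 0 := by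
  simpa using pull_add (0 : Z' ⟶ Z) 0 δ

/-- `U` is presilting: `𝔼(U, U) = 0`. -/
def IsPresilting (U : C) : Prop := Subsingleton (Ext U U)

/-- The subcategory `C_U = {X | 𝔼(U, X) = 0 = 𝔼(X, U)}`. -/
def perp (U : C) : ObjectProperty C := fun X =>
  Subsingleton (Ext U X) ∧ Subsingleton (Ext X U)

lemma perp_symm {X Y : C} (h : perp X Y) : perp Y X := ⟨h.2, h.1⟩

lemma isPresilting_iff (U : C) : IsPresilting U ↔ perp U U := ⟨fun h => ⟨h, h⟩, fun h => h.1⟩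

lemma perp_retract {U X Y : C} (hX : perp U X) (e : Retract Y X) : perp U Y := by
  have := hX.1
  have := hX.2
  refine ⟨subsingleton_of_forall_eq 0 fun δ => ?_, subsingleton_of_forall_eq 0 fun δ => ?_⟩
  · rw [← push_id δ, ← e.retract, push_comp, Subsingleton.elim (push e.i δ) 0, map_zero]
  · rw [← pull_id δ, ← e.retract, pull_comp, Subsingleton.elim (pull e.r δ) 0, map_zero]

lemma perp_isZero {Z : C} (hZ : IsZero Z) (X : C) : perp Z X := by
  refine ⟨subsingleton_of_forall_eq 0 fun δ => ?_, subsingleton_of_forall_eq 0 fun δ => ?_⟩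
  · rw [← pull_id δ, hZ.eq_of_src (𝟙 Z) 0, pull_zero]
  · rw [← push_id δ, hZ.eq_of_src (𝟙 Z) 0, push_zero]

end

section Extriangulated

variable {C : Type u} [Category.{v} C] [Preadditive C] [HasFiniteBiproducts C]
  [ExtriangulatedData.{w} C]

/-- The extension `δ ⊕ δ'`, the image of `(δ, 0, 0, δ')` in `𝔼(Z ⊕ Z', A ⊕ A')`. -/
noncomputable def extSum {Z A Z' A' : C} (δ : Ext Z A) (δ' : Ext Z' A') :
    Ext (Z ⊞ Z') (A ⊞ A') :=
  push biprod.inl (pull biprod.fst δ) + push biprod.inr (pull biprod.snd δ')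

variable (C) in
/-- The axioms (ET2), (ET3), (ET3)ᵒᵖ, (ET4), (ET4)ᵒᵖ of an extriangulated category
((ET1) is part of `ExtriangulatedData`). -/
class IsExtriangulated : Prop where
  /-- `𝔰 δ` is an equivalence class of sequences: it is non-empty ... -/
  exists_realizes : ∀ {Z A : C} (δ : Ext Z A),
    ∃ (B : C) (i : A ⟶ B) (p : B ⟶ Z), Realizes δ i p
  /-- ... and consists of all the sequences equivalent to any one of its members. -/
  realizes_iff : ∀ {Z A B B' : C} (δ : Ext Z A) (i : A ⟶ B) (p : B ⟶ Z) (i' : A ⟶ B')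
    (p' : B' ⟶ Z), Realizes δ i p →
      (Realizes δ i' p' ↔ ∃ e : B ≅ B', i ≫ e.hom = i' ∧ e.hom ≫ p' = p)
  /-- A morphism of extensions is realized by a morphism of sequences. -/
  exists_middle : ∀ {Z A B Z' A' B' : C} (δ : Ext Z A) (δ' : Ext Z' A')
    (i : A ⟶ B) (p : B ⟶ Z) (i' : A' ⟶ B') (p' : B' ⟶ Z') (f : A ⟶ A') (h : Z ⟶ Z'),
    Realizes δ i p → Realizes δ' i' p' → push f δ = pull h δ' →
      ∃ g : B ⟶ B', i ≫ g = f ≫ i' ∧ p ≫ h = g ≫ p'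
  realizes_zero : ∀ Z A : C,
    Realizes (0 : Ext Z A) (biprod.inl : A ⟶ A ⊞ Z) (biprod.snd : A ⊞ Z ⟶ Z)
  realizes_sum : ∀ {Z A B Z' A' B' : C} (δ : Ext Z A) (δ' : Ext Z' A')
    (i : A ⟶ B) (p : B ⟶ Z) (i' : A' ⟶ B') (p' : B' ⟶ Z'),
    Realizes δ i p → Realizes δ' i' p' →
      Realizes (extSum δ δ') (biprod.map i i') (biprod.map p p')
  et3 : ∀ {Z A B Z' A' B' : C} (δ : Ext Z A) (δ' : Ext Z' A')
    (i : A ⟶ B) (p : B ⟶ Z) (i' : A' ⟶ B') (p' : B' ⟶ Z') (f : A ⟶ A') (g : B ⟶ B'),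
    Realizes δ i p → Realizes δ' i' p' → i ≫ g = f ≫ i' →
      ∃ h : Z ⟶ Z', p ≫ h = g ≫ p' ∧ push f δ = pull h δ'
  et3_op : ∀ {Z A B Z' A' B' : C} (δ : Ext Z A) (δ' : Ext Z' A')
    (i : A ⟶ B) (p : B ⟶ Z) (i' : A' ⟶ B') (p' : B' ⟶ Z') (g : B ⟶ B') (h : Z ⟶ Z'),
    Realizes δ i p → Realizes δ' i' p' → p ≫ h = g ≫ p' →
      ∃ f : A ⟶ A', i ≫ g = f ≫ i' ∧ push f δ = pull h δ'
  et4 : ∀ {A B X Y W : C} (δ : Ext X A) (δ' : Ext W B)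
    (f : A ⟶ B) (f' : B ⟶ X) (g : B ⟶ Y) (g' : Y ⟶ W),
    Realizes δ f f' → Realizes δ' g g' →
      ∃ (V : C) (h' : Y ⟶ V) (d : X ⟶ V) (e : V ⟶ W) (δ'' : Ext V A),
        f' ≫ d = g ≫ h' ∧ h' ≫ e = g' ∧
        Realizes δ'' (f ≫ g) h' ∧ Realizes (push f' δ') d e ∧
        pull d δ'' = δ ∧ push f δ'' = pull e δ'
  et4_op : ∀ {A B X Y W : C} (δ : Ext B X) (δ' : Ext A W)
    (f' : X ⟶ Y) (f : Y ⟶ B) (g' : W ⟶ B) (g : B ⟶ A),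
    Realizes δ f' f → Realizes δ' g' g →
      ∃ (V : C) (h' : V ⟶ Y) (d : X ⟶ V) (e : V ⟶ W) (δ'' : Ext A V),
        h' ≫ f = e ≫ g' ∧ d ≫ h' = f' ∧
        Realizes δ'' h' (f ≫ g) ∧ Realizes (pull g' δ) d e ∧
        push e δ'' = δ' ∧ pull g δ'' = push d δ

/-! ## Projectives, injectives, 0-Auslander categories -/

/-- `p` is a deflation. -/
def IsDeflation {B Z : C} (p : B ⟶ Z) : Prop :=
  ∃ (A : C) (δ : Ext Z A) (i : A ⟶ B), Realizes δ i p

/-- `i` is an inflation. -/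
def IsInflation {A B : C} (i : A ⟶ B) : Prop :=
  ∃ (Z : C) (δ : Ext Z A) (p : B ⟶ Z), Realizes δ i p

/-- `A ⟶ B ⟶ Z` is a conflation. -/
def IsConflation {A B Z : C} (i : A ⟶ B) (p : B ⟶ Z) : Prop :=
  ∃ δ : Ext Z A, Realizes δ i p

/-- Projectives of an extriangulated category. -/
def IsProj (P : C) : Prop :=
  ∀ ⦃B Z : C⦄ (p : B ⟶ Z), IsDeflation p → ∀ f : P ⟶ Z, ∃ g : P ⟶ B, g ≫ p = f

/-- Injectives of an extriangulated category. -/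
def IsInj (I : C) : Prop :=
  ∀ ⦃A B : C⦄ (i : A ⟶ B), IsInflation i → ∀ f : A ⟶ I, ∃ g : B ⟶ I, i ≫ g = f

variable (C) in
/-- `C` is a reduced 0-Auslander extriangulated category. -/
class IsReducedZeroAuslander : Prop extends IsExtriangulated C where
  enough_proj : ∀ X : C, ∃ (P : C) (p : P ⟶ X), IsProj P ∧ IsDeflation p
  exists_presentation : ∀ X : C, ∃ (P₁ P₀ : C) (i : P₁ ⟶ P₀) (p : P₀ ⟶ X),
    IsProj P₁ ∧ IsProj P₀ ∧ IsConflation i p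
  exists_coresolution : ∀ P : C, IsProj P → ∃ (Q I : C) (i : P ⟶ Q) (p : Q ⟶ I),
    IsProj Q ∧ IsInj Q ∧ IsInj I ∧ IsConflation i p
  reduced : ∀ Q : C, IsProj Q → IsInj Q → IsZero Q

/-- `I` is `ΣP`, i.e. there is a conflation `P ⟶ 0 ⟶ I`. -/
def IsSuspension (P I : C) : Prop :=
  ∃ (N : C) (i : P ⟶ N) (p : N ⟶ I), IsZero N ∧ IsConflation i p

/-! ## The reduction `C_U / [U]` -/

lemma perp_of_inAdd {U X W : C} (hX : perp U X) (hW : InAdd U W) : perp W X := by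
  obtain ⟨n, s, r, h⟩ := inAdd_iff.1 hW
  have := hX.1
  have := hX.2
  refine ⟨subsingleton_of_forall_eq 0 fun δ => ?_, subsingleton_of_forall_eq 0 fun δ => ?_⟩
  · have key : ∀ t : Finset (Fin n), pull (∑ i ∈ t, s i ≫ r i) δ = 0 := by
      intro t
      induction t using Finset.induction_on with
      | empty => simpa using pull_zero δ
      | insert a t ha ih =>
        rw [Finset.sum_insert ha, pull_add, ih, pull_comp,
          Subsingleton.elim (pull (r a) δ) 0, map_zero, add_zero]
    rw [← pull_id δ, ← h, key]
  · have key : ∀ t : Finset (Fin n), push (∑ i ∈ t, s i ≫ r i) δ = 0 := by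
      intro t
      induction t using Finset.induction_on with
      | empty => simpa using push_zero δ
      | insert a t ha ih =>
        rw [Finset.sum_insert ha, push_add, ih, push_comp,
          Subsingleton.elim (push (s a) δ) 0, map_zero, add_zero]
    rw [← push_id δ, ← h, key]

/-- `f` and `g` agree modulo the ideal `[U]` of morphisms of `C_U` factoring through `add U`. -/
def idealRel (U : C) : HomRel (perp U).FullSubcategory := fun X Y f g =>
  ∃ (W : C) (_ : InAdd U W) (a : X.obj ⟶ W) (b : W ⟶ Y.obj), f.hom - g.hom = a ≫ b

instance (U : C) : Congruence (idealRel U) where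
  comp_left := by
    rintro X Y Z f g g' ⟨W, hW, a, b, h⟩
    exact ⟨W, hW, f.hom ≫ a, b, by
      simp only [ObjectProperty.FullSubcategory.comp_hom, ← Preadditive.comp_sub, h,
        Category.assoc]⟩
  comp_right := by
    rintro X Y Z f f' g ⟨W, hW, a, b, h⟩
    exact ⟨W, hW, a, b ≫ g.hom, by
      simp only [ObjectProperty.FullSubcategory.comp_hom, ← Preadditive.sub_comp, h,
        Category.assoc]⟩
  equivalence :=
    { refl := fun f => ⟨U, inAdd_self U, 0, 0, by simp⟩
      symm := by
        rintro f g ⟨W, hW, a, b, h⟩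
        exact ⟨W, hW, -a, b, by rw [Preadditive.neg_comp, ← h, neg_sub]⟩
      trans := by
        rintro f g k ⟨W, hW, a, b, h⟩ ⟨W', hW', a', b', h'⟩
        exact ⟨W ⊞ W', hW.biprod hW', biprod.lift a a', biprod.desc b b', by
          rw [biprod.lift_desc, ← h, ← h', sub_add_sub_cancel]⟩ }

/-- The presilting reduction `C_U / [U]`. -/
def Reduction (U : C) : Type u := CategoryTheory.Quotient (idealRel U)

instance (U : C) : Category.{v} (Reduction U) :=
  inferInstanceAs (Category (CategoryTheory.Quotient (idealRel U)))

lemma idealRel_add (U : C) ⦃X Y : (perp U).FullSubcategory⦄ (f₁ f₂ g₁ g₂ : X ⟶ Y)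
    (hf : idealRel U f₁ f₂) (hg : idealRel U g₁ g₂) : idealRel U (f₁ + g₁) (f₂ + g₂) := by
  obtain ⟨W, hW, a, b, h⟩ := hf
  obtain ⟨W', hW', a', b', h'⟩ := hg
  refine ⟨W ⊞ W', hW.biprod hW', biprod.lift a a', biprod.desc b b', ?_⟩
  rw [biprod.lift_desc, ← h, ← h']
  exact add_sub_add_comm _ _ _ _

instance (U : C) : Preadditive (Reduction U) :=
  CategoryTheory.Quotient.preadditive (idealRel U) (idealRel_add U)

/-- The projection `π_U : C_U ⥤ C_U / [U]`. -/
def projFunctor (U : C) : (perp U).FullSubcategory ⥤ Reduction U :=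
  CategoryTheory.Quotient.functor (idealRel U)

/-- An object of `C_U`, viewed as an object of `C_U / [U]`. -/
def Reduction.of (U X : C) (hX : perp U X) : Reduction U := (projFunctor U).obj ⟨X, hX⟩

instance (U : C) : (projFunctor U).Additive :=
  CategoryTheory.Quotient.functor_additive (idealRel U) (idealRel_add U)

lemma perp_biproduct (U : C) {n : ℕ} (F : Fin n → C) (hF : ∀ i, perp U (F i)) :
    perp U (⨁ F) := by
  have h := biproduct.total (f := F)
  refine ⟨subsingleton_of_forall_eq 0 fun δ => ?_, subsingleton_of_forall_eq 0 fun δ => ?_⟩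
  · have key : ∀ t : Finset (Fin n), push (∑ i ∈ t, biproduct.π F i ≫ biproduct.ι F i) δ = 0 := by
      intro t
      induction t using Finset.induction_on with
      | empty => simpa using push_zero δ
      | insert a t ha ih =>
        have := (hF a).1
        rw [Finset.sum_insert ha, push_add, ih, push_comp,
          Subsingleton.elim (push (biproduct.π F a) δ) 0, map_zero, add_zero]
    rw [← push_id δ, ← h, key]
  · have key : ∀ t : Finset (Fin n), pull (∑ i ∈ t, biproduct.π F i ≫ biproduct.ι F i) δ = 0 := by
      intro t
      induction t using Finset.induction_on with
      | empty => simpa using pull_zero δ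
      | insert a t ha ih =>
        have := (hF a).2
        rw [Finset.sum_insert ha, pull_add, ih, pull_comp,
          Subsingleton.elim (pull (biproduct.ι F a) δ) 0, map_zero, add_zero]
    rw [← pull_id δ, ← h, key]

instance (U : C) : HasFiniteBiproducts (perp U).FullSubcategory where
  out n :=
    { has_biproduct := fun F => by
        let G : Fin n → C := fun i => (F i).obj
        let b : Bicone F :=
          { pt := ⟨⨁ G, perp_biproduct U G fun i => (F i).property⟩
            π := fun i => ObjectProperty.homMk (biproduct.π G i)
            ι := fun i => ObjectProperty.homMk (biproduct.ι G i)
            ι_π := fun i j => by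
              ext
              by_cases hij : i = j
              · subst hij; simp [G]
              · simp [hij, G] }
        refine HasBiproduct.mk ⟨b, isBilimitOfTotal b ?_⟩
        apply (perp U).ι.map_injective
        rw [Functor.map_sum]
        exact biproduct.total (f := G) }

instance (U : C) : HasFiniteBiproducts (Reduction U) where
  out n :=
    { has_biproduct := fun F => by
        let G : Fin n → (perp U).FullSubcategory := fun i => CategoryTheory.Quotient.as (F i)
        exact HasBiproduct.mk
          ⟨(projFunctor U).mapBicone (biproduct.bicone G),
            isBilimitOfPreserves (projFunctor U) (biproduct.isBilimit G)⟩ }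

lemma push_eq_of_idealRel {U : C} {X Y Z : (perp U).FullSubcategory} {f g : X ⟶ Y}
    (h : idealRel U f g) (δ : Ext Z.obj X.obj) : push f.hom δ = push g.hom δ := by
  obtain ⟨W, hW, a, b, h⟩ := h
  have := (perp_of_inAdd Z.property hW).2
  rw [← sub_add_cancel f.hom g.hom, push_add, h, push_comp,
    Subsingleton.elim (push a δ) 0, map_zero, zero_add]

lemma pull_eq_of_idealRel {U : C} {X Y Z : (perp U).FullSubcategory} {f g : X ⟶ Y}
    (h : idealRel U f g) (δ : Ext Y.obj Z.obj) : pull f.hom δ = pull g.hom δ := by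
  obtain ⟨W, hW, a, b, h⟩ := h
  have := (perp_of_inAdd Z.property hW).1
  rw [← sub_add_cancel f.hom g.hom, pull_add, h, pull_comp,
    Subsingleton.elim (pull b δ) 0, map_zero, zero_add]

/-- The extriangulated data of `C_U / [U]` induced from `C`: the bifunctor is the restriction of
`𝔼` to `C_U`, and the sequences realizing `δ` are those equivalent in `C_U / [U]` to the image
of a conflation of `C` that realizes `δ` and has all its terms in `C_U`. -/
instance (U : C) : ExtriangulatedData.{w} (Reduction U) where
  Ext Z A := Ext (C := C) (CategoryTheory.Quotient.as Z).obj (CategoryTheory.Quotient.as A).obj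
  push {Z A A'} f := Quot.lift
    (fun f₀ : CategoryTheory.Quotient.as A ⟶ CategoryTheory.Quotient.as A' => push f₀.hom)
    (fun f₀ f₁ h => by
      ext δ
      exact push_eq_of_idealRel (Z := CategoryTheory.Quotient.as Z)
        ((HomRel.compClosure_iff_self (idealRel U) _ _).1 h) δ) f
  pull {Z Z' A} g := Quot.lift
    (fun g₀ : CategoryTheory.Quotient.as Z' ⟶ CategoryTheory.Quotient.as Z => pull g₀.hom)
    (fun g₀ g₁ h => by
      ext δ
      exact pull_eq_of_idealRel (Z := CategoryTheory.Quotient.as A)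
        ((HomRel.compClosure_iff_self (idealRel U) _ _).1 h) δ) g
  push_id δ := push_id (C := C) δ
  push_comp f g δ := by
    obtain ⟨f⟩ := f
    obtain ⟨g⟩ := g
    exact push_comp (C := C) f.hom g.hom δ
  push_add f g δ := by
    obtain ⟨f⟩ := f
    obtain ⟨g⟩ := g
    exact push_add (C := C) f.hom g.hom δ
  pull_id δ := pull_id (C := C) δ
  pull_comp f g δ := by
    obtain ⟨f⟩ := f
    obtain ⟨g⟩ := g
    exact pull_comp (C := C) f.hom g.hom δ
  pull_add f g δ := by
    obtain ⟨f⟩ := f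
    obtain ⟨g⟩ := g
    exact pull_add (C := C) f.hom g.hom δ
  push_pull f g δ := by
    obtain ⟨f⟩ := f
    obtain ⟨g⟩ := g
    exact push_pull (C := C) f.hom g.hom δ
  Realizes {Z A B} δ i p := ∃ (B₀ : (perp U).FullSubcategory)
    (i₀ : CategoryTheory.Quotient.as A ⟶ B₀) (p₀ : B₀ ⟶ CategoryTheory.Quotient.as Z)
    (e : (projFunctor U).obj B₀ ≅ B),
    Realizes (C := C) δ i₀.hom p₀.hom ∧
      (projFunctor U).map i₀ ≫ e.hom = i ∧ e.hom ≫ p = (projFunctor U).map p₀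

end Extriangulated

/-! ## Signed presilting sequences -/

/-- `(X 0, …, X (t - 1))` is a signed presilting sequence in `D`: all entries are indecomposable,
the last entry `X_t` is a non-injective presilting object or an injective object `ΣP` with `P`
indecomposable projective, and the other entries form a signed presilting sequence in the
reduction `D_{X_t} / [X_t]`. -/
def IsSignedPresilting : (t : ℕ) → (D : Type u) → [Category.{v} D] → [Preadditive D] →
    [HasFiniteBiproducts D] → [ExtriangulatedData.{w} D] → (Fin t → D) → Prop
  | 0, _, _, _, _, _, _ => True
  | t + 1, _, _, _, _, _, X =>
    (∀ i, Indecomposable (X i)) ∧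
    ((¬ IsInj (X (Fin.last t)) ∧ IsPresilting (X (Fin.last t))) ∨
      (IsInj (X (Fin.last t)) ∧
        ∃ P, Indecomposable P ∧ IsProj P ∧ IsSuspension P (X (Fin.last t)))) ∧
    ∃ h : ∀ i : Fin t, perp (X (Fin.last t)) (X i.castSucc),
      IsSignedPresilting t (Reduction (X (Fin.last t)))
        fun i => Reduction.of (X (Fin.last t)) (X i.castSucc) (h i)

/-- The set of signed presilting sequences `(U₁, …, U_t)` in `D`, up to isomorphism of the
entries, such that `V = U₁ ⊕ ⋯ ⊕ U_t`. -/
def SignedPresiltingSeq {D : Type u} [Category.{v} D] [Preadditive D] [HasFiniteBiproducts D]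
    [ExtriangulatedData.{w} D] (V : D) (t : ℕ) : Type u :=
  {s : Fin t → IsoClass D // ∃ X : Fin t → D, (∀ i, s i = IsoClass.mk (X i)) ∧
    IsSignedPresilting t D X ∧ Nonempty (V ≅ ⨁ X)}

/-! ## The τ-cluster morphism category -/

section Category

variable (C : Type u) [Category.{v} C] [Preadditive C] [HasFiniteBiproducts C]
  [ExtriangulatedData.{w} C]

/-- The objects of the τ-cluster morphism category: the subcategories `C_U`, `U` presilting. -/
structure TauObj where
  carrier : ObjectProperty C
  exists_eq : ∃ U : C, IsPresilting U ∧ carrier = perp U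

variable {C}

/-- The conditions on an object `V` under which `h_V` is a morphism `B₁ ⟶ B₂`: `V` is a basic
presilting object of `B₁ = C_U`, `add V ∩ add U = 0`, and `B₂ = (B₁)_V`.
(`add U` depends only on `C_U`, so the condition is the same for all `U` with `B₁ = C_U`.) -/
structure IsLabel (B₁ B₂ : TauObj C) (V : C) : Prop where
  mem : B₁.carrier V
  presilting : IsPresilting V
  basic : IsBasic V
  disjoint : ∀ U : C, IsPresilting U → B₁.carrier = perp U → AddDisjoint V U
  target : B₂.carrier = B₁.carrier ⊓ perp V

lemma perp_mem_biprod {U X Y : C} (hX : perp U X) (hY : perp U Y) : perp U (X ⊞ Y) := by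
  have := hX.1
  have := hX.2
  have := hY.1
  have := hY.2
  refine ⟨subsingleton_of_forall_eq 0 fun δ => ?_, subsingleton_of_forall_eq 0 fun δ => ?_⟩
  · rw [← push_id δ, ← biprod.total, push_add, push_comp, push_comp,
      Subsingleton.elim (push biprod.fst δ) 0, Subsingleton.elim (push biprod.snd δ) 0]
    simp
  · rw [← pull_id δ, ← biprod.total, pull_add, pull_comp, pull_comp,
      Subsingleton.elim (pull biprod.inl δ) 0, Subsingleton.elim (pull biprod.inr δ) 0]
    simp

lemma perp_biprod (V W : C) : perp (V ⊞ W) = perp V ⊓ perp W := by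
  ext X
  constructor
  · intro h
    have h := perp_symm h
    exact ⟨perp_symm (perp_retract h ⟨biprod.inl, biprod.fst, by simp⟩),
      perp_symm (perp_retract h ⟨biprod.inr, biprod.snd, by simp⟩)⟩
  · rintro ⟨h, h'⟩
    exact perp_symm (perp_mem_biprod (perp_symm h) (perp_symm h'))

lemma isPresilting_biprod {V W : C} (hV : IsPresilting V) (hW : IsPresilting W)
    (h : perp V W) : IsPresilting (V ⊞ W) := by
  rw [isPresilting_iff, perp_biprod]
  exact ⟨perp_mem_biprod ((isPresilting_iff V).1 hV) h,
    perp_mem_biprod (perp_symm h) ((isPresilting_iff W).1 hW)⟩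

lemma isLabel_zero (B : TauObj C) : IsLabel B B (zeroObj C) where
  mem := by
    obtain ⟨U, -, h⟩ := B.exists_eq
    rw [h]
    exact perp_symm (perp_isZero isZero_zeroObj U)
  presilting := (isPresilting_iff _).2 (perp_isZero isZero_zeroObj _)
  basic := isBasic_of_isZero isZero_zeroObj
  disjoint _ _ _ _ hX _ := isZero_of_inAdd_isZero isZero_zeroObj hX
  target := by
    ext X
    exact ⟨fun h => ⟨h, perp_isZero isZero_zeroObj X⟩, fun h => h.1⟩

lemma IsLabel.comp [IsKrullSchmidt C] {B₁ B₂ B₃ : TauObj C} {V W : C} (hV : IsLabel B₁ B₂ V)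
    (hW : IsLabel B₂ B₃ W) : IsLabel B₁ B₃ (V ⊞ W) := by
  have hW' : B₁.carrier W ∧ perp V W := by
    have := hW.mem
    rw [hV.target] at this
    exact this
  have hdis : ∀ U : C, IsPresilting U → B₁.carrier = perp U →
      AddDisjoint W U ∧ AddDisjoint W V := by
    intro U hU hB
    have hUV : perp U V := hB ▸ hV.mem
    have h := hW.disjoint (U ⊞ V) (isPresilting_biprod hU hV.presilting hUV)
      (by rw [hV.target, hB, perp_biprod])
    exact ⟨fun X hX hX' => h X hX (inAdd_biprod_left hX'),
      fun X hX hX' => h X hX (inAdd_biprod_right hX')⟩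
  refine ⟨?_, isPresilting_biprod hV.presilting hW.presilting hW'.2, ?_, ?_, ?_⟩
  · obtain ⟨U, -, h⟩ := B₁.exists_eq
    have h1 := hV.mem
    have h2 := hW'.1
    rw [h] at h1 h2 ⊢
    exact perp_mem_biprod h1 h2
  · obtain ⟨U, hU, h⟩ := B₁.exists_eq
    exact isBasic_biprod hV.basic hW.basic (hdis U hU h).2.symm
  · intro U hU hB
    exact addDisjoint_biprod (hV.disjoint U hU hB) (hdis U hU hB).1
  · rw [hW.target, hV.target, perp_biprod, inf_assoc]

/-- A morphism `h_V : B₁ ⟶ B₂`; the object `V` matters only up to isomorphism. -/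
@[ext]
structure TauHom (B₁ B₂ : TauObj C) where
  label : IsoClass C
  isLabel : ∃ V : C, label = IsoClass.mk V ∧ IsLabel B₁ B₂ V


/-- `h_W ∘ h_V = h_{V ⊕ W}`, and the identity of `B` is `h_0`. -/
noncomputable instance [IsKrullSchmidt C] : Category (TauObj C) where
  Hom := TauHom
  id B := ⟨IsoClass.mk (zeroObj C), _, rfl, isLabel_zero B⟩
  comp f g := ⟨IsoClass.sum f.label g.label, by
    obtain ⟨V, hV, hV'⟩ := f.isLabel
    obtain ⟨W, hW, hW'⟩ := g.isLabel
    exact ⟨V ⊞ W, (congrArg₂ IsoClass.sum hV hW), hV'.comp hW'⟩⟩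
  id_comp f := TauHom.ext (IsoClass.zero_sum f.label)
  comp_id f := TauHom.ext (IsoClass.sum_zero f.label)
  assoc f g h := TauHom.ext (IsoClass.sum_assoc f.label g.label h.label)

/-- The object `V` of a morphism `h_V`, up to isomorphism. -/
def homLabel [IsKrullSchmidt C] {B₁ B₂ : TauObj C} (h : B₁ ⟶ B₂) : IsoClass C :=
  TauHom.label h

/-- `f` is an identity morphism. -/
def IsIdentity {D : Type*} [Category D] {X Y : D} (f : X ⟶ Y) : Prop :=
  ∃ h : X = Y, f = eqToHom h

/-- Irreducible morphisms: the non-identity morphisms `h` such that in every factorisation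
`h = h₁ ∘ h₂` one of `h₁`, `h₂` is an identity. -/
def irreducibles (D : Type*) [Category D] : MorphismProperty D := fun X Y h =>
  ¬ IsIdentity h ∧
    ∀ (Z : D) (h₂ : X ⟶ Z) (h₁ : Z ⟶ Y), h₂ ≫ h₁ = h → IsIdentity h₁ ∨ IsIdentity h₂

/-- The factorisations of `h` into compositions of irreducible morphisms. -/
def IrreducibleFactorisation {D : Type*} [Category D] {X Y : D} (h : X ⟶ Y) :=
  {p : Quiver.Path X Y // (irreducibles D).paths p ∧ composePath p = h}

/-- For the factorisation `h_{U₁} ∘ ⋯ ∘ h_{U_t}` (a path whose first arrow is `h_{U_t}`) this is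
the list `[U₁, …, U_t]`. -/
def pathLabels [IsKrullSchmidt C] {B : TauObj C} :
    {B' : TauObj C} → Quiver.Path B B' → List (IsoClass C)
  | _, .nil => []
  | _, .cons p h => homLabel h :: pathLabels p

/-- The isomorphism class `y` in `C_U / [U]` is that of an object of `C_U` whose isomorphism class
in `C` is `x`. -/
def Represents (U : C) (x : IsoClass C) (y : IsoClass (Reduction U)) : Prop :=
  ∃ (X : C) (hX : perp U X), x = IsoClass.mk X ∧ y = IsoClass.mk (Reduction.of U X hX)

/-- The object `C_U` of the τ-cluster morphism category. -/
def TauObj.of (U : C) (hU : IsPresilting U) : TauObj C := ⟨perp U, U, hU, rfl⟩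

end Category

end TauCluster

open TauCluster

/-!
The theorem rests on one structural fact: if `U` is presilting in a reduced 0-Auslander
category `C`, then the reduction `C_U / [U]` is again reduced 0-Auslander
(`isReducedZeroAuslander_reduction`).

* `C_U` is closed under extensions and `U` is projective and injective in it, so that commutative
  squares of the quotient can be corrected to commutative squares of `C`. Hence the axioms
  (ET2)–(ET4) descend to `C_U / [U]`.
* Extending a presentation `P₁ ⟶ P₀ ⟶ X` of `X` in `C_U` along the universal extension of `P₁` by
  copies of `U` gives a presentation `B ⟶ M ⟶ X` by objects which are projective in `C_U`
  (`exists_bongartz_presentation`).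
* Since `P₀ ⟶ 0` is an inflation, so is the left `add U`-approximation of `P₀`, and its pushout is
  an inflation from `M` to an object of `add U`, which becomes zero in the quotient
  (`exists_inflation_to_add`).

In a reduced 0-Auslander category every indecomposable injective `I` is the suspension of an
indecomposable projective (`exists_isSuspension`): `I` is a summand of some `ΣP₁`, so `0 ⟶ I` is a
deflation. Applied to all iterated reductions, this makes the condition on injective entries of a
signed presilting sequence automatic. Consequently the signed presilting sequences with sum `V` are
the orderings of the indecomposable summands of `V` (`isSignedPresilting_iff`).

On the other side, decompositions of the label of a morphism correspond to factorisations of the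
morphism (`exists_factorisation`), because `add U` is determined by `C_U` (`inAdd_of_perp_eq`: a
projective-injective object of the reduction is zero). So a morphism is irreducible iff its label is
indecomposable, and its factorisations into irreducibles are the orderings of the indecomposable
summands of its label (`nodup_pathLabels`, `path_ext`, `exists_path`).

Finally, the ideal `[U]` lies in the radical on objects without summands in `add U`
(`isIso_of_factorsAdd_sub_id`). Hence such objects are determined up to isomorphism by their images
in the reduction, every basic object of the reduction lifts to one of them, and the two kinds of
orderings correspond.
-/

namespace TauCluster

open ExtriangulatedData

/-! ### Exact sequences from (ET2) and (ET3) -/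

section ExtriangulatedData

variable {C : Type u} [Category.{v} C] [Preadditive C] [ExtriangulatedData.{w} C]

lemma subsingleton_ext_retract_left {X Y A : C} (e : Retract Y X) (h : Subsingleton (Ext X A)) :
    Subsingleton (Ext Y A) :=
  subsingleton_of_forall_eq 0 fun δ => by
    rw [← pull_id δ, ← e.retract, pull_comp, Subsingleton.elim (pull e.r δ) 0, map_zero]

end ExtriangulatedData

lemma isIso_of_isIso_comp_both {C : Type u} [Category.{v} C] {X Y : C} (f : X ⟶ Y) (g : Y ⟶ X)
    [IsIso (f ≫ g)] [IsIso (g ≫ f)] : IsIso f := by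
  have hl : f ≫ (g ≫ inv (f ≫ g)) = 𝟙 X := by rw [← Category.assoc, IsIso.hom_inv_id]
  have hr : (inv (g ≫ f) ≫ g) ≫ f = 𝟙 Y := by rw [Category.assoc, IsIso.inv_hom_id]
  have : g ≫ inv (f ≫ g) = inv (g ≫ f) ≫ g := by
    calc g ≫ inv (f ≫ g) = ((inv (g ≫ f) ≫ g) ≫ f) ≫ (g ≫ inv (f ≫ g)) := by
          rw [hr, Category.id_comp]
      _ = _ := by rw [Category.assoc, hl, Category.comp_id]
  exact ⟨_, hl, by rw [this, hr]⟩

section PreExtriangulated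

/-- The axioms (ET2), (ET3) and (ET3)ᵒᵖ alone. They already give the exact sequences of `𝔼`, and
these are needed for a reduction before (ET4) is known there. -/
class IsPreExtriangulated (C : Type u) [Category.{v} C] [Preadditive C] [HasFiniteBiproducts C]
    [ExtriangulatedData.{w} C] : Prop where
  exists_realizes : ∀ {Z A : C} (δ : Ext Z A),
    ∃ (B : C) (i : A ⟶ B) (p : B ⟶ Z), Realizes δ i p
  realizes_iff : ∀ {Z A B B' : C} (δ : Ext Z A) (i : A ⟶ B) (p : B ⟶ Z) (i' : A ⟶ B')
    (p' : B' ⟶ Z), Realizes δ i p →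
      (Realizes δ i' p' ↔ ∃ e : B ≅ B', i ≫ e.hom = i' ∧ e.hom ≫ p' = p)
  exists_middle : ∀ {Z A B Z' A' B' : C} (δ : Ext Z A) (δ' : Ext Z' A')
    (i : A ⟶ B) (p : B ⟶ Z) (i' : A' ⟶ B') (p' : B' ⟶ Z') (f : A ⟶ A') (h : Z ⟶ Z'),
    Realizes δ i p → Realizes δ' i' p' → push f δ = pull h δ' →
      ∃ g : B ⟶ B', i ≫ g = f ≫ i' ∧ p ≫ h = g ≫ p'
  realizes_zero : ∀ Z A : C,
    Realizes (0 : Ext Z A) (biprod.inl : A ⟶ A ⊞ Z) (biprod.snd : A ⊞ Z ⟶ Z)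
  et3 : ∀ {Z A B Z' A' B' : C} (δ : Ext Z A) (δ' : Ext Z' A')
    (i : A ⟶ B) (p : B ⟶ Z) (i' : A' ⟶ B') (p' : B' ⟶ Z') (f : A ⟶ A') (g : B ⟶ B'),
    Realizes δ i p → Realizes δ' i' p' → i ≫ g = f ≫ i' →
      ∃ h : Z ⟶ Z', p ≫ h = g ≫ p' ∧ push f δ = pull h δ'
  et3_op : ∀ {Z A B Z' A' B' : C} (δ : Ext Z A) (δ' : Ext Z' A')
    (i : A ⟶ B) (p : B ⟶ Z) (i' : A' ⟶ B') (p' : B' ⟶ Z') (g : B ⟶ B') (h : Z ⟶ Z'),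
    Realizes δ i p → Realizes δ' i' p' → p ≫ h = g ≫ p' →
      ∃ f : A ⟶ A', i ≫ g = f ≫ i' ∧ push f δ = pull h δ'

instance (C : Type u) [Category.{v} C] [Preadditive C] [HasFiniteBiproducts C]
    [ExtriangulatedData.{w} C] [IsExtriangulated C] : IsPreExtriangulated C where
  exists_realizes := IsExtriangulated.exists_realizes
  realizes_iff := IsExtriangulated.realizes_iff
  exists_middle := IsExtriangulated.exists_middle
  realizes_zero := IsExtriangulated.realizes_zero
  et3 := IsExtriangulated.et3
  et3_op := IsExtriangulated.et3_op

open IsPreExtriangulated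

variable {C : Type u} [Category.{v} C] [Preadditive C] [HasFiniteBiproducts C]
  [ExtriangulatedData.{w} C] [IsPreExtriangulated C]

namespace Realizes

variable {Z A B : C} {δ : Ext Z A} {i : A ⟶ B} {p : B ⟶ Z}

lemma comp_eq_zero (h : Realizes δ i p) : i ≫ p = 0 := by
  obtain ⟨x, hx, -⟩ := et3 _ _ _ _ _ _ (𝟙 A) (biprod.fst ≫ i)
    (realizes_zero (zeroObj C) A) h (by simp)
  have hs : (biprod.snd : A ⊞ zeroObj C ⟶ _) = 0 := isZero_zeroObj.eq_of_tgt _ _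
  rw [hs, zero_comp] at hx
  calc i ≫ p = biprod.inl ≫ (biprod.fst ≫ i) ≫ p := by simp
    _ = 0 := by rw [← hx, comp_zero]

lemma exists_extension (h : Realizes δ i p) {X : C} (f : A ⟶ X) (hf : push f δ = 0) :
    ∃ g : B ⟶ X, i ≫ g = f := by
  obtain ⟨g, hg, -⟩ := exists_middle _ _ _ _ _ _ f (0 : Z ⟶ zeroObj C) h
    (realizes_zero (zeroObj C) X) (by rw [hf, map_zero])
  exact ⟨g ≫ biprod.fst, by rw [← Category.assoc, hg]; simp⟩

lemma exists_lift (h : Realizes δ i p) {X : C} (f : X ⟶ Z) (hf : pull f δ = 0) :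
    ∃ g : X ⟶ B, g ≫ p = f := by
  obtain ⟨g, -, hg⟩ := exists_middle _ _ _ _ _ _ (0 : zeroObj C ⟶ A) f
    (realizes_zero X (zeroObj C)) h (by rw [hf, map_zero])
  exact ⟨biprod.inr ≫ g, by rw [Category.assoc, ← hg]; simp⟩

lemma push_comp_eq_zero (h : Realizes δ i p) {X : C} (g : B ⟶ X) : push (i ≫ g) δ = 0 := by
  obtain ⟨x, -, hx⟩ := et3 _ _ _ _ _ _ (i ≫ g) (g ≫ biprod.inl) h
    (realizes_zero (zeroObj C) X) (by simp)
  rw [hx, map_zero]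

lemma pull_comp_eq_zero (h : Realizes δ i p) {X : C} (g : X ⟶ B) : pull (g ≫ p) δ = 0 := by
  obtain ⟨x, -, hx⟩ := et3_op _ _ _ _ _ _ (biprod.snd ≫ g) (g ≫ p)
    (realizes_zero X (zeroObj C)) h (by simp)
  rw [← hx, map_zero]

lemma push_self (h : Realizes δ i p) : push i δ = 0 := by
  simpa using push_comp_eq_zero h (𝟙 _)

lemma exists_factor (h : Realizes δ i p) {X : C} (g : X ⟶ B) (hg : g ≫ p = 0) :
    ∃ k : X ⟶ A, k ≫ i = g := by
  obtain ⟨x, hx, -⟩ := et3_op _ _ _ _ _ _ (biprod.fst ≫ g) (0 : zeroObj C ⟶ Z)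
    (realizes_zero (zeroObj C) X) h (by rw [Category.assoc, hg]; simp)
  exact ⟨x, by simpa using hx.symm⟩

lemma exists_eq_push (h : Realizes δ i p) {X : C} (ε : Ext Z X) (hε : pull p ε = 0) :
    ∃ f : A ⟶ X, ε = push f δ := by
  obtain ⟨E, j, q, hE⟩ := exists_realizes ε
  obtain ⟨g, hg⟩ := exists_lift hE p hε
  obtain ⟨f, -, hf⟩ := et3_op _ _ _ _ _ _ g (𝟙 Z) h hE (by rw [hg]; simp)
  exact ⟨f, by rw [hf, pull_id]⟩

lemma exists_eq_pull (h : Realizes δ i p) {X : C} (ε : Ext X A) (hε : push i ε = 0) :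
    ∃ f : X ⟶ Z, ε = pull f δ := by
  obtain ⟨E, j, q, hE⟩ := exists_realizes ε
  obtain ⟨g, hg⟩ := exists_extension hE i hε
  obtain ⟨f, -, hf⟩ := et3 _ _ _ _ _ _ (𝟙 A) g hE h (by rw [hg]; simp)
  exact ⟨f, by rw [← hf, push_id]⟩

/-- An endomorphism of a conflation that is the identity at both ends differs from the identity by
a morphism of square zero. -/
lemma isIso_of_id (h : Realizes δ i p) (x : B ⟶ B) (hi : i ≫ x = i) (hp : x ≫ p = p) :
    IsIso x := by
  obtain ⟨a, ha⟩ := exists_factor h (x - 𝟙 B) (by rw [Preadditive.sub_comp, hp]; simp)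
  have hy : (x - 𝟙 B) ≫ (x - 𝟙 B) = 0 := by
    nth_rw 1 [← ha]
    rw [Category.assoc, Preadditive.comp_sub, hi]
    simp
  have hx : x ≫ x = x + x - 𝟙 B := by
    rw [Preadditive.sub_comp, Preadditive.comp_sub, Preadditive.comp_sub] at hy
    simp only [Category.comp_id, Category.id_comp] at hy
    have := sub_eq_zero.1 hy
    rw [sub_eq_iff_eq_add] at this
    rw [this]; abel
  refine ⟨𝟙 B + 𝟙 B - x, ?_, ?_⟩
  · rw [Preadditive.comp_sub, Preadditive.comp_add, hx]; simp
  · rw [Preadditive.sub_comp, Preadditive.add_comp, hx]; simp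

/-- The five lemma for morphisms of conflations. -/
lemma isIso_middle (h : Realizes δ i p) {Z' A' B' : C} {δ' : Ext Z' A'} {i' : A' ⟶ B'}
    {p' : B' ⟶ Z'} (h' : Realizes δ' i' p') (f : A ≅ A') (k : Z ≅ Z')
    (hδ : push f.hom δ = pull k.hom δ') (g : B ⟶ B') (hi : i ≫ g = f.hom ≫ i')
    (hp : p ≫ k.hom = g ≫ p') : IsIso g := by
  obtain ⟨g', hi', hp'⟩ := exists_middle δ' δ i' p' i p f.inv k.inv h' h (by
    calc push f.inv δ' = pull k.inv (pull k.hom (push f.inv δ')) := by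
          rw [← pull_comp]; simp [pull_id]
      _ = pull k.inv (push f.inv (push f.hom δ)) := by rw [hδ, push_pull]
      _ = pull k.inv δ := by rw [← push_comp]; simp [push_id])
  have h1 : IsIso (g ≫ g') := isIso_of_id h _
    (by rw [← Category.assoc, hi, Category.assoc, hi']; simp)
    (by rw [Category.assoc, ← hp', ← Category.assoc, ← hp]; simp)
  have h2 : IsIso (g' ≫ g) := isIso_of_id h' _
    (by rw [← Category.assoc, hi', Category.assoc, hi]; simp)
    (by rw [Category.assoc, ← hp, ← Category.assoc, ← hp']; simp)
  exact isIso_of_isIso_comp_both g g'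

/-- Transport of a conflation along isomorphisms of its three terms. -/
lemma of_iso (h : Realizes δ i p) {Z' A' B' : C} {δ' : Ext Z' A'} {i' : A' ⟶ B'}
    {p' : B' ⟶ Z'} (a : A ≅ A') (b : B ≅ B') (c : Z ≅ Z')
    (hδ : push a.hom δ = pull c.hom δ') (hi : i ≫ b.hom = a.hom ≫ i')
    (hp : p ≫ c.hom = b.hom ≫ p') : Realizes δ' i' p' := by
  obtain ⟨E, j, q, hE⟩ := exists_realizes δ'
  obtain ⟨g, hg, hg'⟩ := exists_middle δ δ' i p j q a.hom c.hom h hE hδ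
  have := isIso_middle h hE a c hδ g hg hg'
  refine (realizes_iff δ' j q i' p' hE).2 ⟨(asIso g).symm ≪≫ b, ?_, ?_⟩
  · rw [← cancel_epi a.hom, ← hi, ← Category.assoc, ← hg]
    simp
  · rw [← cancel_epi g]
    simp [hg', ← hp]

lemma push_iso (h : Realizes δ i p) {A' : C} (a : A ≅ A') :
    Realizes (push a.hom δ) (a.inv ≫ i) p :=
  of_iso h a (Iso.refl B) (Iso.refl Z) (by simp [pull_id]) (by simp) (by simp)

lemma pull_iso (h : Realizes δ i p) {Z' : C} (c : Z ≅ Z') :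
    Realizes (pull c.inv δ) i (p ≫ c.hom) :=
  of_iso h (Iso.refl A) (Iso.refl B) c (by rw [← pull_comp]; simp [push_id, pull_id])
    (by simp) (by simp)

/-- A conflation that realizes zero splits. -/
lemma exists_splitting (h : Realizes (0 : Ext Z A) i p) :
    ∃ (r : B ⟶ A) (s : Z ⟶ B), i ≫ r = 𝟙 A ∧ s ≫ p = 𝟙 Z ∧ s ≫ r = 0 ∧
      r ≫ i + p ≫ s = 𝟙 B := by
  obtain ⟨e, he, he'⟩ := (realizes_iff _ _ _ _ _ (realizes_zero Z A)).1 h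
  refine ⟨e.inv ≫ biprod.fst, biprod.inr ≫ e.hom, ?_, ?_, by simp, ?_⟩
  · rw [← he]; simp
  · rw [Category.assoc, he']; simp
  · have : p = e.inv ≫ biprod.snd := by rw [← he']; simp
    rw [← he, this]
    have : e.inv ≫ (biprod.fst ≫ biprod.inl + biprod.snd ≫ biprod.inr) ≫ e.hom = 𝟙 B := by
      rw [biprod.total]; simp
    simpa only [Preadditive.comp_add, Preadditive.add_comp, Category.assoc] using this

end Realizes

/-- Split sequences realize zero. -/
lemma realizes_of_splitting {Z A B : C} {i : A ⟶ B} {p : B ⟶ Z} {r : B ⟶ A} {s : Z ⟶ B}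
    (hi : i ≫ r = 𝟙 A) (hp : s ≫ p = 𝟙 Z) (hip : i ≫ p = 0) (hs : s ≫ r = 0)
    (h : r ≫ i + p ≫ s = 𝟙 B) : Realizes (0 : Ext Z A) i p := by
  refine (realizes_iff _ _ _ _ _ (realizes_zero Z A)).2 ⟨⟨biprod.desc i s, biprod.lift r p,
    ?_, ?_⟩, by simp, ?_⟩
  · apply biprod.hom_ext' <;> apply biprod.hom_ext <;> simp [hi, hp, hip, hs]
  · rw [biprod.lift_desc, h]
  · apply biprod.hom_ext' <;> simp [hp, hip]

lemma realizes_id_left (A : C) {N : C} (hN : IsZero N) :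
    Realizes (0 : Ext N A) (𝟙 A) (0 : A ⟶ N) :=
  realizes_of_splitting (r := 𝟙 A) (s := 0) (by simp) (hN.eq_of_src _ _) (by simp) (by simp)
    (by simp)

/-! ### Projective and injective objects -/

lemma isProj_iff {P : C} : IsProj P ↔ ∀ X : C, Subsingleton (Ext P X) := by
  constructor
  · intro h X
    refine subsingleton_of_forall_eq 0 fun δ => ?_
    obtain ⟨B, i, p, hB⟩ := exists_realizes δ
    obtain ⟨s, hs⟩ := h p ⟨X, δ, i, hB⟩ (𝟙 P)
    rw [← pull_id δ, ← hs, Realizes.pull_comp_eq_zero hB]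
  · rintro h B Z p ⟨A, δ, i, hB⟩ f
    have := h A
    exact Realizes.exists_lift hB f (Subsingleton.elim _ _)

lemma isInj_iff {I : C} : IsInj I ↔ ∀ X : C, Subsingleton (Ext X I) := by
  constructor
  · intro h X
    refine subsingleton_of_forall_eq 0 fun δ => ?_
    obtain ⟨B, i, p, hB⟩ := exists_realizes δ
    obtain ⟨s, hs⟩ := h i ⟨X, δ, p, hB⟩ (𝟙 I)
    rw [← push_id δ, ← hs, Realizes.push_comp_eq_zero hB]
  · rintro h A B i ⟨Z, δ, p, hB⟩ f
    have := h Z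
    exact Realizes.exists_extension hB f (Subsingleton.elim _ _)

lemma IsProj.of_retract {P Q : C} (h : IsProj P) (e : Retract Q P) : IsProj Q :=
  isProj_iff.2 fun X => subsingleton_ext_retract_left e (isProj_iff.1 h X)

end PreExtriangulated

/-! ### Consequences of (ET4) -/

section Extriangulated

variable {C : Type u} [Category.{v} C] [Preadditive C] [HasFiniteBiproducts C]
  [ExtriangulatedData.{w} C] [IsExtriangulated C]

open IsExtriangulated

namespace Realizes

variable {Z A B : C} {δ : Ext Z A} {i : A ⟶ B} {p : B ⟶ Z}

lemma exists_eq_pull_of_pull_eq_zero (h : Realizes δ i p) {X : C} (ε : Ext B X)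
    (hε : pull i ε = 0) : ∃ ε' : Ext Z X, ε = pull p ε' := by
  obtain ⟨E, j, q, hE⟩ := exists_realizes ε
  obtain ⟨V, h', d, e, δ'', -, -, -, hd, -, hg⟩ := et4_op _ _ _ _ _ _ hE h
  rw [hε] at hd
  obtain ⟨r, s, hr, -⟩ := exists_splitting hd
  exact ⟨push r δ'', by rw [← push_pull, hg, ← push_comp, hr, push_id]⟩

lemma exists_eq_push_of_push_eq_zero (h : Realizes δ i p) {X : C} (ε : Ext X B)
    (hε : push p ε = 0) : ∃ ε' : Ext X A, ε = push i ε' := by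
  obtain ⟨E, j, q, hE⟩ := exists_realizes ε
  obtain ⟨V, h', d, e, δ'', -, -, -, hd, -, hg⟩ := et4 _ _ _ _ _ _ h hE
  rw [hε] at hd
  obtain ⟨r, s, -, hs, -⟩ := exists_splitting hd
  exact ⟨pull s δ'', by rw [push_pull, hg, ← pull_comp, hs, pull_id]⟩

lemma subsingleton_ext_left (h : Realizes δ i p) {X : C} (hA : Subsingleton (Ext A X))
    (hZ : Subsingleton (Ext Z X)) : Subsingleton (Ext B X) :=
  subsingleton_of_forall_eq 0 fun ε => by
    obtain ⟨ε', rfl⟩ := exists_eq_pull_of_pull_eq_zero h ε (Subsingleton.elim _ _)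
    rw [Subsingleton.elim ε' 0, map_zero]

lemma subsingleton_ext_right (h : Realizes δ i p) {X : C} (hA : Subsingleton (Ext X A))
    (hZ : Subsingleton (Ext X Z)) : Subsingleton (Ext X B) :=
  subsingleton_of_forall_eq 0 fun ε => by
    obtain ⟨ε', rfl⟩ := exists_eq_push_of_push_eq_zero h ε (Subsingleton.elim _ _)
    rw [Subsingleton.elim ε' 0, map_zero]

/-- `C_U` is closed under extensions. -/
lemma perp_middle (h : Realizes δ i p) {U : C} (hA : perp U A) (hZ : perp U Z) : perp U B :=
  ⟨subsingleton_ext_right h hA.1 hZ.1, subsingleton_ext_left h hA.2 hZ.2⟩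

/-- The pushout of two inflations with the same source: both of its legs are inflations, with the
cones of the given ones. -/
lemma exists_pushout (h : Realizes δ i p) {Z' B' : C} {δ' : Ext Z' A} {i' : A ⟶ B'}
    {p' : B' ⟶ Z'} (h' : Realizes δ' i' p') :
    ∃ (M : C) (m : B ⟶ M) (e : M ⟶ Z') (m' : B' ⟶ M) (e' : M ⟶ Z),
      Realizes (push i δ') m e ∧ Realizes (push i' δ) m' e' := by
  obtain ⟨M, m, e, hM⟩ := exists_realizes (push i δ')
  obtain ⟨V, q, d, c, θ, -, -, hθ, hd, hdθ, hiθ⟩ := et4 _ _ _ _ _ _ h hM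
  have h0 : push p (push i δ') = 0 := by rw [← push_comp, comp_eq_zero h, push_zero]
  rw [h0] at hd
  have hdc := comp_eq_zero hd
  obtain ⟨r, s, hr, hs, hsr, hrs⟩ := exists_splitting hd
  -- The splitting of `Z ⟶ V ⟶ Z'` is corrected so that `θ` restricts to `δ'` on `Z'`.
  obtain ⟨φ, hφ⟩ := exists_eq_pull h (pull s θ - δ') (by
    rw [map_sub, push_pull, hiθ, ← pull_comp, hs, pull_id, sub_self])
  have hs'θ : pull (s - φ ≫ d) θ = δ' := by
    have := pull_add (s - φ ≫ d) (φ ≫ d) θ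
    rw [sub_add_cancel, pull_comp φ, hdθ, ← hφ] at this
    rw [eq_sub_of_add_eq this.symm]; abel
  have hsplit : Realizes (0 : Ext Z Z') (s - φ ≫ d) (r + c ≫ φ) := by
    refine realizes_of_splitting (r := c) (s := d) ?_ ?_ ?_ hdc ?_
    · rw [Preadditive.sub_comp, hs, Category.assoc, hdc]; simp
    · rw [Preadditive.comp_add, hr, ← Category.assoc, hdc]; simp
    · simp only [Preadditive.sub_comp, Preadditive.comp_add, hsr, Category.assoc, hr,
        reassoc_of% hs, reassoc_of% hdc]
      simp
    · simp only [Preadditive.comp_sub, Preadditive.add_comp, Category.assoc]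
      rw [← hrs]; abel
  obtain ⟨W, m', a, b, θ', -, -, hW, hW', -, hW''⟩ := et4_op _ _ _ _ _ _ hθ hsplit
  rw [hs'θ] at hW'
  obtain ⟨ψ, hψ, -⟩ := (realizes_iff _ _ _ _ _ hW').1 h'
  have hθ' : θ' = push a δ := by
    have : pull d (pull (r + c ≫ φ) θ') = pull d (push a θ) := by rw [hW'']
    rwa [← pull_comp, Preadditive.comp_add, hr, reassoc_of% hdc, zero_comp, add_zero, pull_id,
      ← push_pull, hdθ] at this
  have := push_iso hW ψ
  rw [hθ', ← push_comp, hψ] at this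
  exact ⟨M, m, e, _, _, hM, this⟩

end Realizes

lemma IsInflation.comp {A B Y : C} {f : A ⟶ B} {g : B ⟶ Y} (hf : IsInflation f)
    (hg : IsInflation g) : IsInflation (f ≫ g) := by
  obtain ⟨X, δ, f', hf⟩ := hf
  obtain ⟨W, δ', g', hg⟩ := hg
  obtain ⟨V, h', d, e, δ'', -, -, h, -⟩ := et4 _ _ _ _ _ _ hf hg
  exact ⟨V, δ'', h', h⟩

lemma IsDeflation.comp {X Y Z : C} {f : X ⟶ Y} {g : Y ⟶ Z} (hf : IsDeflation f)
    (hg : IsDeflation g) : IsDeflation (f ≫ g) := by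
  obtain ⟨A, δ, f', hf⟩ := hf
  obtain ⟨W, δ', g', hg⟩ := hg
  obtain ⟨V, h', d, e, δ'', -, -, h, -⟩ := et4_op _ _ _ _ _ _ hf hg
  exact ⟨V, δ'', h', h⟩

/-- If `i : A ⟶ N` is an inflation to a zero object, every morphism from `A` is an inflation. -/
lemma isInflation_of_isZero {A N X : C} {i : A ⟶ N} (hN : IsZero N) (hi : IsInflation i)
    (j : A ⟶ X) : IsInflation j := by
  obtain ⟨Z, δ, p, h⟩ := hi
  -- `j` is the composite of its graph, of `i ⊕ 1` and of the isomorphism `N ⊕ X ≅ X`.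
  have h1 : IsInflation (biprod.lift (𝟙 A) j) :=
    ⟨X, 0, biprod.desc (-j) (𝟙 X), realizes_of_splitting (r := biprod.fst) (s := biprod.inr)
      (by simp) (by simp) (by simp) (by simp) (by
        apply biprod.hom_ext' <;> apply biprod.hom_ext <;> simp)⟩
  have h2 : IsInflation (biprod.map i (𝟙 X)) :=
    ⟨_, _, _, realizes_sum _ _ _ _ _ _ h (realizes_id_left X hN)⟩
  have h3 : IsInflation (biprod.snd : N ⊞ X ⟶ X) :=
    ⟨N, 0, 0, realizes_of_splitting (r := biprod.inr) (s := 0) (by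
      apply biprod.hom_ext' <;> apply biprod.hom_ext <;> simp [hN.eq_of_src _ (0 : N ⟶ N)])
      (hN.eq_of_src _ _) (by simp) (by simp) (by simp)⟩
  simpa using (h1.comp h2).comp h3

end Extriangulated

/-! ### Indecomposable objects and direct summands -/

lemma isZero_of_retract {C : Type u} [Category.{v} C] [HasZeroMorphisms C] {X Y : C}
    (hX : IsZero X) (e : Retract Y X) : IsZero Y := by
  rw [IsZero.iff_id_eq_zero, ← e.retract, hX.eq_of_tgt e.i 0, zero_comp]

lemma IsoClass.mk_eq_mk {C : Type u} [Category.{v} C] {X Y : C} :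
    IsoClass.mk X = IsoClass.mk Y ↔ Nonempty (X ≅ Y) :=
  Quotient.eq (r := isIsomorphicSetoid C)

lemma IsoClass.exists_eq_mk {C : Type u} [Category.{v} C] (x : IsoClass C) :
    ∃ X : C, x = IsoClass.mk X := by
  induction x using Quotient.inductionOn with
  | h X => exact ⟨X, rfl⟩

section Preadditive

variable {C : Type u} [Category.{v} C] [Preadditive C]

/-- The endomorphism ring of an object is local iff the object is nonzero and, for each
endomorphism `a`, one of `a` and `1 - a` is an isomorphism. -/
lemma isLocalRing_end_iff {X : C} :
    IsLocalRing (End X) ↔ ¬ IsZero X ∧ ∀ a : X ⟶ X, IsIso a ∨ IsIso (𝟙 X - a) := by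
  constructor
  · intro h
    refine ⟨fun h0 => zero_ne_one (α := End X) (h0.eq_of_src (𝟙 X) 0).symm, fun a => ?_⟩
    rcases IsLocalRing.isUnit_or_isUnit_of_add_one (R := End X) (a := a) (b := 𝟙 X - a)
      (add_sub_cancel a (𝟙 X)) with h1 | h1
    · exact Or.inl ((isUnit_iff_isIso _).1 h1)
    · exact Or.inr ((isUnit_iff_isIso _).1 h1)
  · rintro ⟨h0, h⟩
    have : Nontrivial (End X) := ⟨𝟙 X, 0, fun h' => h0 ((IsZero.iff_id_eq_zero X).2 h')⟩
    refine ⟨fun {a b} hab => ?_⟩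
    rcases h (show X ⟶ X from a) with h1 | h1
    · exact Or.inl ((isUnit_iff_isIso _).2 h1)
    · have hb : 𝟙 X - (show X ⟶ X from a) = b := sub_eq_of_eq_add' (Eq.symm hab)
      rw [hb] at h1
      exact Or.inr ((isUnit_iff_isIso _).2 h1)

lemma isLocalRing_end_of_iso {X Y : C} (e : X ≅ Y) (h : IsLocalRing (End X)) :
    IsLocalRing (End Y) := by
  rw [isLocalRing_end_iff] at h ⊢
  refine ⟨fun h0 => h.1 (h0.of_iso e), fun a => ?_⟩
  rcases h.2 (e.hom ≫ a ≫ e.inv) with h1 | h1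
  · left
    have : a = e.inv ≫ (e.hom ≫ a ≫ e.inv) ≫ e.hom := by simp
    rw [this]; infer_instance
  · right
    have : 𝟙 Y - a = e.inv ≫ (𝟙 X - e.hom ≫ a ≫ e.inv) ≫ e.hom := by
      simp [Preadditive.comp_sub, Preadditive.sub_comp]
    rw [this]; infer_instance

/-- An object with local endomorphism ring has no nontrivial retracts. -/
lemma iso_of_retract_isLocalRing {X Y : C} (hY : IsLocalRing (End Y)) (hX : ¬ IsZero X)
    (e : Retract X Y) : Nonempty (X ≅ Y) := by
  have hi : (e.r ≫ e.i) ≫ (e.r ≫ e.i) = e.r ≫ e.i := by simp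
  rcases (isLocalRing_end_iff.1 hY).2 (e.r ≫ e.i) with h | h
  · rw [← Category.comp_id (e.r ≫ e.i), Category.assoc] at hi
    have : e.r ≫ e.i = 𝟙 Y := by
      rw [← cancel_epi (e.r ≫ e.i)]; simp
    exact ⟨⟨e.i, e.r, e.retract, this⟩⟩
  · refine absurd ?_ hX
    have h0 : e.r ≫ e.i = 0 := by
      rw [← cancel_epi (𝟙 Y - e.r ≫ e.i), Preadditive.sub_comp, hi]; simp
    rw [IsZero.iff_id_eq_zero]
    calc 𝟙 X = e.i ≫ (e.r ≫ e.i) ≫ e.r := by simp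
      _ = 0 := by rw [h0]; simp

end Preadditive

section Additive

variable {C : Type u} [Category.{v} C] [Preadditive C] [HasFiniteBiproducts C]

lemma isZero_biproduct_of_isEmpty {ι : Type} [Finite ι] [IsEmpty ι] (F : ι → C) :
    IsZero (⨁ F) := by
  rw [IsZero.iff_id_eq_zero]
  apply biproduct.hom_ext
  exact fun i => isEmptyElim i

/-- An object with local endomorphism ring that is a summand of a finite family is a summand of
one of its members. -/
lemma exists_retract_of_sum {X : C} (hX : IsLocalRing (End X)) {ι : Type} [Finite ι]
    {F : ι → C} (e : Retract X (⨁ F)) : ∃ i, Nonempty (Retract X (F i)) := by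
  classical
  have := Fintype.ofFinite ι
  have key : ∀ t : Finset ι, IsIso (∑ i ∈ t, (e.i ≫ biproduct.π F i) ≫ (biproduct.ι F i ≫ e.r)) →
      ∃ i, Nonempty (Retract X (F i)) := by
    intro t
    induction t using Finset.induction_on with
    | empty =>
      intro h
      refine absurd ?_ (isLocalRing_end_iff.1 hX).1
      rw [Finset.sum_empty] at h
      rw [IsZero.iff_id_eq_zero, ← IsIso.hom_inv_id (0 : X ⟶ X), zero_comp]
    | insert i t hi ih =>
      rw [Finset.sum_insert hi]
      intro h
      set a := (e.i ≫ biproduct.π F i) ≫ (biproduct.ι F i ≫ e.r) with ha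
      set b := ∑ i ∈ t, (e.i ≫ biproduct.π F i) ≫ (biproduct.ι F i ≫ e.r) with hb
      rcases (isLocalRing_end_iff.1 hX).2 (a ≫ inv (a + b)) with h1 | h1
      · refine ⟨i, ⟨⟨e.i ≫ biproduct.π F i,
          (biproduct.ι F i ≫ e.r) ≫ inv (a + b) ≫ inv (a ≫ inv (a + b)), ?_⟩⟩⟩
        rw [← Category.assoc, ← ha, ← Category.assoc, IsIso.hom_inv_id]
      · apply ih
        have : b = (𝟙 X - a ≫ inv (a + b)) ≫ (a + b) := by
          rw [Preadditive.sub_comp, Category.id_comp, Category.assoc, IsIso.inv_hom_id,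
            Category.comp_id, add_sub_cancel_left]
        rw [this]; infer_instance
  apply key Finset.univ
  have : ∑ i, (e.i ≫ biproduct.π F i) ≫ (biproduct.ι F i ≫ e.r) = 𝟙 X := by
    calc _ = e.i ≫ (∑ i, biproduct.π F i ≫ biproduct.ι F i) ≫ e.r := by
          simp only [Preadditive.sum_comp, Preadditive.comp_sum, Category.assoc]
      _ = 𝟙 X := by rw [biproduct.total, Category.id_comp, e.retract]
  rw [this]; infer_instance

lemma indecomposable_of_isLocalRing {X : C} (hX : IsLocalRing (End X)) : Indecomposable X := by
  refine ⟨(isLocalRing_end_iff.1 hX).1, fun Y Z e => ?_⟩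
  by_contra! h
  obtain ⟨f⟩ := iso_of_retract_isLocalRing hX h.1 ⟨biprod.inl ≫ e.inv, e.hom ≫ biprod.fst, by simp⟩
  obtain ⟨g⟩ := iso_of_retract_isLocalRing hX h.2 ⟨biprod.inr ≫ e.inv, e.hom ≫ biprod.snd, by simp⟩
  rcases (isLocalRing_end_iff.1 hX).2 (e.hom ≫ biprod.fst ≫ biprod.inl ≫ e.inv) with h1 | h1
  · apply h.2
    rw [IsZero.iff_id_eq_zero]
    have : (biprod.inr ≫ e.inv) ≫ (e.hom ≫ biprod.fst ≫ biprod.inl ≫ e.inv) = 0 := by simp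
    have h2 : (biprod.inr : Z ⟶ Y ⊞ Z) ≫ e.inv = 0 := by
      rw [← cancel_mono (e.hom ≫ biprod.fst ≫ biprod.inl ≫ e.inv), this, zero_comp]
    calc 𝟙 Z = (biprod.inr ≫ e.inv) ≫ e.hom ≫ (biprod.snd : Y ⊞ Z ⟶ Z) := by simp
      _ = 0 := by rw [h2, zero_comp]
  · apply h.1
    rw [IsZero.iff_id_eq_zero]
    have : (biprod.inl ≫ e.inv) ≫ (𝟙 X - e.hom ≫ biprod.fst ≫ biprod.inl ≫ e.inv) = 0 := by
      simp [Preadditive.comp_sub]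
    have h2 : (biprod.inl : Y ⟶ Y ⊞ Z) ≫ e.inv = 0 := by
      rw [← cancel_mono (𝟙 X - e.hom ≫ biprod.fst ≫ biprod.inl ≫ e.inv), this, zero_comp]
    calc 𝟙 Y = (biprod.inl ≫ e.inv) ≫ e.hom ≫ (biprod.fst : Y ⊞ Z ⟶ Y) := by simp
      _ = 0 := by rw [h2, zero_comp]

lemma indecomposable_of_iso {X Y : C} (e : X ≅ Y) (h : Indecomposable X) : Indecomposable Y :=
  ⟨fun h0 => h.1 (h0.of_iso e), fun A B f => h.2 A B (e ≪≫ f)⟩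

lemma nonempty_iso_biproduct {ι : Type} [Fintype ι] {X : C} {F : ι → C} (s : ∀ i, X ⟶ F i)
    (r : ∀ i, F i ⟶ X) (h : ∀ i, r i ≫ s i = 𝟙 _) (h' : ∀ i j, i ≠ j → r i ≫ s j = 0)
    (hsum : ∑ i, s i ≫ r i = 𝟙 X) : Nonempty (X ≅ ⨁ F) := by
  classical
  refine ⟨⟨biproduct.lift s, biproduct.desc r, by rw [biproduct.lift_desc, hsum], ?_⟩⟩
  apply biproduct.hom_ext'
  intro i
  apply biproduct.hom_ext
  intro j
  by_cases hij : i = j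
  · subst hij; simp [h]
  · simp [h' i j hij, biproduct.ι_π_ne _ hij]

/-- Splitting off one term of a direct sum. -/
noncomputable def biproductSplit {ι : Type} [Finite ι] (F : ι → C) (i : ι) :
    ⨁ F ≅ (⨁ fun j : {j // j ≠ i} => F j) ⊞ F i where
  hom := biprod.lift (biproduct.lift fun j => biproduct.π F j) (biproduct.π F i)
  inv := biprod.desc (biproduct.desc fun j => biproduct.ι F j) (biproduct.ι F i)
  hom_inv_id := by
    classical
    apply biproduct.hom_ext'
    intro k
    by_cases hk : k = i
    · subst hk
      have h : (biproduct.ι F k ≫ biproduct.lift fun j : {j // j ≠ k} => biproduct.π F j) = 0 := by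
        apply biproduct.hom_ext
        intro j
        simpa using biproduct.ι_π_ne F j.2.symm
      rw [biprod.lift_desc, Preadditive.comp_add, reassoc_of% h]
      simp
    · have h : (biproduct.ι F k ≫ biproduct.lift fun j : {j // j ≠ i} => biproduct.π F j) =
          biproduct.ι (fun j : {j // j ≠ i} => F j) ⟨k, hk⟩ := by
        apply biproduct.hom_ext
        intro j
        by_cases hj : k = j
        · obtain ⟨j, hji⟩ := j
          obtain rfl : k = j := hj
          simp
        · rw [biproduct.ι_π_ne _ (fun h => hj (congrArg Subtype.val h))]
          simpa using biproduct.ι_π_ne F hj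
      rw [biprod.lift_desc, Preadditive.comp_add, reassoc_of% h]
      simp [reassoc_of% biproduct.ι_π_ne F hk]
  inv_hom_id := by
    classical
    apply biprod.hom_ext' <;> apply biprod.hom_ext
    · apply biproduct.hom_ext'
      intro j
      apply biproduct.hom_ext
      intro k
      by_cases hjk : j = k
      · subst hjk; simp
      · have : (j : ι) ≠ k := fun h => hjk (Subtype.ext h)
        simp [biproduct.ι_π_ne F this, biproduct.ι_π_ne _ hjk]
    · apply biproduct.hom_ext'
      intro j
      simp [biproduct.ι_π_ne F j.2]
    · apply biproduct.hom_ext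
      intro j
      simp [biproduct.ι_π_ne F j.2.symm]
    · simp

/-- The set of isomorphism classes of indecomposable direct summands of `V`. -/
def summandClasses (V : C) : Set (IsoClass C) :=
  {x | ∃ X Y : C, x = IsoClass.mk X ∧ Indecomposable X ∧ Nonempty (V ≅ X ⊞ Y)}

lemma summandClasses_iso {V W : C} (e : V ≅ W) : summandClasses V = summandClasses W := by
  ext x
  exact ⟨fun ⟨X, Y, h, h', ⟨f⟩⟩ => ⟨X, Y, h, h', ⟨e.symm ≪≫ f⟩⟩,
    fun ⟨X, Y, h, h', ⟨f⟩⟩ => ⟨X, Y, h, h', ⟨e ≪≫ f⟩⟩⟩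

lemma IsBasic.of_iso {V W : C} (h : IsBasic V) (e : V ≅ W) : IsBasic W := by
  obtain ⟨ι, hι, F, hF, hF', ⟨f⟩⟩ := h
  exact ⟨ι, hι, F, hF, hF', ⟨e.symm ≪≫ f⟩⟩

lemma InAdd.of_iso_left {V W X : C} (h : InAdd V X) (e : V ≅ W) : InAdd W X := by
  obtain ⟨n, s, r, h⟩ := inAdd_iff.1 h
  exact inAdd_iff.2 ⟨n, fun i => s i ≫ e.hom, fun i => e.inv ≫ r i, by simpa using h⟩

/-- `g` factors through an object of `add U`. -/
def FactorsAdd (U : C) {X Y : C} (g : X ⟶ Y) : Prop :=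
  ∃ (W : C) (_ : InAdd U W) (a : X ⟶ W) (b : W ⟶ Y), g = a ≫ b

lemma FactorsAdd.comp_left {U X Y Z : C} {g : X ⟶ Y} (h : FactorsAdd U g) (f : Z ⟶ X) :
    FactorsAdd U (f ≫ g) := by
  obtain ⟨W, hW, a, b, rfl⟩ := h
  exact ⟨W, hW, f ≫ a, b, by simp⟩

lemma FactorsAdd.comp_right {U X Y Z : C} {g : X ⟶ Y} (h : FactorsAdd U g) (f : Y ⟶ Z) :
    FactorsAdd U (g ≫ f) := by
  obtain ⟨W, hW, a, b, rfl⟩ := h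
  exact ⟨W, hW, a, b ≫ f, by simp⟩

lemma FactorsAdd.sub {U X Y : C} {g g' : X ⟶ Y} (h : FactorsAdd U g) (h' : FactorsAdd U g') :
    FactorsAdd U (g - g') := by
  obtain ⟨W, hW, a, b, rfl⟩ := h
  obtain ⟨W', hW', a', b', rfl⟩ := h'
  exact ⟨W ⊞ W', hW.biprod hW', biprod.lift a (-a'), biprod.desc b b', by
    rw [biprod.lift_desc, Preadditive.neg_comp, sub_eq_add_neg]⟩

lemma inAdd_of_factorsAdd {U X : C} {g : X ⟶ X} (h : FactorsAdd U g) [IsIso g] : InAdd U X := by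
  obtain ⟨W, hW, a, b, rfl⟩ := h
  exact hW.of_retract ⟨a, b ≫ inv (a ≫ b), by rw [← Category.assoc, IsIso.hom_inv_id]⟩

/-! ### Krull–Schmidt categories -/

variable [IsKrullSchmidt C]

lemma isLocalRing_of_indecomposable {X : C} (hX : Indecomposable X) : IsLocalRing (End X) := by
  obtain ⟨ι, _, F, hF, ⟨e⟩⟩ := IsKrullSchmidt.exists_decomposition X
  rcases isEmpty_or_nonempty ι with h | ⟨⟨i⟩⟩
  · exact absurd ((isZero_biproduct_of_isEmpty F).of_iso e) hX.1
  · rcases hX.2 _ _ (e ≪≫ biproductSplit F i) with h | h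
    · exact isLocalRing_end_of_iso (e ≪≫ biproductSplit F i ≪≫ (isoZeroBiprod h).symm).symm (hF i)
    · exact absurd h (isLocalRing_end_iff.1 (hF i)).1

lemma exists_indecomposable_decomposition (X : C) : ∃ (ι : Type) (_ : Finite ι) (F : ι → C),
    (∀ i, Indecomposable (F i)) ∧ Nonempty (X ≅ ⨁ F) := by
  obtain ⟨ι, hι, F, hF, e⟩ := IsKrullSchmidt.exists_decomposition X
  exact ⟨ι, hι, F, fun i => indecomposable_of_isLocalRing (hF i), e⟩

lemma exists_iso_of_retract_biproduct {X : C} (hX : Indecomposable X) {ι : Type} [Finite ι]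
    {F : ι → C} (hF : ∀ i, Indecomposable (F i)) (e : Retract X (⨁ F)) :
    ∃ i, Nonempty (X ≅ F i) := by
  obtain ⟨i, ⟨e'⟩⟩ := exists_retract_of_sum (isLocalRing_of_indecomposable hX) e
  exact ⟨i, iso_of_retract_isLocalRing (isLocalRing_of_indecomposable (hF i)) hX.1 e'⟩

lemma inAdd_iff_retract {V X : C} (hX : Indecomposable X) :
    InAdd V X ↔ Nonempty (Retract X V) := by
  constructor
  · rintro ⟨n, ⟨e⟩⟩
    obtain ⟨i, h⟩ := exists_retract_of_sum (isLocalRing_of_indecomposable hX) e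
    exact h
  · rintro ⟨e⟩
    exact (inAdd_self V).of_retract e

lemma mk_mem_summandClasses {V X : C} :
    IsoClass.mk X ∈ summandClasses V ↔ Indecomposable X ∧ Nonempty (Retract X V) := by
  constructor
  · rintro ⟨X', Y, hX, h, ⟨e⟩⟩
    obtain ⟨f⟩ := IsoClass.mk_eq_mk.1 hX
    exact ⟨indecomposable_of_iso f.symm h,
      ⟨⟨f.hom ≫ biprod.inl ≫ e.inv, e.hom ≫ biprod.fst ≫ f.inv, by simp⟩⟩⟩
  · rintro ⟨h, ⟨r⟩⟩
    obtain ⟨ι, _, F, hF, ⟨e⟩⟩ := exists_indecomposable_decomposition V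
    obtain ⟨i, ⟨f⟩⟩ := exists_iso_of_retract_biproduct h hF
      ⟨r.i ≫ e.hom, e.inv ≫ r.r, by simp⟩
    exact ⟨F i, _, IsoClass.mk_eq_mk.2 ⟨f⟩, hF i,
      ⟨e ≪≫ biproductSplit F i ≪≫ biprod.braiding _ _⟩⟩

lemma summandClasses_biproduct {V : C} {ι : Type} [Finite ι] {F : ι → C}
    (hF : ∀ i, Indecomposable (F i)) (e : V ≅ ⨁ F) :
    summandClasses V = Set.range fun i => IsoClass.mk (F i) := by
  ext x
  obtain ⟨X, rfl⟩ := IsoClass.exists_eq_mk x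
  rw [mk_mem_summandClasses]
  constructor
  · rintro ⟨h, ⟨r⟩⟩
    obtain ⟨i, f⟩ := exists_iso_of_retract_biproduct h hF ⟨r.i ≫ e.hom, e.inv ≫ r.r, by simp⟩
    exact ⟨i, (IsoClass.mk_eq_mk.2 f).symm⟩
  · rintro ⟨i, hi⟩
    obtain ⟨f⟩ := IsoClass.mk_eq_mk.1 hi
    exact ⟨indecomposable_of_iso f (hF i),
      ⟨⟨f.inv ≫ biproduct.ι F i ≫ e.inv, e.hom ≫ biproduct.π F i ≫ f.hom, by simp⟩⟩⟩

lemma summandClasses_of_indecomposable {X : C} (hX : Indecomposable X) :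
    summandClasses X = {IsoClass.mk X} := by
  ext y
  obtain ⟨Y, rfl⟩ := IsoClass.exists_eq_mk y
  rw [mk_mem_summandClasses, Set.mem_singleton_iff, IsoClass.mk_eq_mk]
  constructor
  · rintro ⟨hY, ⟨e⟩⟩
    exact iso_of_retract_isLocalRing (isLocalRing_of_indecomposable hX) hY.1 e
  · rintro ⟨e⟩
    exact ⟨indecomposable_of_iso e.symm hX, ⟨⟨e.hom, e.inv, by simp⟩⟩⟩

lemma summandClasses_biprod (V W : C) :
    summandClasses (V ⊞ W) = summandClasses V ∪ summandClasses W := by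
  obtain ⟨ι, _, F, hF, ⟨e⟩⟩ := exists_indecomposable_decomposition V
  obtain ⟨κ, _, G, hG, ⟨f⟩⟩ := exists_indecomposable_decomposition W
  rw [summandClasses_biproduct hF e, summandClasses_biproduct hG f,
    summandClasses_biproduct (F := Sum.elim F G) (by rintro (i | i); exacts [hF i, hG i])
      (biprod.mapIso e f ≪≫ sumIso (Sum.elim F G))]
  ext x
  constructor
  · rintro ⟨i | i, rfl⟩
    exacts [Or.inl ⟨i, rfl⟩, Or.inr ⟨i, rfl⟩]
  · rintro (⟨i, rfl⟩ | ⟨i, rfl⟩)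
    exacts [⟨Sum.inl i, rfl⟩, ⟨Sum.inr i, rfl⟩]

lemma isZero_iff_summandClasses {V : C} : IsZero V ↔ summandClasses V = ∅ := by
  obtain ⟨ι, _, F, hF, ⟨e⟩⟩ := exists_indecomposable_decomposition V
  rw [summandClasses_biproduct hF e, Set.range_eq_empty_iff]
  constructor
  · intro h
    exact ⟨fun i => (hF i).1 (isZero_of_retract h
      ⟨biproduct.ι F i ≫ e.inv, e.hom ≫ biproduct.π F i, by simp⟩)⟩
  · intro h
    exact (isZero_biproduct_of_isEmpty F).of_iso e

lemma addDisjoint_iff {V W : C} :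
    AddDisjoint V W ↔ Disjoint (summandClasses V) (summandClasses W) := by
  rw [Set.disjoint_left]
  constructor
  · intro h x hx hx'
    obtain ⟨X, rfl⟩ := IsoClass.exists_eq_mk x
    obtain ⟨hX, hV⟩ := mk_mem_summandClasses.1 hx
    obtain ⟨-, hW⟩ := mk_mem_summandClasses.1 hx'
    exact hX.1 (h X ((inAdd_iff_retract hX).2 hV) ((inAdd_iff_retract hX).2 hW))
  · intro h X hV hW
    rw [isZero_iff_summandClasses, Set.eq_empty_iff_forall_notMem]
    intro y hy
    obtain ⟨Y, rfl⟩ := IsoClass.exists_eq_mk y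
    obtain ⟨hY, ⟨e⟩⟩ := mk_mem_summandClasses.1 hy
    exact h (mk_mem_summandClasses.2 ⟨hY, (inAdd_iff_retract hY).1 (hV.of_retract e)⟩)
      (mk_mem_summandClasses.2 ⟨hY, (inAdd_iff_retract hY).1 (hW.of_retract e)⟩)

lemma addDisjoint_of_indecomposable {X Y : C} (hX : Indecomposable X) (hY : Indecomposable Y)
    (h : IsEmpty (X ≅ Y)) : AddDisjoint X Y := by
  rw [addDisjoint_iff, summandClasses_of_indecomposable hX, summandClasses_of_indecomposable hY,
    Set.disjoint_singleton, ne_eq, IsoClass.mk_eq_mk, not_nonempty_iff]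
  exact h

/-- Basic objects are determined by their indecomposable summands. -/
lemma IsBasic.nonempty_iso {V W : C} (hV : IsBasic V) (hW : IsBasic W)
    (h : summandClasses V = summandClasses W) : Nonempty (V ≅ W) := by
  obtain ⟨ι, _, F, hF, hF', ⟨e⟩⟩ := hV
  obtain ⟨κ, _, G, hG, hG', ⟨f⟩⟩ := hW
  rw [summandClasses_biproduct hF e, summandClasses_biproduct hG f] at h
  have hFi : Function.Injective fun i => IsoClass.mk (F i) :=
    fun i j hij => hF' i j (IsoClass.mk_eq_mk.1 hij)
  have hGi : Function.Injective fun i => IsoClass.mk (G i) :=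
    fun i j hij => hG' i j (IsoClass.mk_eq_mk.1 hij)
  let σ : ι ≃ κ := (Equiv.ofInjective _ hFi).trans
    ((Equiv.setCongr h).trans (Equiv.ofInjective _ hGi).symm)
  have hσ : ∀ i, Nonempty (G (σ i) ≅ F i) := fun i => IsoClass.mk_eq_mk.1 (by
    have := Equiv.apply_ofInjective_symm hGi (Equiv.setCongr h (Equiv.ofInjective _ hFi i))
    exact this)
  exact ⟨e ≪≫ biproduct.whiskerEquiv σ (fun i => (hσ i).some) ≪≫ f.symm⟩

/-- An indecomposable summand of a basic object splits off, with basic complement. -/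
lemma IsBasic.exists_split {V : C} (hV : IsBasic V) {y : IsoClass C} (hy : y ∈ summandClasses V) :
    ∃ V' Y : C, y = IsoClass.mk Y ∧ Indecomposable Y ∧ IsBasic V' ∧ Nonempty (V ≅ V' ⊞ Y) ∧
      summandClasses V' = summandClasses V \ {y} := by
  obtain ⟨ι, _, F, hF, hF', ⟨e⟩⟩ := hV
  rw [summandClasses_biproduct hF e] at hy ⊢
  obtain ⟨i, rfl⟩ := hy
  refine ⟨⨁ fun j : {j // j ≠ i} => F j, F i, rfl, hF i,
    ⟨_, inferInstance, fun j : {j // j ≠ i} => F j, fun j => hF j,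
      fun j k h => Subtype.ext (hF' j k h), ⟨Iso.refl _⟩⟩,
    ⟨e ≪≫ biproductSplit F i⟩, ?_⟩
  rw [summandClasses_biproduct (F := fun j : {j // j ≠ i} => F j) (fun j => hF j) (Iso.refl _)]
  ext x
  constructor
  · rintro ⟨j, rfl⟩
    exact ⟨⟨j, rfl⟩, fun h => j.2 (hF' _ _ (IsoClass.mk_eq_mk.1 h))⟩
  · rintro ⟨⟨j, rfl⟩, h⟩
    exact ⟨⟨j, fun hji => h (by subst hji; rfl)⟩, rfl⟩

/-- To prove a statement for all objects, it suffices to add one indecomposable summand at a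
time. -/
lemma IsKrullSchmidt.induction {p : C → Prop} (iso : ∀ {X Y : C}, (X ≅ Y) → p X → p Y)
    (zero : ∀ X : C, IsZero X → p X)
    (add : ∀ F X : C, Indecomposable F → p X → p (F ⊞ X)) (X : C) : p X := by
  have key : ∀ (n : ℕ) (ι : Type) [Finite ι] (F : ι → C), Nat.card ι = n →
      (∀ i, Indecomposable (F i)) → p (⨁ F) := by
    intro n
    induction n with
    | zero =>
      intro ι _ F hι _
      have : IsEmpty ι := (Nat.card_eq_zero.1 hι).resolve_right (not_infinite_iff_finite.2 ‹_›)
      exact zero _ (isZero_biproduct_of_isEmpty F)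
    | succ n ih =>
      intro ι _ F hι hF
      have : Nonempty ι := (Nat.card_pos_iff.1 (by omega)).1
      obtain ⟨i⟩ := this
      refine iso (biproductSplit F i ≪≫ biprod.braiding _ _).symm
        (add _ _ (hF i) (ih _ _ ?_ fun j => hF j))
      classical
      have := Fintype.ofFinite ι
      rw [Nat.card_eq_fintype_card] at hι ⊢
      rw [Fintype.card_subtype_compl, hι, Fintype.card_subtype_eq, Nat.add_sub_cancel]
  obtain ⟨ι, _, F, hF, ⟨e⟩⟩ := exists_indecomposable_decomposition X
  exact iso e.symm (key _ ι F rfl hF)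

/-- If `V` has no summand in `add U`, then the ideal of endomorphisms of `V` that factor through
`add U` lies in the radical. -/
lemma isIso_of_factorsAdd_sub_id {U V : C} (hV : AddDisjoint V U) (f : V ⟶ V)
    (hf : FactorsAdd U (f - 𝟙 V)) : IsIso f := by
  induction V using IsKrullSchmidt.induction with
  | iso e ih =>
    rename_i X Y
    have := ih (fun Z h h' => hV Z (h.of_iso_left e) h') (e.hom ≫ f ≫ e.inv) (by
      have : e.hom ≫ f ≫ e.inv - 𝟙 X = e.hom ≫ (f - 𝟙 Y) ≫ e.inv := by
        simp [Preadditive.comp_sub, Preadditive.sub_comp]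
      rw [this]
      exact (hf.comp_right _).comp_left _)
    have h2 : f = e.inv ≫ (e.hom ≫ f ≫ e.inv) ≫ e.hom := by simp
    rw [h2]; infer_instance
  | zero X h => exact ⟨0, h.eq_of_src _ _, h.eq_of_src _ _⟩
  | add F X hF ih =>
    set f₁₁ := biprod.inl ≫ f ≫ biprod.fst with h11
    set f₁₂ := biprod.inl ≫ f ≫ biprod.snd with h12
    set f₂₁ := biprod.inr ≫ f ≫ biprod.fst with h21
    set f₂₂ := biprod.inr ≫ f ≫ biprod.snd with h22
    have hiso : IsIso f₁₁ := by
      rcases (isLocalRing_end_iff.1 (isLocalRing_of_indecomposable hF)).2 f₁₁ with h | h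
      · exact h
      · have : FactorsAdd U (𝟙 F - f₁₁) := by
          have := (hf.comp_left (biprod.inl)).comp_right (-biprod.fst)
          convert this using 1
          simp [Preadditive.comp_sub, Preadditive.sub_comp, h11]
        exact absurd (hV F (inAdd_biprod_left (inAdd_self F)) (inAdd_of_factorsAdd this)) hF.1
    have h21' : FactorsAdd U f₂₁ := by
      have := (hf.comp_left biprod.inr).comp_right biprod.fst
      convert this using 1
      simp [Preadditive.comp_sub, Preadditive.sub_comp, h21]
    have h22' : FactorsAdd U (f₂₂ - 𝟙 X) := by
      have := (hf.comp_left biprod.inr).comp_right biprod.snd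
      convert this using 1
      simp [Preadditive.comp_sub, Preadditive.sub_comp, h22]
    have hg : IsIso (f₂₂ - f₂₁ ≫ inv f₁₁ ≫ f₁₂) :=
      ih (fun Z h h' => hV Z (inAdd_biprod_right h) h') _ (by
        have := h22'.sub (h21'.comp_right (inv f₁₁ ≫ f₁₂))
        convert this using 1
        abel)
    obtain ⟨L, R, hLR⟩ : ∃ L R : F ⊞ X ≅ F ⊞ X,
        L.hom ≫ f ≫ R.hom = biprod.map f₁₁ (f₂₂ - f₂₁ ≫ inv f₁₁ ≫ f₁₂) := by
      have := (Biprod.gaussian' f₁₁ f₁₂ f₂₁ f₂₂).2.2.2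
      exact ⟨_, _, by rw [← Biprod.ofComponents_eq f]; exact this⟩
    have hf' : f = L.inv ≫ biprod.map f₁₁ (f₂₂ - f₂₁ ≫ inv f₁₁ ≫ f₁₂) ≫ R.inv := by
      rw [← hLR]; simp
    have : IsIso (biprod.map f₁₁ (f₂₂ - f₂₁ ≫ inv f₁₁ ≫ f₁₂)) :=
      (biprod.mapIso (asIso f₁₁) (asIso (f₂₂ - f₂₁ ≫ inv f₁₁ ≫ f₁₂))).isIso_hom
    rw [hf']; infer_instance

end Additive

/-! ### The reduction is extriangulated -/

section Reduction

variable {C : Type u} [Category.{v} C] [Preadditive C] [HasFiniteBiproducts C]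
  [ExtriangulatedData.{w} C] {U : C}

instance : (projFunctor U).Full :=
  inferInstanceAs (CategoryTheory.Quotient.functor (idealRel U)).Full

lemma projFunctor_map_eq_iff {X Y : (perp U).FullSubcategory} (f g : X ⟶ Y) :
    (projFunctor U).map f = (projFunctor U).map g ↔ FactorsAdd U (f.hom - g.hom) :=
  CategoryTheory.Quotient.functor_map_eq_iff (idealRel U) f g

/-- Every object of the reduction is the image of an object of `C_U`. -/
@[elab_as_elim]
lemma Reduction.ind {p : Reduction U → Prop} (proj : ∀ X, p ((projFunctor U).obj X))
    (X : Reduction U) : p X :=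
  proj X.as

lemma realizes_map {A B Z : (perp U).FullSubcategory} {δ : Ext Z.obj A.obj} {i : A ⟶ B}
    {p : B ⟶ Z} (h : Realizes δ i.hom p.hom) :
    Realizes (C := Reduction U) (Z := (projFunctor U).obj Z) (A := (projFunctor U).obj A) δ
      ((projFunctor U).map i) ((projFunctor U).map p) :=
  ⟨B, i, p, Iso.refl _, h, Category.comp_id _, Category.id_comp _⟩

lemma realizes_proj_iff {Z A : (perp U).FullSubcategory} {B : Reduction U}
    (δ : Ext (C := Reduction U) ((projFunctor U).obj Z) ((projFunctor U).obj A))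
    (i : (projFunctor U).obj A ⟶ B) (p : B ⟶ (projFunctor U).obj Z) :
    Realizes δ i p ↔ ∃ (B₀ : (perp U).FullSubcategory) (i₀ : A ⟶ B₀) (p₀ : B₀ ⟶ Z)
      (e : (projFunctor U).obj B₀ ≅ B),
      Realizes (C := C) (Z := Z.obj) (A := A.obj) δ i₀.hom p₀.hom ∧
        (projFunctor U).map i₀ ≫ e.hom = i ∧ e.hom ≫ p = (projFunctor U).map p₀ :=
  Iff.rfl

/-- The direct sum in `C_U`. -/
noncomputable abbrev perpBiprod (X Y : (perp U).FullSubcategory) : (perp U).FullSubcategory :=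
  ⟨X.obj ⊞ Y.obj, perp_mem_biprod X.property Y.property⟩

/-- The projection to the reduction preserves direct sums. -/
noncomputable def projBiprodIso (X Y : (perp U).FullSubcategory) :
    (projFunctor U).obj (perpBiprod X Y) ≅ (projFunctor U).obj X ⊞ (projFunctor U).obj Y where
  hom := biprod.lift ((projFunctor U).map (X := perpBiprod X Y) (ObjectProperty.homMk biprod.fst))
    ((projFunctor U).map (X := perpBiprod X Y) (ObjectProperty.homMk biprod.snd))
  inv := biprod.desc ((projFunctor U).map (Y := perpBiprod X Y) (ObjectProperty.homMk biprod.inl))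
    ((projFunctor U).map (Y := perpBiprod X Y) (ObjectProperty.homMk biprod.inr))
  hom_inv_id := by
    rw [biprod.lift_desc, ← Functor.map_comp, ← Functor.map_comp, ← Functor.map_add,
      ← (projFunctor U).map_id]
    congr 1
    exact ObjectProperty.hom_ext _ (biprod.total (X := X.obj) (Y := Y.obj))
  inv_hom_id := by
    apply biprod.hom_ext' <;> apply biprod.hom_ext <;>
      simp only [biprod.inl_desc_assoc, biprod.inr_desc_assoc, Category.assoc, biprod.lift_fst,
        biprod.lift_snd, Category.comp_id, biprod.inl_fst, biprod.inl_snd, biprod.inr_fst,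
        biprod.inr_snd, ← Functor.map_comp]
    · rw [← (projFunctor U).map_id]; congr 1; ext; exact biprod.inl_fst
    · rw [← Functor.map_zero]; congr 1; ext; exact biprod.inl_snd
    · rw [← Functor.map_zero]; congr 1; ext; exact biprod.inr_fst
    · rw [← (projFunctor U).map_id]; congr 1; ext; exact biprod.inr_snd

lemma projBiprodIso_hom_fst (X Y : (perp U).FullSubcategory) :
    (projBiprodIso X Y).hom ≫ biprod.fst =
      (projFunctor U).map (X := perpBiprod X Y) (ObjectProperty.homMk biprod.fst) :=
  biprod.lift_fst _ _

lemma projBiprodIso_hom_snd (X Y : (perp U).FullSubcategory) :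
    (projBiprodIso X Y).hom ≫ biprod.snd =
      (projFunctor U).map (X := perpBiprod X Y) (ObjectProperty.homMk biprod.snd) :=
  biprod.lift_snd _ _

lemma map_inl_projBiprodIso_hom (X Y : (perp U).FullSubcategory) :
    (projFunctor U).map (Y := perpBiprod X Y) (ObjectProperty.homMk biprod.inl) ≫
      (projBiprodIso X Y).hom = biprod.inl := by
  rw [← Iso.eq_comp_inv]
  exact (biprod.inl_desc _ _).symm

lemma map_inr_projBiprodIso_hom (X Y : (perp U).FullSubcategory) :
    (projFunctor U).map (Y := perpBiprod X Y) (ObjectProperty.homMk biprod.inr) ≫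
      (projBiprodIso X Y).hom = biprod.inr := by
  rw [← Iso.eq_comp_inv]
  exact (biprod.inr_desc _ _).symm

lemma map_biprodMap_projBiprodIso_hom {X Y X' Y' : (perp U).FullSubcategory} (f : X ⟶ X')
    (g : Y ⟶ Y') :
    (projFunctor U).map (X := perpBiprod X Y) (Y := perpBiprod X' Y')
        (ObjectProperty.homMk (biprod.map f.hom g.hom)) ≫ (projBiprodIso X' Y').hom =
      (projBiprodIso X Y).hom ≫
        biprod.map ((projFunctor U).map f) ((projFunctor U).map g) := by
  apply biprod.hom_ext
  · rw [Category.assoc, projBiprodIso_hom_fst, Category.assoc, biprod.map_fst,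
      ← Category.assoc, projBiprodIso_hom_fst, ← Functor.map_comp, ← Functor.map_comp]
    congr 1
    exact ObjectProperty.hom_ext _ (biprod.map_fst f.hom g.hom)
  · rw [Category.assoc, projBiprodIso_hom_snd, Category.assoc, biprod.map_snd,
      ← Category.assoc, projBiprodIso_hom_snd, ← Functor.map_comp, ← Functor.map_comp]
    congr 1
    exact ObjectProperty.hom_ext _ (biprod.map_snd f.hom g.hom)

lemma push_projBiprodIso_extSum {Z A Z' A' : (perp U).FullSubcategory}
    (δ : Ext (C := Reduction U) ((projFunctor U).obj Z) ((projFunctor U).obj A))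
    (δ' : Ext (C := Reduction U) ((projFunctor U).obj Z') ((projFunctor U).obj A')) :
    push (C := Reduction U) (projBiprodIso A A').hom
        (show Ext (C := Reduction U) ((projFunctor U).obj (perpBiprod Z Z'))
            ((projFunctor U).obj (perpBiprod A A')) from
          extSum (C := C) (Z := Z.obj) (A := A.obj) (Z' := Z'.obj) (A' := A'.obj) δ δ') =
      pull (projBiprodIso Z Z').hom (extSum δ δ') := by
  have h : (show Ext (C := Reduction U) ((projFunctor U).obj (perpBiprod Z Z'))
      ((projFunctor U).obj (perpBiprod A A')) from
        extSum (C := C) (Z := Z.obj) (A := A.obj) (Z' := Z'.obj) (A' := A'.obj) δ δ') =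
      push (C := Reduction U)
          ((projFunctor U).map (Y := perpBiprod A A') (ObjectProperty.homMk biprod.inl))
        (pull ((projFunctor U).map (X := perpBiprod Z Z') (ObjectProperty.homMk biprod.fst)) δ) +
      push (C := Reduction U)
          ((projFunctor U).map (Y := perpBiprod A A') (ObjectProperty.homMk biprod.inr))
        (pull ((projFunctor U).map (X := perpBiprod Z Z') (ObjectProperty.homMk biprod.snd)) δ') :=
    rfl
  rw [h, map_add, ← push_comp, ← push_comp, map_inl_projBiprodIso_hom, map_inr_projBiprodIso_hom,
    extSum, map_add, ← push_pull, ← push_pull, ← pull_comp, ← pull_comp, projBiprodIso_hom_fst,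
    projBiprodIso_hom_snd]

variable [IsExtriangulated C]

instance : IsPreExtriangulated (Reduction U) where
  exists_realizes {Z A} δ := by
    induction Z using Reduction.ind with | proj Z
    induction A using Reduction.ind with | proj A
    obtain ⟨B, i, p, h⟩ := IsExtriangulated.exists_realizes (C := C) (Z := Z.obj)
      (A := A.obj) δ
    let B₀ : (perp U).FullSubcategory := ⟨B, Realizes.perp_middle h A.property Z.property⟩
    exact ⟨(projFunctor U).obj B₀, _, _, realizes_map (A := A) (B := B₀) (Z := Z)
      (i := ObjectProperty.homMk i) (p := ObjectProperty.homMk p) h⟩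
  realizes_iff {Z A B B'} δ i p i' p' h := by
    induction Z using Reduction.ind with | proj Z
    induction A using Reduction.ind with | proj A
    obtain ⟨B₀, i₀, p₀, e, hr, rfl, hp⟩ := (realizes_proj_iff _ _ _).1 h
    rw [realizes_proj_iff]
    constructor
    · rintro ⟨B₀', i₀', p₀', e', hr', rfl, hp'⟩
      obtain ⟨f, hf, hf'⟩ := (IsExtriangulated.realizes_iff _ _ _ _ _ hr).1 hr'
      let f₀ : B₀ ≅ B₀' := ObjectProperty.isoMk _ f
      have h1 : i₀ ≫ f₀.hom = i₀' := by ext; exact hf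
      have h2 : f₀.hom ≫ p₀' = p₀ := by ext; exact hf'
      refine ⟨e.symm ≪≫ (projFunctor U).mapIso f₀ ≪≫ e', ?_, ?_⟩
      · rw [← h1]; simp
      · simp only [Iso.trans_hom, Iso.symm_hom, Functor.mapIso_hom, Category.assoc, hp']
        rw [← Functor.map_comp, h2, ← hp]; simp
    · rintro ⟨f, rfl, rfl⟩
      exact ⟨B₀, i₀, p₀, e ≪≫ f, hr, by simp, by simpa using hp⟩
  exists_middle {Z A B Z' A' B'} δ δ' i p i' p' f h hδ hδ' hfh := by
    induction Z using Reduction.ind with | proj Z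
    induction A using Reduction.ind with | proj A
    induction Z' using Reduction.ind with | proj Z'
    induction A' using Reduction.ind with | proj A'
    obtain ⟨B₀, i₀, p₀, e, hr, rfl, hp⟩ := (realizes_proj_iff _ _ _).1 hδ
    obtain ⟨B₀', i₀', p₀', e', hr', rfl, hp'⟩ := (realizes_proj_iff _ _ _).1 hδ'
    obtain ⟨f₀, rfl⟩ := (projFunctor U).map_surjective f
    obtain ⟨h₀, rfl⟩ := (projFunctor U).map_surjective h
    obtain ⟨g, hg, hg'⟩ := IsExtriangulated.exists_middle _ _ _ _ _ _ f₀.hom h₀.hom hr hr' hfh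
    let g₀ : B₀ ⟶ B₀' := ObjectProperty.homMk g
    have h1 : i₀ ≫ g₀ = f₀ ≫ i₀' := by ext; exact hg
    have h2 : p₀ ≫ h₀ = g₀ ≫ p₀' := by ext; exact hg'
    refine ⟨e.inv ≫ (projFunctor U).map g₀ ≫ e'.hom, ?_, ?_⟩
    · simp only [Category.assoc, Iso.hom_inv_id_assoc]
      rw [← Functor.map_comp_assoc, h1, Functor.map_comp_assoc]
    · simp only [Category.assoc, hp']
      rw [← Functor.map_comp, ← h2, Functor.map_comp, ← hp]
      simp
  realizes_zero Z A := by
    induction Z using Reduction.ind with | proj Z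
    induction A using Reduction.ind with | proj A
    refine (realizes_proj_iff _ _ _).2 ⟨perpBiprod A Z, ObjectProperty.homMk biprod.inl,
      ObjectProperty.homMk biprod.snd, projBiprodIso A Z,
      IsExtriangulated.realizes_zero Z.obj A.obj, ?_, ?_⟩
    · rw [← Iso.eq_comp_inv]
      exact (biprod.inl_desc _ _).symm
    · exact biprod.lift_snd _ _
  et3 {Z A B Z' A' B'} δ δ' i p i' p' f g h h' hfg := by
    induction Z using Reduction.ind with | proj Z
    induction A using Reduction.ind with | proj A
    induction Z' using Reduction.ind with | proj Z'
    induction A' using Reduction.ind with | proj A'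
    obtain ⟨B₀, i₀, p₀, e, hr, rfl, hp⟩ := (realizes_proj_iff _ _ _).1 h
    obtain ⟨B₀', i₀', p₀', e', hr', rfl, hp'⟩ := (realizes_proj_iff _ _ _).1 h'
    obtain ⟨f₀, rfl⟩ := (projFunctor U).map_surjective f
    obtain ⟨g₀, hg₀⟩ := (projFunctor U).map_surjective (e.hom ≫ g ≫ e'.inv)
    have heq : (projFunctor U).map (i₀ ≫ g₀) = (projFunctor U).map (f₀ ≫ i₀') := by
      rw [Functor.map_comp, hg₀, Functor.map_comp, ← cancel_mono e'.hom]
      simpa using hfg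
    -- The difference factors through `add U`, and its first factor extends along `i₀`.
    obtain ⟨W, hW, a, b, hab⟩ := (projFunctor_map_eq_iff _ _).1 heq
    have := (perp_of_inAdd Z.property hW).2
    obtain ⟨a', ha'⟩ := Realizes.exists_extension hr a (Subsingleton.elim _ _)
    obtain ⟨k, hk, hk'⟩ := IsExtriangulated.et3 _ _ _ _ _ _ f₀.hom (g₀.hom - a' ≫ b) hr hr' (by
      rw [Preadditive.comp_sub, ← Category.assoc, ha', ← hab]
      simp)
    let g₁ : B₀ ⟶ B₀' := ObjectProperty.homMk (g₀.hom - a' ≫ b)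
    let k₀ : Z ⟶ Z' := ObjectProperty.homMk k
    have h1 : (projFunctor U).map g₁ = e.hom ≫ g ≫ e'.inv := by
      rw [← hg₀, eq_comm, projFunctor_map_eq_iff]
      exact ⟨W, hW, a', b, by simp [g₁]⟩
    have h2 : p₀ ≫ k₀ = g₁ ≫ p₀' := by ext; exact hk
    refine ⟨(projFunctor U).map k₀, ?_, hk'⟩
    rw [← cancel_epi e.hom, reassoc_of% hp, ← Functor.map_comp, h2, Functor.map_comp, h1, ← hp']
    simp
  et3_op {Z A B Z' A' B'} δ δ' i p i' p' g k h h' hfg := by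
    induction Z using Reduction.ind with | proj Z
    induction A using Reduction.ind with | proj A
    induction Z' using Reduction.ind with | proj Z'
    induction A' using Reduction.ind with | proj A'
    obtain ⟨B₀, i₀, p₀, e, hr, rfl, hp⟩ := (realizes_proj_iff _ _ _).1 h
    obtain ⟨B₀', i₀', p₀', e', hr', rfl, hp'⟩ := (realizes_proj_iff _ _ _).1 h'
    obtain ⟨k₀, rfl⟩ := (projFunctor U).map_surjective k
    obtain ⟨g₀, hg₀⟩ := (projFunctor U).map_surjective (e.hom ≫ g ≫ e'.inv)
    have heq : (projFunctor U).map (g₀ ≫ p₀') = (projFunctor U).map (p₀ ≫ k₀) := by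
      rw [Functor.map_comp, hg₀, Functor.map_comp, ← hp, ← hp']
      simp [hfg]
    obtain ⟨W, hW, a, b, hab⟩ := (projFunctor_map_eq_iff _ _).1 heq
    have := (perp_of_inAdd A'.property hW).1
    obtain ⟨b', hb'⟩ := Realizes.exists_lift hr' b (Subsingleton.elim _ _)
    obtain ⟨f, hf, hf'⟩ := IsExtriangulated.et3_op _ _ _ _ _ _ (g₀.hom - a ≫ b') k₀.hom hr hr' (by
      rw [Preadditive.sub_comp, Category.assoc, hb', ← hab]
      simp)
    let g₁ : B₀ ⟶ B₀' := ObjectProperty.homMk (g₀.hom - a ≫ b')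
    let f₀ : A ⟶ A' := ObjectProperty.homMk f
    have h1 : (projFunctor U).map g₁ = e.hom ≫ g ≫ e'.inv := by
      rw [← hg₀, eq_comm, projFunctor_map_eq_iff]
      exact ⟨W, hW, a, b', by simp [g₁]⟩
    have h2 : i₀ ≫ g₁ = f₀ ≫ i₀' := by ext; exact hf
    refine ⟨(projFunctor U).map f₀, ?_, hf'⟩
    rw [← cancel_mono e'.inv]
    have h3 : (projFunctor U).map i₀ ≫ (projFunctor U).map g₁ =
        (projFunctor U).map f₀ ≫ (projFunctor U).map i₀' := by
      rw [← Functor.map_comp, h2, Functor.map_comp]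
    rw [h1] at h3
    simpa using h3

instance isExtriangulated_reduction : IsExtriangulated (Reduction U) where
  exists_realizes := IsPreExtriangulated.exists_realizes
  realizes_iff := IsPreExtriangulated.realizes_iff
  exists_middle := IsPreExtriangulated.exists_middle
  realizes_zero := IsPreExtriangulated.realizes_zero
  et3 := IsPreExtriangulated.et3
  et3_op := IsPreExtriangulated.et3_op
  realizes_sum {Z A B Z' A' B'} δ δ' i p i' p' h h' := by
    induction Z using Reduction.ind with | proj Z
    induction A using Reduction.ind with | proj A
    induction Z' using Reduction.ind with | proj Z'
    induction A' using Reduction.ind with | proj A'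
    obtain ⟨B₀, i₀, p₀, e, hr, rfl, hp⟩ := (realizes_proj_iff _ _ _).1 h
    obtain ⟨B₀', i₀', p₀', e', hr', rfl, hp'⟩ := (realizes_proj_iff _ _ _).1 h'
    have hs := realizes_map (A := perpBiprod A A') (B := perpBiprod B₀ B₀')
      (Z := perpBiprod Z Z') (i := ObjectProperty.homMk (biprod.map i₀.hom i₀'.hom))
      (p := ObjectProperty.homMk (biprod.map p₀.hom p₀'.hom))
      (IsExtriangulated.realizes_sum _ _ _ _ _ _ hr hr')
    refine Realizes.of_iso hs (projBiprodIso A A') (projBiprodIso B₀ B₀' ≪≫ biprod.mapIso e e')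
      (projBiprodIso Z Z') (push_projBiprodIso_extSum δ δ') ?_ ?_
    · rw [Iso.trans_hom, ← Category.assoc, map_biprodMap_projBiprodIso_hom, Category.assoc]
      congr 1
      apply biprod.hom_ext' <;> simp
    · rw [map_biprodMap_projBiprodIso_hom, Iso.trans_hom, Category.assoc]
      congr 1
      apply biprod.hom_ext' <;> simp [reassoc_of% hp, reassoc_of% hp']
  et4 {A B X Y W} δ δ' f f' g g' h h' := by
    induction A using Reduction.ind with | proj A
    induction B using Reduction.ind with | proj B
    induction X using Reduction.ind with | proj X
    induction W using Reduction.ind with | proj W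
    obtain ⟨B₀, f₀, f₀', e, hr, rfl, hf'⟩ := (realizes_proj_iff _ _ _).1 h
    obtain ⟨Y₀, g₀, g₀', ψ, hr', hg, hg'⟩ :=
      (realizes_proj_iff _ _ _).1 (Realizes.push_iso h' e.symm)
    obtain ⟨V, q, d, c, θ, h1, h2, h3, h4, h5, h6⟩ :=
      IsExtriangulated.et4 _ _ _ _ _ _ hr hr'
    let V₀ : (perp U).FullSubcategory := ⟨V, Realizes.perp_middle h4 X.property W.property⟩
    let q₀ : Y₀ ⟶ V₀ := ObjectProperty.homMk q
    let d₀ : X ⟶ V₀ := ObjectProperty.homMk d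
    let c₀ : V₀ ⟶ W := ObjectProperty.homMk c
    have h1' : f₀' ≫ d₀ = g₀ ≫ q₀ := ObjectProperty.hom_ext _ h1
    have h2' : q₀ ≫ c₀ = g₀' := ObjectProperty.hom_ext _ h2
    refine ⟨(projFunctor U).obj V₀, ψ.inv ≫ (projFunctor U).map q₀, (projFunctor U).map d₀,
      (projFunctor U).map c₀, θ, ?_, ?_, ?_, ?_, h5, ?_⟩
    · rw [← cancel_epi e.hom, reassoc_of% hf', ← Functor.map_comp, h1', Functor.map_comp]
      rw [Iso.symm_inv] at hg
      rw [← reassoc_of% hg, Iso.hom_inv_id_assoc]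
    · rw [Category.assoc, ← Functor.map_comp, h2', ← hg', Iso.inv_hom_id_assoc]
    · refine (realizes_proj_iff _ _ _).2 ⟨Y₀, f₀ ≫ g₀, q₀, ψ, h3, ?_, ?_⟩
      · rw [Functor.map_comp, Category.assoc, hg, Iso.symm_inv, Category.assoc]
      · rw [Iso.hom_inv_id_assoc]
    · have := realizes_map (A := X) (B := V₀) (Z := W) (i := d₀) (p := c₀) h4
      have h7 : push ((projFunctor U).map f₀') (push e.inv δ') = push f' δ' := by
        rw [← push_comp, ← hf', Iso.inv_hom_id_assoc]
      rw [← h7]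
      exact this
    · have h8 : push ((projFunctor U).map f₀) θ = pull ((projFunctor U).map c₀)
          (push e.symm.hom δ') := h6
      refine (push_comp (C := Reduction U) (Z := (projFunctor U).obj V₀)
        ((projFunctor U).map f₀) e.hom θ).trans ?_
      rw [h8, push_pull, ← push_comp, Iso.symm_hom, Iso.inv_hom_id, push_id]
  et4_op {A B X Y W} δ δ' f' f g' g h h' := by
    induction A using Reduction.ind with | proj A
    induction B using Reduction.ind with | proj B
    induction X using Reduction.ind with | proj X
    induction W using Reduction.ind with | proj W
    obtain ⟨B₀, g₀', g₀, e, hr', rfl, hg⟩ := (realizes_proj_iff _ _ _).1 h'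
    obtain ⟨Y₀, f₀', f₀, ψ, hr, hf', hf⟩ :=
      (realizes_proj_iff _ _ _).1 (Realizes.pull_iso h e.symm)
    obtain ⟨V, q, d, c, θ, h1, h2, h3, h4, h5, h6⟩ :=
      IsExtriangulated.et4_op _ _ _ _ _ _ hr hr'
    let V₀ : (perp U).FullSubcategory := ⟨V, Realizes.perp_middle h4 X.property W.property⟩
    let q₀ : V₀ ⟶ Y₀ := ObjectProperty.homMk q
    let d₀ : X ⟶ V₀ := ObjectProperty.homMk d
    let c₀ : V₀ ⟶ W := ObjectProperty.homMk c
    have h1' : q₀ ≫ f₀ = c₀ ≫ g₀' := ObjectProperty.hom_ext _ h1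
    have h2' : d₀ ≫ q₀ = f₀' := ObjectProperty.hom_ext _ h2
    rw [Iso.symm_hom] at hf
    refine ⟨(projFunctor U).obj V₀, (projFunctor U).map q₀ ≫ ψ.hom, (projFunctor U).map d₀,
      (projFunctor U).map c₀, θ, ?_, ?_, ?_, ?_, ?_, ?_⟩
    · have : f = ψ.inv ≫ (projFunctor U).map f₀ ≫ e.hom := by rw [← hf]; simp
      rw [this, Category.assoc, Iso.hom_inv_id_assoc, ← Functor.map_comp_assoc, h1',
        Functor.map_comp_assoc]
    · rw [← Functor.map_comp_assoc, h2', hf']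
    · refine (realizes_proj_iff _ _ _).2 ⟨Y₀, q₀, f₀ ≫ g₀, ψ, h3, rfl, ?_⟩
      rw [Functor.map_comp, ← hf, ← hg]
      simp
    · have := realizes_map (A := X) (B := V₀) (Z := W) (i := d₀) (p := c₀) h4
      have h7 : pull ((projFunctor U).map g₀') (pull e.hom δ) =
          pull ((projFunctor U).map g₀' ≫ e.hom) δ := (pull_comp _ _ _).symm
      rw [← h7]
      exact this
    · exact h5
    · have h8 : pull ((projFunctor U).map g₀) θ = push ((projFunctor U).map d₀)
          (pull e.symm.inv δ) := h6
      have h9 : g = e.inv ≫ (projFunctor U).map g₀ := by rw [← hg]; simp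
      rw [h9]
      refine (pull_comp (C := Reduction U) (A := (projFunctor U).obj V₀)
        e.inv ((projFunctor U).map g₀) θ).trans ?_
      rw [h8, ← push_pull, ← pull_comp, Iso.symm_inv, Iso.inv_hom_id, pull_id]

end Reduction

/-! ### The reduction is a Krull–Schmidt category -/

section KrullSchmidt

variable {C : Type u} [Category.{v} C] [Preadditive C] [HasFiniteBiproducts C]
  [ExtriangulatedData.{w} C] {U : C}

lemma isZero_proj_iff (X : (perp U).FullSubcategory) :
    IsZero ((projFunctor U).obj X) ↔ InAdd U X.obj := by
  rw [IsZero.iff_id_eq_zero, ← (projFunctor U).map_id, ← Functor.map_zero (projFunctor U) X X,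
    projFunctor_map_eq_iff]
  have h : (𝟙 X : X ⟶ X).hom - (0 : X ⟶ X).hom = 𝟙 X.obj := sub_zero _
  rw [h]
  exact ⟨fun h => inAdd_of_factorsAdd h, fun h => ⟨_, h, 𝟙 _, 𝟙 _, by simp⟩⟩

lemma isIso_proj_map {X Y : (perp U).FullSubcategory} (f : X ⟶ Y) [h : IsIso f.hom] :
    IsIso ((projFunctor U).map f) := by
  have : IsIso f := ⟨ObjectProperty.homMk (inv f.hom), by ext; simp, by ext; simp⟩
  infer_instance

lemma isLocalRing_end_proj {X : (perp U).FullSubcategory} (hX : IsLocalRing (End X.obj))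
    (h : ¬ InAdd U X.obj) : IsLocalRing (End ((projFunctor U).obj X)) := by
  rw [isLocalRing_end_iff, isZero_proj_iff]
  refine ⟨h, fun a => ?_⟩
  obtain ⟨a, rfl⟩ := (projFunctor U).map_surjective a
  rcases (isLocalRing_end_iff.1 hX).2 a.hom with h1 | h1
  · exact Or.inl (isIso_proj_map a)
  · right
    have : IsIso (𝟙 X - a : X ⟶ X).hom := h1
    rw [← (projFunctor U).map_id, ← Functor.map_sub]
    exact isIso_proj_map _

/-- An object of `C_U` decomposes in the reduction like in `C`, except that the summands in
`add U` disappear. -/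
lemma exists_proj_decomposition [IsKrullSchmidt C] (X : (perp U).FullSubcategory) :
    ∃ (ι : Type) (_ : Finite ι) (F : ι → (perp U).FullSubcategory),
      (∀ i, IsLocalRing (End (F i).obj)) ∧ (∀ i, ¬ InAdd U (F i).obj) ∧
      (∀ i, Nonempty (Retract (F i).obj X.obj)) ∧
      Nonempty ((projFunctor U).obj X ≅ ⨁ fun i => (projFunctor U).obj (F i)) := by
  classical
  obtain ⟨ι, _, F, hF, ⟨e⟩⟩ := IsKrullSchmidt.exists_decomposition X.obj
  have := Fintype.ofFinite ι
  let F₀ : ι → (perp U).FullSubcategory := fun i =>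
    ⟨F i, perp_retract X.property ⟨biproduct.ι F i ≫ e.inv, e.hom ≫ biproduct.π F i, by simp⟩⟩
  let s : ∀ i, X ⟶ F₀ i := fun i => ObjectProperty.homMk (e.hom ≫ biproduct.π F i)
  let r : ∀ i, F₀ i ⟶ X := fun i => ObjectProperty.homMk (biproduct.ι F i ≫ e.inv)
  refine ⟨{i // ¬ InAdd U (F i)}, inferInstance, fun i => F₀ i, fun i => hF i, fun i => i.2,
    fun i => ⟨⟨biproduct.ι F i ≫ e.inv, e.hom ≫ biproduct.π F i, by simp [F₀]⟩⟩,
    nonempty_iso_biproduct (fun i => (projFunctor U).map (s i))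
      (fun i => (projFunctor U).map (r i)) ?_ ?_ ?_⟩
  · intro i
    rw [← Functor.map_comp, ← (projFunctor U).map_id]
    congr 1
    ext
    simp [s, r, F₀]
  · intro i j hij
    rw [← Functor.map_comp, ← Functor.map_zero (projFunctor U)]
    congr 1
    ext
    have : (i : ι) ≠ j := fun h => hij (Subtype.ext h)
    simp [s, r, biproduct.ι_π_ne F this]
  · have h0 : ∀ i, InAdd U (F i) → (projFunctor U).map (s i) ≫ (projFunctor U).map (r i) = 0 :=
      fun i hi => by rw [((isZero_proj_iff (F₀ i)).2 hi).eq_of_tgt ((projFunctor U).map (s i)) 0,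
        zero_comp]
    have h1 : ∑ i, (projFunctor U).map (s i) ≫ (projFunctor U).map (r i) =
        𝟙 ((projFunctor U).obj X) := by
      simp_rw [← Functor.map_comp]
      rw [← Functor.map_sum, ← (projFunctor U).map_id]
      congr 1
      apply (perp U).ι.map_injective
      rw [Functor.map_sum]
      calc ∑ i, (e.hom ≫ biproduct.π F i) ≫ (biproduct.ι F i ≫ e.inv)
          = e.hom ≫ (∑ i, biproduct.π F i ≫ biproduct.ι F i) ≫ e.inv := by
            simp only [Preadditive.sum_comp, Preadditive.comp_sum, Category.assoc]
        _ = 𝟙 X.obj := by rw [biproduct.total]; simp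
    rw [← h1, ← Fintype.sum_subtype_add_sum_subtype (fun i => ¬ InAdd U (F i)), left_eq_add]
    exact Finset.sum_eq_zero fun i _ => h0 i (not_not.1 i.2)

instance [IsKrullSchmidt C] : IsKrullSchmidt (Reduction U) where
  exists_decomposition X := by
    induction X using Reduction.ind with | proj X
    obtain ⟨ι, hι, F, hF, hU, -, e⟩ := exists_proj_decomposition X
    exact ⟨ι, hι, _, fun i => isLocalRing_end_proj (hF i) (hU i), e⟩

end KrullSchmidt

/-! ### The reduction is reduced 0-Auslander -/

/-- The groups `Hom(U, X)` and `Hom(X, U)` are finitely generated over `End U`. Unlike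
Hom-finiteness over a field, this refers to the preadditive structure only. -/
class HasFiniteApproximations (C : Type u) [Category.{v} C] [Preadditive C] : Prop where
  right : ∀ U X : C, ∃ (n : ℕ) (f : Fin n → (U ⟶ X)), ∀ g : U ⟶ X,
    ∃ a : Fin n → (U ⟶ U), g = ∑ i, a i ≫ f i
  left : ∀ U X : C, ∃ (n : ℕ) (f : Fin n → (X ⟶ U)), ∀ g : X ⟶ U,
    ∃ a : Fin n → (U ⟶ U), g = ∑ i, f i ≫ a i

lemma hasFiniteApproximations_of_homFinite {k : Type*} [Field k] (C : Type u) [Category.{v} C]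
    [Preadditive C] [Linear k C] (h : ∀ X Y : C, Module.Finite k (X ⟶ Y)) :
    HasFiniteApproximations C where
  right U X := by
    obtain ⟨n, f, hf⟩ := Module.Finite.exists_fin (R := k) (M := U ⟶ X)
    refine ⟨n, f, fun g => ?_⟩
    obtain ⟨c, hc⟩ := (Submodule.mem_span_range_iff_exists_fun k).1
      (hf ▸ Submodule.mem_top : g ∈ Submodule.span k (Set.range f))
    exact ⟨fun i => c i • 𝟙 U, by simp [← hc]⟩
  left U X := by
    obtain ⟨n, f, hf⟩ := Module.Finite.exists_fin (R := k) (M := X ⟶ U)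
    refine ⟨n, f, fun g => ?_⟩
    obtain ⟨c, hc⟩ := (Submodule.mem_span_range_iff_exists_fun k).1
      (hf ▸ Submodule.mem_top : g ∈ Submodule.span k (Set.range f))
    exact ⟨fun i => c i • 𝟙 U, by simp [← hc]⟩

instance {C : Type u} [Category.{v} C] [Preadditive C] [HasFiniteBiproducts C]
    [ExtriangulatedData.{w} C] [HasFiniteApproximations C] (U : C) :
    HasFiniteApproximations (Reduction U) where
  right V X := by
    induction V using Reduction.ind with | proj V
    induction X using Reduction.ind with | proj X
    obtain ⟨n, f, hf⟩ := HasFiniteApproximations.right V.obj X.obj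
    refine ⟨n, fun i => (projFunctor U).map (ObjectProperty.homMk (f i)), fun g => ?_⟩
    obtain ⟨g, rfl⟩ := (projFunctor U).map_surjective g
    obtain ⟨a, ha⟩ := hf g.hom
    refine ⟨fun i => (projFunctor U).map (ObjectProperty.homMk (a i)), ?_⟩
    simp_rw [← Functor.map_comp]
    rw [← Functor.map_sum]
    congr 1
    apply (perp U).ι.map_injective
    rw [Functor.map_sum]
    exact ha
  left V X := by
    induction V using Reduction.ind with | proj V
    induction X using Reduction.ind with | proj X
    obtain ⟨n, f, hf⟩ := HasFiniteApproximations.left V.obj X.obj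
    refine ⟨n, fun i => (projFunctor U).map (ObjectProperty.homMk (f i)), fun g => ?_⟩
    obtain ⟨g, rfl⟩ := (projFunctor U).map_surjective g
    obtain ⟨a, ha⟩ := hf g.hom
    refine ⟨fun i => (projFunctor U).map (ObjectProperty.homMk (a i)), ?_⟩
    simp_rw [← Functor.map_comp]
    rw [← Functor.map_sum]
    congr 1
    apply (perp U).ι.map_injective
    rw [Functor.map_sum]
    exact ha

lemma inAdd_biproduct {C : Type u} [Category.{v} C] [Preadditive C] [HasFiniteBiproducts C]
    (U : C) (n : ℕ) : InAdd U (⨁ fun _ : Fin n => U) :=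
  ⟨n, ⟨Retract.refl _⟩⟩

section ZeroAuslander

variable {C : Type u} [Category.{v} C] [Preadditive C] [HasFiniteBiproducts C]
  [ExtriangulatedData.{w} C]

/-- `𝔼(X, -)` is right exact if `X` has a projective presentation of length one. -/
lemma Realizes.exists_push_eq [IsExtriangulated C] {A B Z : C} {δ : Ext Z A} {i : A ⟶ B}
    {p : B ⟶ Z} (h : Realizes δ i p) {P₁ P₀ X : C} {θ : Ext X P₁} {j : P₁ ⟶ P₀} {q : P₀ ⟶ X}
    (hθ : Realizes θ j q) (hP₁ : IsProj P₁) (hP₀ : IsProj P₀) (ε : Ext X Z) :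
    ∃ ε' : Ext X B, push p ε' = ε := by
  have := isProj_iff.1 hP₀ Z
  obtain ⟨φ, rfl⟩ := Realizes.exists_eq_push hθ ε (Subsingleton.elim _ _)
  obtain ⟨ψ, rfl⟩ := hP₁ p ⟨A, δ, i, h⟩ φ
  exact ⟨push ψ θ, (push_comp _ _ _).symm⟩

variable [IsReducedZeroAuslander C]

open IsReducedZeroAuslander

lemma Realizes.exists_push_eq_of_reducedZeroAuslander {A B Z : C} {δ : Ext Z A} {i : A ⟶ B}
    {p : B ⟶ Z} (h : Realizes δ i p) {X : C} (ε : Ext X Z) : ∃ ε' : Ext X B, push p ε' = ε := by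
  obtain ⟨P₁, P₀, j, q, h₁, h₀, θ, hθ⟩ := exists_presentation X
  exact Realizes.exists_push_eq h hθ h₁ h₀ ε

/-- A projective `P` has a conflation `P ⟶ N ⟶ ΣP` with `N` zero and `ΣP` injective. -/
lemma IsProj.exists_suspension {P : C} (hP : IsProj P) :
    ∃ (N I : C) (i : P ⟶ N) (p : N ⟶ I) (δ : Ext I P), IsZero N ∧ IsInj I ∧ Realizes δ i p := by
  obtain ⟨Q, I, i, p, h1, h2, h3, δ, h⟩ := exists_coresolution P hP
  exact ⟨Q, I, i, p, δ, reduced Q h1 h2, h3, h⟩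

lemma isInj_of_isZero_middle {A N Z : C} {δ : Ext Z A} {i : A ⟶ N} {p : N ⟶ Z}
    (h : Realizes δ i p) (hN : IsZero N) : IsInj Z :=
  isInj_iff.2 fun X => subsingleton_of_forall_eq 0 fun ε => by
    obtain ⟨ε', rfl⟩ := Realizes.exists_push_eq_of_reducedZeroAuslander h ε
    rw [← push_id ε', hN.eq_of_src (𝟙 N) 0, push_zero, map_zero]

/-- Every object has an injective coresolution of length one: the sequence `X ⟶ ΣP₁ ⟶ ΣP₀`
obtained from a presentation `P₁ ⟶ P₀ ⟶ X`. The middle term moreover is the cone of an inflation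
to zero. -/
lemma exists_injective_coresolution (X : C) : ∃ (J₀ J₁ : C) (i : X ⟶ J₀) (p : J₀ ⟶ J₁)
    (δ : Ext J₁ X), IsInj J₀ ∧ IsInj J₁ ∧ Realizes δ i p ∧
      ∃ (N : C) (q : N ⟶ J₀), IsZero N ∧ IsDeflation q := by
  obtain ⟨P₁, P₀, j, q, h₁, h₀, θ, hθ⟩ := exists_presentation X
  obtain ⟨N, J₁, a, b, η, hN, hJ, hη⟩ := h₀.exists_suspension
  obtain ⟨J₀, h', d, e, θ', -, -, h3, h4, -⟩ := IsExtriangulated.et4 _ _ _ _ _ _ hθ hη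
  exact ⟨J₀, J₁, d, e, _, isInj_of_isZero_middle h3 hN, hJ, h4, N, h', hN, ⟨_, _, _, h3⟩⟩

/-- `𝔼(-, X)` is right exact. -/
lemma Realizes.exists_pull_eq {A B Z : C} {δ : Ext Z A} {i : A ⟶ B}
    {p : B ⟶ Z} (h : Realizes δ i p) {X : C} (ε : Ext A X) : ∃ ε' : Ext B X, pull i ε' = ε := by
  obtain ⟨J₀, J₁, j, q, θ, h₀, h₁, hθ, -⟩ := exists_injective_coresolution X
  have := isInj_iff.1 h₀ A
  obtain ⟨φ, rfl⟩ := Realizes.exists_eq_pull hθ ε (Subsingleton.elim _ _)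
  obtain ⟨ψ, rfl⟩ := h₁ i ⟨Z, δ, p, h⟩ φ
  exact ⟨pull ψ θ, (pull_comp _ _ _).symm⟩

lemma isProj_of_isZero_middle {A N Z : C} {δ : Ext Z A} {i : A ⟶ N} {p : N ⟶ Z}
    (h : Realizes δ i p) (hN : IsZero N) : IsProj A :=
  isProj_iff.2 fun X => subsingleton_of_forall_eq 0 fun ε => by
    obtain ⟨ε', rfl⟩ := Realizes.exists_pull_eq h ε
    rw [← pull_id ε', hN.eq_of_src (𝟙 N) 0, pull_zero, map_zero]

variable [HasFiniteApproximations C]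

/-- The universal extension of `X` by copies of `U`. -/
lemma exists_universal_extension {U : C} (hU : IsPresilting U) (X : C) :
    ∃ (n : ℕ) (B : C) (i : X ⟶ B) (p : B ⟶ ⨁ fun _ : Fin n => U)
      (ε : Ext (⨁ fun _ : Fin n => U) X), Realizes ε i p ∧ Subsingleton (Ext U B) := by
  obtain ⟨J₀, J₁, j, q, θ, h₀, -, hθ, -⟩ := exists_injective_coresolution X
  have := isInj_iff.1 h₀ U
  obtain ⟨n, f, hf⟩ := HasFiniteApproximations.right U J₁
  obtain ⟨B, i, p, hB⟩ := IsExtriangulated.exists_realizes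
    (pull (biproduct.desc f : (⨁ fun _ : Fin n => U) ⟶ J₁) θ)
  refine ⟨n, B, i, p, _, hB, subsingleton_of_forall_eq 0 fun ζ => ?_⟩
  have := (perp_symm (perp_of_inAdd ((isPresilting_iff U).1 hU) (inAdd_biproduct U n))).1
  obtain ⟨ξ, rfl⟩ := Realizes.exists_eq_push_of_push_eq_zero hB ζ (Subsingleton.elim _ _)
  obtain ⟨g, rfl⟩ := Realizes.exists_eq_pull hθ ξ (Subsingleton.elim _ _)
  obtain ⟨a, rfl⟩ := hf g
  rw [← biproduct.lift_desc, pull_comp, push_pull, Realizes.push_self hB, map_zero]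

/-- The Bongartz completion: each object `X` of `C_U` has a presentation `B ⟶ M ⟶ X` by objects
that are projective in `C_U`, where `M` is an extension of some `U ⊕ ⋯ ⊕ U` by a projective. -/
lemma exists_bongartz_presentation {U : C} (hU : IsPresilting U) {X : C} (hX : perp U X) :
    ∃ (B M : C) (i : B ⟶ M) (p : M ⟶ X) (δ : Ext X B), perp U B ∧ perp U M ∧ Realizes δ i p ∧
      (∀ Y, perp U Y → Subsingleton (Ext B Y)) ∧ (∀ Y, perp U Y → Subsingleton (Ext M Y)) ∧
      ∃ (n : ℕ) (P : C) (j : P ⟶ M) (q : M ⟶ ⨁ fun _ : Fin n => U)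
        (θ : Ext (⨁ fun _ : Fin n => U) P), IsProj P ∧ Realizes θ j q := by
  obtain ⟨P₁, P₀, j, q, h₁, h₀, θ, hθ⟩ := exists_presentation X
  obtain ⟨n, B, i, p, ε, hε, hUB⟩ := exists_universal_extension hU P₁
  obtain ⟨M, m, e, m', e', hM, hM'⟩ := Realizes.exists_pushout hθ hε
  have hUn : ∀ Y, perp U Y → Subsingleton (Ext (⨁ fun _ : Fin n => U) Y) :=
    fun Y hY => (perp_of_inAdd hY (inAdd_biproduct U n)).1
  have hB : ∀ Y, perp U Y → Subsingleton (Ext B Y) :=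
    fun Y hY => Realizes.subsingleton_ext_left hε (isProj_iff.1 h₁ Y) (hUn Y hY)
  have hBU : perp U B := ⟨hUB, hB U ((isPresilting_iff U).1 hU)⟩
  exact ⟨B, M, m', e', _, hBU, Realizes.perp_middle hM' hBU hX, hM', hB,
    fun Y hY => Realizes.subsingleton_ext_left hM (isProj_iff.1 h₀ Y) (hUn Y hY),
    n, P₀, m, e, _, h₀, hM⟩

/-- An extension `M` of `U ⊕ ⋯ ⊕ U` by a projective `P` has an inflation
to an object of `add U` with cone in `C_U`: the pushout along `P ⟶ M` of the left
`add U`-approximation of `P`, which is an inflation since `P ⟶ 0` is one. -/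
lemma exists_inflation_to_add {U : C} (hU : IsPresilting U) {M : C} {n : ℕ} {P : C}
    {j : P ⟶ M} {q : M ⟶ ⨁ fun _ : Fin n => U} {θ : Ext (⨁ fun _ : Fin n => U) P} (hP : IsProj P)
    (hθ : Realizes θ j q) : ∃ (E W : C) (i : M ⟶ E) (p : E ⟶ W) (δ : Ext W M),
      InAdd U E ∧ perp U W ∧ Realizes δ i p := by
  have hUU := (isPresilting_iff U).1 hU
  obtain ⟨N, I, a, b, η, hN, -, hη⟩ := hP.exists_suspension
  obtain ⟨m, f, hf⟩ := HasFiniteApproximations.left U P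
  obtain ⟨W, ζ, p, hζ⟩ := isInflation_of_isZero hN ⟨I, η, b, hη⟩
    (biproduct.lift f : P ⟶ ⨁ fun _ : Fin m => U)
  have hUm := perp_of_inAdd hUU (inAdd_biproduct U m)
  have hW : perp U W := by
    have := hUm.1
    have := hUm.2
    refine ⟨subsingleton_of_forall_eq 0 fun ξ => ?_, subsingleton_of_forall_eq 0 fun ξ => ?_⟩
    · obtain ⟨ξ', rfl⟩ := Realizes.exists_push_eq_of_reducedZeroAuslander hζ ξ
      rw [Subsingleton.elim ξ' 0, map_zero]
    · obtain ⟨g, rfl⟩ := Realizes.exists_eq_push hζ ξ (Subsingleton.elim _ _)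
      obtain ⟨c, rfl⟩ := hf g
      rw [← biproduct.lift_desc, Realizes.push_comp_eq_zero hζ]
  obtain ⟨E, i, e, i', e', hE, hE'⟩ := Realizes.exists_pushout hθ hζ
  have := (perp_of_inAdd (perp_symm hUm) (inAdd_biproduct U n)).1
  rw [Subsingleton.elim (push _ θ) 0] at hE'
  obtain ⟨r, s, -, -, -, hrs⟩ := Realizes.exists_splitting hE'
  exact ⟨E, W, i, e, _, ((inAdd_biproduct U m).biprod (inAdd_biproduct U n)).of_retract
    ⟨biprod.lift r e', biprod.desc i' s, by rw [biprod.lift_desc, hrs]⟩, hW, hE⟩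

/-- In the reduction, every object has a presentation by projectives whose degree zero term has an
inflation to zero. -/
lemma exists_presentation_reduction {U : C} (hU : IsPresilting U) (X : Reduction U) :
    ∃ (B M : Reduction U) (i : B ⟶ M) (p : M ⟶ X) (δ : Ext X B), IsProj B ∧ IsProj M ∧
      Realizes δ i p ∧ ∃ (N : Reduction U) (j : M ⟶ N), IsZero N ∧ IsInflation j := by
  induction X using Reduction.ind with | proj X
  obtain ⟨B, M, i, p, δ, hB, hM, h, hB', hM', n, P, j, q, θ, hP, hθ⟩ :=
    exists_bongartz_presentation hU X.property
  obtain ⟨E, W, k, l, ζ, hE, hW, hζ⟩ := exists_inflation_to_add hU hP hθ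
  let B₀ : (perp U).FullSubcategory := ⟨B, hB⟩
  let M₀ : (perp U).FullSubcategory := ⟨M, hM⟩
  let W₀ : (perp U).FullSubcategory := ⟨W, hW⟩
  let E₀ : (perp U).FullSubcategory := ⟨E, Realizes.perp_middle hζ hM hW⟩
  refine ⟨(projFunctor U).obj B₀, (projFunctor U).obj M₀, _, _, δ,
    isProj_iff.2 fun Y => hB' Y.as.obj Y.as.property,
    isProj_iff.2 fun Y => hM' Y.as.obj Y.as.property,
    realizes_map (A := B₀) (B := M₀) (Z := X) (i := ObjectProperty.homMk i)
      (p := ObjectProperty.homMk p) h, (projFunctor U).obj E₀, _, (isZero_proj_iff E₀).2 hE,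
    (projFunctor U).obj W₀, ζ, _, realizes_map (A := M₀) (B := E₀) (Z := W₀)
      (i := ObjectProperty.homMk k) (p := ObjectProperty.homMk l) hζ⟩

/-- The presilting reduction of a reduced 0-Auslander category is reduced 0-Auslander. -/
lemma isReducedZeroAuslander_reduction {U : C} (hU : IsPresilting U) :
    IsReducedZeroAuslander (Reduction U) := by
  have key : ∀ P : Reduction U, IsProj P → ∃ (N I : Reduction U) (i : P ⟶ N) (p : N ⟶ I)
      (δ : Ext I P), IsZero N ∧ IsInj I ∧ Realizes δ i p := by
    intro P hP
    obtain ⟨B, M, i, p, δ, -, -, h, N, j, hN, hj⟩ := exists_presentation_reduction hU P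
    -- `P` is a direct summand of `M`, and the inclusion of a summand is an inflation.
    have := isProj_iff.1 hP B
    rw [Subsingleton.elim δ 0] at h
    obtain ⟨r, s, hr, hs, hsr, hrs⟩ := Realizes.exists_splitting h
    have hs' : IsInflation s := ⟨B, 0, r, realizes_of_splitting hs hr hsr
      (Realizes.comp_eq_zero h) (by rw [add_comm]; exact hrs)⟩
    obtain ⟨I, θ, q, hθ⟩ := hs'.comp hj
    refine ⟨N, I, _, q, θ, hN, isInj_iff.2 fun Y => subsingleton_of_forall_eq 0 fun ε => ?_, hθ⟩
    obtain ⟨P₁, P₀, a, b, η, h₁, h₀, hη, -⟩ := exists_presentation_reduction hU Y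
    obtain ⟨ε', rfl⟩ := Realizes.exists_push_eq hθ hη h₁ h₀ ε
    rw [← push_id ε', hN.eq_of_src (𝟙 N) 0, push_zero, map_zero]
  refine { enough_proj := ?_, exists_presentation := ?_, exists_coresolution := ?_, reduced := ?_ }
  · intro X
    obtain ⟨B, M, i, p, δ, -, hM, h, -⟩ := exists_presentation_reduction hU X
    exact ⟨M, p, hM, B, δ, i, h⟩
  · intro X
    obtain ⟨B, M, i, p, δ, hB, hM, h, -⟩ := exists_presentation_reduction hU X
    exact ⟨B, M, i, p, hB, hM, δ, h⟩
  · intro P hP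
    obtain ⟨N, I, i, p, δ, hN, hI, h⟩ := key P hP
    exact ⟨N, I, i, p, fun _ _ _ _ _ => ⟨0, hN.eq_of_src _ _⟩, fun _ _ _ _ _ =>
      ⟨0, hN.eq_of_tgt _ _⟩, hI, δ, h⟩
  · intro Q hP hI
    obtain ⟨N, I, i, p, δ, hN, -, h⟩ := key Q hP
    obtain ⟨g, hg⟩ := hI i ⟨I, δ, p, h⟩ (𝟙 Q)
    exact isZero_of_retract hN ⟨i, g, hg⟩

end ZeroAuslander

/-! ### Signed presilting sequences are orderings of the summands -/

section Suspension

variable {C : Type u} [Category.{v} C] [Preadditive C] [HasFiniteBiproducts C]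
  [ExtriangulatedData.{w} C]

lemma nonempty_iso_of_isZero_middle [IsPreExtriangulated C] {A N Z N' Z' : C} {δ : Ext Z A}
    {i : A ⟶ N} {p : N ⟶ Z} {δ' : Ext Z' A} {i' : A ⟶ N'} {p' : N' ⟶ Z'} (h : Realizes δ i p)
    (h' : Realizes δ' i' p') (hN : IsZero N) (hN' : IsZero N') : Nonempty (Z ≅ Z') := by
  have key : ∀ {N Z Z' : C} {δ : Ext Z A} {δ' : Ext Z' A} {i : A ⟶ N} {p : N ⟶ Z}
      (_ : Realizes δ i p) (_ : IsZero N), ∃ f : Z' ⟶ Z, δ' = pull f δ := by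
    intro N Z Z' δ δ' i p h hN
    exact Realizes.exists_eq_pull h δ' (by rw [hN.eq_of_tgt i 0, push_zero])
  have key' : ∀ {N Z : C} {δ : Ext Z A} {i : A ⟶ N} {p : N ⟶ Z} (_ : Realizes δ i p)
      (_ : IsZero N) (x : Z ⟶ Z), pull x δ = δ → x = 𝟙 Z := by
    intro N Z δ i p h hN x hx
    obtain ⟨g, hg⟩ := Realizes.exists_lift h (x - 𝟙 Z) (by
      have := pull_add (x - 𝟙 Z) (𝟙 Z) δ
      rw [sub_add_cancel, pull_id, hx] at this
      exact left_eq_add.1 (this.trans (add_comm _ _)))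
    rw [hN.eq_of_tgt g 0, zero_comp] at hg
    exact sub_eq_zero.1 hg.symm
  obtain ⟨f, hf⟩ := key (δ' := δ') h hN
  obtain ⟨g, hg⟩ := key (δ' := δ) h' hN'
  exact ⟨⟨g, f, key' h hN _ (by rw [pull_comp, ← hf, ← hg]),
    key' h' hN' _ (by rw [pull_comp, ← hg, ← hf])⟩⟩

lemma isZero_of_isZero_right [IsPreExtriangulated C] {A N Z : C} {δ : Ext Z A} {i : A ⟶ N}
    {p : N ⟶ Z} (h : Realizes δ i p) (hN : IsZero N) (hZ : IsZero Z) : IsZero A := by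
  have h0 : δ = 0 := by rw [← pull_id δ, hZ.eq_of_src (𝟙 Z) 0, pull_zero]
  rw [h0] at h
  obtain ⟨r, s, hr, -⟩ := Realizes.exists_splitting h
  exact isZero_of_retract hN ⟨i, r, hr⟩

lemma isZero_of_isZero_left [IsPreExtriangulated C] {A N Z : C} {δ : Ext Z A} {i : A ⟶ N}
    {p : N ⟶ Z} (h : Realizes δ i p) (hN : IsZero N) (hA : IsZero A) : IsZero Z := by
  have h0 : δ = 0 := by rw [← push_id δ, hA.eq_of_src (𝟙 A) 0, push_zero]
  rw [h0] at h
  obtain ⟨r, s, -, hs, -⟩ := Realizes.exists_splitting h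
  exact isZero_of_retract hN ⟨s, p, hs⟩

/-- An indecomposable injective object is the suspension of an indecomposable projective: it is
a summand of some `ΣP₁`, so that `0 ⟶ I` is a deflation. -/
lemma exists_isSuspension [IsReducedZeroAuslander C] {I : C} (hI : IsInj I)
    (hI' : Indecomposable I) : ∃ P, Indecomposable P ∧ IsProj P ∧ IsSuspension P I := by
  obtain ⟨J₀, J₁, i, p, δ, -, -, h, N, q, hN, hq⟩ := exists_injective_coresolution I
  have := isInj_iff.1 hI J₁
  rw [Subsingleton.elim δ 0] at h
  obtain ⟨r, s, hr, hs, hsr, hrs⟩ := Realizes.exists_splitting h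
  have hr' : IsDeflation r := ⟨J₁, 0, s, realizes_of_splitting hs hr hsr
      (Realizes.comp_eq_zero h) (by rw [add_comm]; exact hrs)⟩
  obtain ⟨P, θ, a, hθ⟩ := hq.comp hr'
  have hP : IsProj P := isProj_of_isZero_middle hθ hN
  refine ⟨P, ⟨fun h0 => hI'.1 (isZero_of_isZero_left hθ hN h0), fun X Y e => ?_⟩, hP,
    N, a, _, hN, θ, hθ⟩
  obtain ⟨N₁, I₁, i₁, p₁, δ₁, hN₁, -, h₁⟩ := (hP.of_retract
    ⟨biprod.inl ≫ e.inv, e.hom ≫ biprod.fst, by simp⟩ : IsProj X).exists_suspension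
  obtain ⟨N₂, I₂, i₂, p₂, δ₂, hN₂, -, h₂⟩ := (hP.of_retract
    ⟨biprod.inr ≫ e.inv, e.hom ≫ biprod.snd, by simp⟩ : IsProj Y).exists_suspension
  have hsum := Realizes.push_iso (IsExtriangulated.realizes_sum _ _ _ _ _ _ h₁ h₂) e.symm
  have hN₁₂ : IsZero (N₁ ⊞ N₂) := hN₂.of_iso (isoZeroBiprod hN₁).symm
  obtain ⟨f⟩ := nonempty_iso_of_isZero_middle hθ hsum hN hN₁₂
  rcases hI'.2 _ _ f with h0 | h0
  · exact Or.inl (isZero_of_isZero_right h₁ hN₁ h0)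
  · exact Or.inr (isZero_of_isZero_right h₂ hN₂ h0)

end Suspension

section Lift

variable {C : Type u} [Category.{v} C] [Preadditive C] [HasFiniteBiproducts C]
  [ExtriangulatedData.{w} C] [IsKrullSchmidt C] {U : C}

/-- Isomorphisms lift from the reduction to `C`, between objects without summands in `add U`. -/
lemma nonempty_iso_of_proj_iso {X Y : (perp U).FullSubcategory} (hX : AddDisjoint X.obj U)
    (hY : AddDisjoint Y.obj U) (e : (projFunctor U).obj X ≅ (projFunctor U).obj Y) :
    Nonempty (X.obj ≅ Y.obj) := by
  obtain ⟨f, hf⟩ := (projFunctor U).map_surjective e.hom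
  obtain ⟨g, hg⟩ := (projFunctor U).map_surjective e.inv
  have h1 : IsIso (f.hom ≫ g.hom) := isIso_of_factorsAdd_sub_id hX _ (by
    refine (projFunctor_map_eq_iff (f ≫ g) (𝟙 X)).1 ?_
    rw [Functor.map_comp, hf, hg, e.hom_inv_id, (projFunctor U).map_id])
  have h2 : IsIso (g.hom ≫ f.hom) := isIso_of_factorsAdd_sub_id hY _ (by
    refine (projFunctor_map_eq_iff (g ≫ f) (𝟙 Y)).1 ?_
    rw [Functor.map_comp, hf, hg, e.inv_hom_id, (projFunctor U).map_id])
  have := isIso_of_isIso_comp_both f.hom g.hom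
  exact ⟨asIso f.hom⟩

lemma indecomposable_proj {X : (perp U).FullSubcategory} (hX : Indecomposable X.obj)
    (h : AddDisjoint X.obj U) : Indecomposable ((projFunctor U).obj X) :=
  indecomposable_of_isLocalRing (isLocalRing_end_proj (isLocalRing_of_indecomposable hX)
    fun hU => hX.1 (h _ (inAdd_self _) hU))

end Lift

/-- Every sequence of pairwise non-isomorphic indecomposables with presilting sum is signed
presilting: the injective entries are suspensions of projectives automatically, and the
assumptions are inherited by the reduction at the last entry. -/
lemma isSignedPresilting_of_pairwise (t : ℕ) : ∀ (D : Type u) [Category.{v} D] [Preadditive D]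
    [HasFiniteBiproducts D] [ExtriangulatedData.{w} D] [IsReducedZeroAuslander D]
    [IsKrullSchmidt D] [HasFiniteApproximations D] (X : Fin t → D),
    (∀ i, Indecomposable (X i)) → (∀ i j, Nonempty (X i ≅ X j) → i = j) →
    (∀ i j, perp (X i) (X j)) → IsSignedPresilting t D X := by
  induction t with
  | zero => intros; trivial
  | succ t ih =>
    intro D _ _ _ _ _ _ _ X hX hne hperp
    have hU : IsPresilting (X (Fin.last t)) := (isPresilting_iff _).2 (hperp _ _)
    refine ⟨hX, ?_, fun i => hperp _ _, ?_⟩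
    · by_cases hI : IsInj (X (Fin.last t))
      · exact Or.inr ⟨hI, exists_isSuspension hI (hX _)⟩
      · exact Or.inl ⟨hI, hU⟩
    · have := isReducedZeroAuslander_reduction hU
      have hdis : ∀ i : Fin t, AddDisjoint (X i.castSucc) (X (Fin.last t)) := fun i =>
        addDisjoint_of_indecomposable (hX _) (hX _)
          (not_nonempty_iff.1 fun h => (Fin.castSucc_lt_last i).ne (hne _ _ h))
      refine ih (Reduction (X (Fin.last t))) _ (fun i => ?_) (fun i j hij => ?_) fun i j => ?_
      · exact indecomposable_proj (X := ⟨X i.castSucc, hperp _ _⟩) (hX _) (hdis i)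
      · obtain ⟨e⟩ := hij
        exact Fin.castSucc_injective t (hne _ _ (nonempty_iso_of_proj_iso
          (X := ⟨X i.castSucc, hperp _ _⟩) (Y := ⟨X j.castSucc, hperp _ _⟩) (hdis i) (hdis j) e))
      · exact hperp i.castSucc j.castSucc

lemma IsSignedPresilting.indecomposable {t : ℕ} {D : Type u} [Category.{v} D] [Preadditive D]
    [HasFiniteBiproducts D] [ExtriangulatedData.{w} D] {X : Fin t → D}
    (h : IsSignedPresilting t D X) (i : Fin t) : Indecomposable (X i) := by
  cases t with
  | zero => exact i.elim0
  | succ t => exact h.1 i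

section Additive

variable {C : Type u} [Category.{v} C] [Preadditive C] [HasFiniteBiproducts C]

lemma IsBasic.of_indecomposable {X : C} (hX : Indecomposable X) : IsBasic X :=
  ⟨Unit, inferInstance, fun _ => X, fun _ => hX, fun _ _ _ => rfl,
    nonempty_iso_biproduct (fun _ => 𝟙 X) (fun _ => 𝟙 X) (by simp) (by simp) (by simp)⟩

lemma IsBasic.exists_fin {V : C} (hV : IsBasic V) : ∃ (n : ℕ) (F : Fin n → C),
    (∀ i, Indecomposable (F i)) ∧ (∀ i j, Nonempty (F i ≅ F j) → i = j) ∧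
      Nonempty (V ≅ ⨁ F) := by
  obtain ⟨ι, _, F, hF, hF', ⟨e⟩⟩ := hV
  obtain ⟨n, ⟨σ⟩⟩ := Finite.exists_equiv_fin ι
  exact ⟨n, F ∘ σ.symm, fun i => hF _, fun i j h => σ.symm.injective (hF' _ _ h),
    ⟨e ≪≫ biproduct.whiskerEquiv σ (fun i => eqToIso (by simp))⟩⟩

lemma AddDisjoint.of_inAdd [IsKrullSchmidt C] {V A A' : C} (h : AddDisjoint V A)
    (hA : InAdd A A') : AddDisjoint V A' := by
  rw [addDisjoint_iff, Set.disjoint_left]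
  intro x hx hx'
  obtain ⟨X, rfl⟩ := IsoClass.exists_eq_mk x
  obtain ⟨hX, ⟨e⟩⟩ := mk_mem_summandClasses.1 hx
  obtain ⟨-, ⟨e'⟩⟩ := mk_mem_summandClasses.1 hx'
  exact hX.1 (h X ((inAdd_self V).of_retract e) (hA.of_retract e'))

end Additive

section Perp

variable {C : Type u} [Category.{v} C] [Preadditive C] [ExtriangulatedData.{w} C]

lemma perp_of_retract_of_retract {V X Y : C} (hV : IsPresilting V) (e : Retract X V)
    (f : Retract Y V) : perp X Y :=
  perp_retract (perp_symm (perp_retract ((isPresilting_iff V).1 hV) e)) f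

lemma perp_eq_of_iso {V W : C} (e : V ≅ W) : perp V = perp W := by
  ext X
  exact ⟨fun h => perp_symm (perp_retract (perp_symm h) ⟨e.inv, e.hom, by simp⟩),
    fun h => perp_symm (perp_retract (perp_symm h) ⟨e.hom, e.inv, by simp⟩)⟩

lemma IsPresilting.of_retract {V X : C} (hV : IsPresilting V) (e : Retract X V) :
    IsPresilting X :=
  (isPresilting_iff X).2 (perp_of_retract_of_retract hV e e)

end Perp

/-- The signed presilting sequences with sum `V` are the enumerations of the indecomposable
summands of `V`. -/
lemma isSignedPresilting_iff {D : Type u} [Category.{v} D] [Preadditive D] [HasFiniteBiproducts D]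
    [ExtriangulatedData.{w} D] [IsReducedZeroAuslander D] [IsKrullSchmidt D]
    [HasFiniteApproximations D] {V : D} (hV : IsPresilting V) (hV' : IsBasic V) {t : ℕ}
    (ht : numSummands V = t) (s : Fin t → IsoClass D) :
    (∃ X : Fin t → D, (∀ i, s i = IsoClass.mk (X i)) ∧ IsSignedPresilting t D X ∧
      Nonempty (V ≅ ⨁ X)) ↔ Function.Injective s ∧ Set.range s = summandClasses V := by
  classical
  constructor
  · rintro ⟨X, hs, hX, ⟨e⟩⟩
    have hr : Set.range s = summandClasses V := by
      rw [summandClasses_biproduct hX.indecomposable e]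
      exact congrArg Set.range (funext hs)
    refine ⟨?_, hr⟩
    have hc : (Finset.univ.image s).card = (Finset.univ : Finset (Fin t)).card := by
      rw [← Set.ncard_coe_finset, Finset.coe_image, Finset.coe_univ, Set.image_univ, hr,
        Finset.card_univ, Fintype.card_fin]
      exact ht
    exact fun i j hij => Finset.card_image_iff.1 hc (by simp) (by simp) hij
  · rintro ⟨hs, hr⟩
    choose X hX using fun i => IsoClass.exists_eq_mk (s i)
    have hmem : ∀ i, Indecomposable (X i) ∧ Nonempty (Retract (X i) V) := fun i =>
      mk_mem_summandClasses.1 (by rw [← hX, ← hr]; exact ⟨i, rfl⟩)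
    have hne : ∀ i j, Nonempty (X i ≅ X j) → i = j := fun i j h =>
      hs (by rw [hX, hX]; exact IsoClass.mk_eq_mk.2 h)
    refine ⟨X, hX, isSignedPresilting_of_pairwise t D X (fun i => (hmem i).1) hne fun i j =>
      perp_of_retract_of_retract hV (hmem i).2.some (hmem j).2.some, hV'.nonempty_iso
        ⟨Fin t, inferInstance, X, fun i => (hmem i).1, hne, ⟨Iso.refl _⟩⟩ ?_⟩
    rw [summandClasses_biproduct (fun i => (hmem i).1) (Iso.refl _), ← hr]
    exact congrArg Set.range (funext hX)

/-! ### Lifting basic objects along the reduction -/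

section Lift

variable {C : Type u} [Category.{v} C] [Preadditive C] [HasFiniteBiproducts C]
  [ExtriangulatedData.{w} C] {U : C}

lemma nonempty_proj_biproduct_iso {n : ℕ} (F : Fin n → (perp U).FullSubcategory) :
    Nonempty ((projFunctor U).obj ⟨⨁ fun i => (F i).obj,
      perp_biproduct U _ fun i => (F i).property⟩ ≅ ⨁ fun i => (projFunctor U).obj (F i)) := by
  let X : (perp U).FullSubcategory :=
    ⟨⨁ fun i => (F i).obj, perp_biproduct U _ fun i => (F i).property⟩
  let s : ∀ i, X ⟶ F i := fun i => ObjectProperty.homMk (biproduct.π (fun i => (F i).obj) i)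
  let r : ∀ i, F i ⟶ X := fun i => ObjectProperty.homMk (biproduct.ι (fun i => (F i).obj) i)
  refine nonempty_iso_biproduct (X := (projFunctor U).obj X)
    (fun i => (projFunctor U).map (s i)) (fun i => (projFunctor U).map (r i)) ?_ ?_ ?_
  · intro i
    rw [← Functor.map_comp, ← (projFunctor U).map_id]
    congr 1
    ext
    simp [s, r, X]
  · intro i j hij
    rw [← Functor.map_comp, ← Functor.map_zero (projFunctor U)]
    congr 1
    ext
    simp [s, r, X, biproduct.ι_π_ne _ hij]
  · simp_rw [← Functor.map_comp]
    rw [← Functor.map_sum, ← (projFunctor U).map_id]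
    congr 1
    apply (perp U).ι.map_injective
    rw [Functor.map_sum]
    exact biproduct.total

lemma Represents.right_unique {x : IsoClass C} {y y' : IsoClass (Reduction U)}
    (h : Represents U x y) (h' : Represents U x y') : y = y' := by
  obtain ⟨X, hX, rfl, rfl⟩ := h
  obtain ⟨X', hX', hx, rfl⟩ := h'
  obtain ⟨e⟩ := IsoClass.mk_eq_mk.1 hx
  let e₀ : (⟨X, hX⟩ : (perp U).FullSubcategory) ≅ ⟨X', hX'⟩ := ObjectProperty.isoMk _ e
  exact IsoClass.mk_eq_mk.2 ⟨(projFunctor U).mapIso e₀⟩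

variable [IsKrullSchmidt C]

/-- A basic object of the reduction is the image of a basic object without summands in
`add U`. -/
lemma IsBasic.exists_lift {V : Reduction U} (hV : IsBasic V) :
    ∃ X : (perp U).FullSubcategory, IsBasic X.obj ∧ AddDisjoint X.obj U ∧
      Nonempty ((projFunctor U).obj X ≅ V) := by
  obtain ⟨n, G, hG, hG', ⟨e⟩⟩ := hV.exists_fin
  have key : ∀ i, ∃ H : (perp U).FullSubcategory, IsLocalRing (End H.obj) ∧ ¬ InAdd U H.obj ∧
      Nonempty (G i ≅ (projFunctor U).obj H) := by
    intro i
    obtain ⟨ι, _, F, hF, hU, -, ⟨f⟩⟩ := exists_proj_decomposition (U := U) (G i).as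
    have f' : G i ≅ ⨁ fun j => (projFunctor U).obj (F j) := f
    obtain ⟨j, hj⟩ := exists_iso_of_retract_biproduct (hG i)
      (fun j => indecomposable_of_isLocalRing (isLocalRing_end_proj (hF j) (hU j)))
      ⟨f'.hom, f'.inv, f'.hom_inv_id⟩
    exact ⟨F j, hF j, hU j, hj⟩
  choose H hH hU hGH using key
  have hHi := fun i => indecomposable_of_isLocalRing (hH i)
  refine ⟨⟨⨁ fun i => (H i).obj, perp_biproduct U _ fun i => (H i).property⟩,
    ⟨Fin n, inferInstance, fun i => (H i).obj, hHi, fun i j h => ?_, ⟨Iso.refl _⟩⟩, ?_, ?_⟩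
  · obtain ⟨f⟩ := h
    let f₀ : H i ≅ H j := ObjectProperty.isoMk _ f
    exact hG' i j ⟨(hGH i).some ≪≫ (projFunctor U).mapIso f₀ ≪≫ (hGH j).some.symm⟩
  · rw [addDisjoint_iff, summandClasses_biproduct hHi (Iso.refl _), Set.disjoint_left]
    rintro - ⟨i, rfl⟩ h
    exact hU i ((inAdd_iff_retract (hHi i)).2 (mk_mem_summandClasses.1 h).2)
  · obtain ⟨f⟩ := nonempty_proj_biproduct_iso H
    exact ⟨f ≪≫ biproduct.mapIso (fun i => (hGH i).some.symm) ≪≫ e.symm⟩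

variable {X : (perp U).FullSubcategory}

/-- The objects representing an indecomposable summand of `X` in `C` also have no summand in
`add U`. -/
lemma addDisjoint_of_mem_summandClasses (hX : AddDisjoint X.obj U) {Y : C}
    (hY : IsoClass.mk Y ∈ summandClasses X.obj) :
    AddDisjoint Y U := by
  obtain ⟨-, ⟨e⟩⟩ := mk_mem_summandClasses.1 hY
  exact (hX.symm.of_inAdd ((inAdd_self _).of_retract e)).symm

lemma exists_represents_of_mem (hX : AddDisjoint X.obj U) {x : IsoClass C}
    (hx : x ∈ summandClasses X.obj) :
    ∃ y ∈ summandClasses ((projFunctor U).obj X), Represents U x y := by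
  obtain ⟨Y, rfl⟩ := IsoClass.exists_eq_mk x
  obtain ⟨hY, ⟨e⟩⟩ := mk_mem_summandClasses.1 hx
  have hUY : perp U Y := perp_retract X.property e
  let Y₀ : (perp U).FullSubcategory := ⟨Y, hUY⟩
  refine ⟨IsoClass.mk (Reduction.of U Y hUY), mk_mem_summandClasses.2
    ⟨indecomposable_proj (X := Y₀) hY (addDisjoint_of_mem_summandClasses hX hx), ⟨?_⟩⟩,
    Y, hUY, rfl, rfl⟩
  have e₀ : Retract Y₀ X :=
    ⟨ObjectProperty.homMk e.i, ObjectProperty.homMk e.r, by ext; exact e.retract⟩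
  exact e₀.map (projFunctor U)

lemma exists_represents_of_mem_proj {y : IsoClass (Reduction U)}
    (hy : y ∈ summandClasses ((projFunctor U).obj X)) :
    ∃ x ∈ summandClasses X.obj, Represents U x y := by
  obtain ⟨ι, _, F, hF, hU, hFX, ⟨e⟩⟩ := exists_proj_decomposition X
  rw [summandClasses_biproduct (fun j => indecomposable_of_isLocalRing
    (isLocalRing_end_proj (hF j) (hU j))) e] at hy
  obtain ⟨i, rfl⟩ := hy
  exact ⟨IsoClass.mk (F i).obj,
    mk_mem_summandClasses.2 ⟨indecomposable_of_isLocalRing (hF i), hFX i⟩,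
    (F i).obj, (F i).property, rfl, rfl⟩

lemma Represents.left_unique (hX : AddDisjoint X.obj U) {x x' : IsoClass C}
    (hx : x ∈ summandClasses X.obj) (hx' : x' ∈ summandClasses X.obj)
    {y : IsoClass (Reduction U)} (h : Represents U x y)
    (h' : Represents U x' y) : x = x' := by
  obtain ⟨Y, hY, rfl, rfl⟩ := h
  obtain ⟨Y', hY', rfl, hy⟩ := h'
  obtain ⟨e⟩ := IsoClass.mk_eq_mk.1 hy
  exact IsoClass.mk_eq_mk.2 (nonempty_iso_of_proj_iso (X := ⟨Y, hY⟩) (Y := ⟨Y', hY'⟩)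
    (addDisjoint_of_mem_summandClasses hX hx) (addDisjoint_of_mem_summandClasses hX hx') e)

end Lift

/-! ### Morphisms of the τ-cluster morphism category -/

lemma TauObj.ext_carrier {C : Type u} [Category.{v} C] [Preadditive C] [ExtriangulatedData.{w} C]
    {B B' : TauObj C} (h : B.carrier = B'.carrier) : B = B' := by
  cases B
  cases B'
  congr

section TauCategory

variable {C : Type u} [Category.{v} C] [Preadditive C] [HasFiniteBiproducts C]
  [ExtriangulatedData.{w} C]

lemma IsLabel.of_iso {B B' : TauObj C} {V W : C} (h : IsLabel B B' V) (e : V ≅ W) :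
    IsLabel B B' W where
  mem := by
    obtain ⟨U, -, hU⟩ := B.exists_eq
    have := h.mem
    rw [hU] at this ⊢
    exact perp_retract this ⟨e.inv, e.hom, by simp⟩
  presilting := h.presilting.of_retract ⟨e.inv, e.hom, by simp⟩
  basic := h.basic.of_iso e
  disjoint U hU hB := fun X hX hX' => h.disjoint U hU hB X (hX.of_iso_left e.symm) hX'
  target := by rw [h.target, perp_eq_of_iso e]

lemma IsLabel.eq_of_isZero {B B' : TauObj C} {V : C} (h : IsLabel B B' V) (hV : IsZero V) :
    B = B' := by
  refine TauObj.ext_carrier ?_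
  rw [h.target]
  ext X
  exact ⟨fun h => ⟨h, perp_isZero hV X⟩, fun h => h.1⟩

/-- `add U` depends only on `C_U`: if `C_U = C_{U'}`, then `U'` is projective and injective in the
reduction `C_U / [U]`, hence zero there. -/
lemma inAdd_of_perp_eq [IsReducedZeroAuslander C] [HasFiniteApproximations C] {U U' : C}
    (hU : IsPresilting U) (hU' : IsPresilting U') (h : perp U = perp U') : InAdd U U' := by
  have := isReducedZeroAuslander_reduction hU
  let X : (perp U).FullSubcategory := ⟨U', by rw [h]; exact (isPresilting_iff U').1 hU'⟩
  have hY : ∀ Y : Reduction U, perp U' Y.as.obj := fun Y => h ▸ Y.as.property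
  exact (isZero_proj_iff X).1 (IsReducedZeroAuslander.reduced _
    (isProj_iff.2 fun Y => (hY Y).1) (isInj_iff.2 fun Y => (hY Y).2))

/-- The labels of composable morphisms have no common summand. -/
lemma IsLabel.addDisjoint {B₁ B₂ B₃ : TauObj C} {V W : C} (hV : IsLabel B₁ B₂ V)
    (hW : IsLabel B₂ B₃ W) : AddDisjoint V W := by
  obtain ⟨U, hU, hB⟩ := B₁.exists_eq
  have hUV : perp U V := hB ▸ hV.mem
  have h := hW.disjoint (U ⊞ V) (isPresilting_biprod hU hV.presilting hUV)
    (by rw [hV.target, hB, perp_biprod])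
  exact fun X hX hX' => h X hX' (inAdd_biprod_right hX)

variable [IsKrullSchmidt C]

lemma hom_ext_label {B B' : TauObj C} {h h' : B ⟶ B'} (e : homLabel h = homLabel h') : h = h' :=
  TauHom.ext e

lemma isLabel_of_homLabel_eq {B B' : TauObj C} (h : B ⟶ B') {V : C}
    (hV : homLabel h = IsoClass.mk V) : IsLabel B B' V := by
  obtain ⟨W, hW, hW'⟩ := TauHom.isLabel h
  obtain ⟨e⟩ := IsoClass.mk_eq_mk.1 (hW.symm.trans hV)
  exact hW'.of_iso e

lemma exists_hom_of_isLabel {B B' : TauObj C} {V : C} (h : IsLabel B B' V) :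
    ∃ f : B ⟶ B', homLabel f = IsoClass.mk V :=
  ⟨⟨IsoClass.mk V, V, rfl, h⟩, rfl⟩

lemma homLabel_id (B : TauObj C) : homLabel (𝟙 B) = IsoClass.mk (zeroObj C) := rfl

lemma homLabel_comp {B₁ B₂ B₃ : TauObj C} {f : B₁ ⟶ B₂} {g : B₂ ⟶ B₃} {V W : C}
    (hV : homLabel f = IsoClass.mk V) (hW : homLabel g = IsoClass.mk W) :
    homLabel (f ≫ g) = IsoClass.mk (V ⊞ W) :=
  congrArg₂ IsoClass.sum hV hW

lemma isIdentity_iff {B B' : TauObj C} (h : B ⟶ B') {V : C} (hV : homLabel h = IsoClass.mk V) :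
    IsIdentity h ↔ IsZero V := by
  constructor
  · rintro ⟨rfl, rfl⟩
    rw [eqToHom_refl, homLabel_id] at hV
    obtain ⟨e⟩ := IsoClass.mk_eq_mk.1 hV
    exact isZero_zeroObj.of_iso e.symm
  · intro h0
    obtain rfl := (isLabel_of_homLabel_eq h hV).eq_of_isZero h0
    refine ⟨rfl, hom_ext_label ?_⟩
    rw [eqToHom_refl, homLabel_id, hV]
    exact IsoClass.mk_eq_mk.2 ⟨h0.iso isZero_zeroObj⟩

/-- A path is determined by its source and its labels. -/
lemma path_ext {B B₁ B₂ : TauObj C} (p : Quiver.Path B B₁) (q : Quiver.Path B B₂)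
    (h : pathLabels p = pathLabels q) :
    (⟨B₁, p⟩ : Σ B', Quiver.Path B B') = ⟨B₂, q⟩ := by
  induction p generalizing B₂ with
  | nil =>
    cases q with
    | nil => rfl
    | cons q g => exact absurd h (by simp [pathLabels])
  | cons p f ih =>
    cases q with
    | nil => exact absurd h (by simp [pathLabels])
    | cons q g =>
      obtain ⟨hfg, hpq⟩ := List.cons.inj h
      obtain ⟨rfl, hpq⟩ := Sigma.mk.inj_iff.1 (ih q hpq)
      obtain rfl := eq_of_heq hpq
      obtain ⟨V, hV⟩ := IsoClass.exists_eq_mk (homLabel f)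
      obtain rfl : _ = B₂ := TauObj.ext_carrier (by
        rw [(isLabel_of_homLabel_eq f hV).target,
          (isLabel_of_homLabel_eq g (hfg.symm.trans hV)).target])
      obtain rfl := hom_ext_label hfg
      rfl

section

variable [IsReducedZeroAuslander C] [HasFiniteApproximations C]

/-- A decomposition of the label of a morphism yields a factorisation of the morphism. -/
lemma exists_factorisation {B B' : TauObj C} (h : B ⟶ B') {V W : C}
    (hVW : homLabel h = IsoClass.mk (V ⊞ W)) (hV : IsBasic V) (hW : IsBasic W)
    (hdis : AddDisjoint V W) : ∃ (B₁ : TauObj C) (f : B ⟶ B₁) (g : B₁ ⟶ B'),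
      homLabel f = IsoClass.mk V ∧ homLabel g = IsoClass.mk W ∧ f ≫ g = h := by
  have hL := isLabel_of_homLabel_eq h hVW
  have eV : Retract V (V ⊞ W) := ⟨biprod.inl, biprod.fst, by simp⟩
  have eW : Retract W (V ⊞ W) := ⟨biprod.inr, biprod.snd, by simp⟩
  obtain ⟨U, hU, hB⟩ := B.exists_eq
  have hmem := hL.mem
  rw [hB] at hmem
  have hUV := perp_retract hmem eV
  have hpV := hL.presilting.of_retract eV
  have hUV' := isPresilting_biprod hU hpV hUV
  have hB₁ : B.carrier ⊓ perp V = perp (U ⊞ V) := by rw [hB, perp_biprod]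
  let B₁ : TauObj C := ⟨B.carrier ⊓ perp V, U ⊞ V, hUV', hB₁⟩
  obtain ⟨f, hf⟩ := exists_hom_of_isLabel (B := B) (B' := B₁) (V := V)
    { mem := by rw [hB]; exact hUV
      presilting := hpV
      basic := hV
      disjoint := fun U' hU' hB' X hX hX' => hL.disjoint U' hU' hB' X (inAdd_biprod_left hX) hX'
      target := rfl }
  obtain ⟨g, hg⟩ := exists_hom_of_isLabel (B := B₁) (B' := B') (V := W)
    { mem := ⟨by rw [hB]; exact perp_retract hmem eW,
        perp_of_retract_of_retract hL.presilting eV eW⟩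
      presilting := hL.presilting.of_retract eW
      basic := hW
      disjoint := fun U' hU' hB' => by
        have hWU : AddDisjoint U W := fun X hX hX' =>
          hL.disjoint U hU hB X (inAdd_biprod_right hX') hX
        exact (addDisjoint_biprod hWU hdis).symm.of_inAdd
          (inAdd_of_perp_eq hUV' hU' (hB₁.symm.trans hB'))
      target := by rw [hL.target, perp_biprod, inf_assoc] }
  exact ⟨B₁, f, g, hf, hg, hom_ext_label (by rw [homLabel_comp hf hg, hVW])⟩

/-- A morphism is irreducible iff its label is indecomposable. -/
theorem irreducibles_iff {B B' : TauObj C} (h : B ⟶ B') :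
    irreducibles (TauObj C) h ↔ ∃ V : C, homLabel h = IsoClass.mk V ∧ Indecomposable V := by
  obtain ⟨V, hV⟩ := IsoClass.exists_eq_mk (homLabel h)
  have hL := isLabel_of_homLabel_eq h hV
  constructor
  · rintro ⟨hid, hirr⟩
    rw [isIdentity_iff h hV, isZero_iff_summandClasses, ← ne_eq, ← Set.nonempty_iff_ne_empty] at hid
    obtain ⟨y, hy⟩ := hid
    obtain ⟨V', Y, rfl, hY, hV', ⟨e⟩, hs⟩ := hL.basic.exists_split hy
    have hV'Y : homLabel h = IsoClass.mk (V' ⊞ Y) := hV.trans (IsoClass.mk_eq_mk.2 ⟨e⟩)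
    have hdis : AddDisjoint V' Y := by
      rw [addDisjoint_iff, hs, summandClasses_of_indecomposable hY]
      exact Set.disjoint_sdiff_left
    obtain ⟨B₁, f, g, hf, hg, hfg⟩ := exists_factorisation h hV'Y hV' (.of_indecomposable hY) hdis
    rcases hirr B₁ f g hfg with h1 | h1
    · exact absurd ((isIdentity_iff g hg).1 h1) hY.1
    · exact ⟨Y, hV'Y.trans (IsoClass.mk_eq_mk.2
        ⟨(isoZeroBiprod ((isIdentity_iff f hf).1 h1)).symm⟩), hY⟩
  · rintro ⟨V, hV, hind⟩
    refine ⟨fun h0 => hind.1 ((isIdentity_iff h hV).1 h0), fun Z f g hfg => ?_⟩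
    obtain ⟨X, hX⟩ := IsoClass.exists_eq_mk (homLabel f)
    obtain ⟨Y, hY⟩ := IsoClass.exists_eq_mk (homLabel g)
    rw [isIdentity_iff f hX, isIdentity_iff g hY]
    subst hfg
    obtain ⟨e⟩ := IsoClass.mk_eq_mk.1 (hV.symm.trans (homLabel_comp hX hY))
    exact (hind.2 X Y e).symm

/-! ### Factorisations are orderings of the summands of the label -/

/-- The labels of a path of irreducible morphisms are, without repetition, the indecomposable
summands of the label of its composite. -/
lemma nodup_pathLabels {B B' : TauObj C} (p : Quiver.Path B B')
    (hp : (irreducibles (TauObj C)).paths p) {V : C}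
    (hV : homLabel (composePath p) = IsoClass.mk V) :
    (pathLabels p).Nodup ∧ ∀ x, x ∈ pathLabels p ↔ x ∈ summandClasses V := by
  induction p generalizing V with
  | nil =>
    obtain ⟨e⟩ := IsoClass.mk_eq_mk.1 ((homLabel_id B).symm.trans hV)
    rw [isZero_iff_summandClasses.1 (isZero_zeroObj.of_iso e.symm)]
    simp [pathLabels]
  | cons p f ih =>
    obtain ⟨hp, hf⟩ := MorphismProperty.cons_mem_paths_iff.1 hp
    obtain ⟨Y, hY, hY'⟩ := (irreducibles_iff f).1 hf
    obtain ⟨X, hX⟩ := IsoClass.exists_eq_mk (homLabel (composePath p))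
    obtain ⟨hn, hm⟩ := ih hp hX
    obtain ⟨e⟩ := IsoClass.mk_eq_mk.1 ((homLabel_comp hX hY).symm.trans hV)
    have hdis := addDisjoint_iff.1
      ((isLabel_of_homLabel_eq _ hX).addDisjoint (isLabel_of_homLabel_eq f hY))
    rw [summandClasses_of_indecomposable hY', Set.disjoint_singleton_right] at hdis
    rw [← summandClasses_iso e, summandClasses_biprod, summandClasses_of_indecomposable hY']
    refine ⟨List.nodup_cons.2 ⟨?_, hn⟩, fun x => ?_⟩
    · rw [hY, hm]
      exact hdis
    · rw [pathLabels, List.mem_cons, hm, hY, Set.mem_union, Set.mem_singleton_iff, or_comm]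

/-- Every ordering of the indecomposable summands of the label of `h` comes from a
factorisation of `h`. -/
lemma exists_path (L : List (IsoClass C)) {B B' : TauObj C} (h : B ⟶ B') {V : C}
    (hV : homLabel h = IsoClass.mk V) (hn : L.Nodup) (hL : ∀ x, x ∈ L ↔ x ∈ summandClasses V) :
    ∃ p : Quiver.Path B B', (irreducibles (TauObj C)).paths p ∧ composePath p = h ∧
      pathLabels p = L := by
  induction L generalizing B' V with
  | nil =>
    have h0 : IsZero V := by
      rw [isZero_iff_summandClasses, Set.eq_empty_iff_forall_notMem]
      exact fun x hx => List.not_mem_nil ((hL x).2 hx)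
    obtain ⟨rfl, rfl⟩ := (isIdentity_iff h hV).2 h0
    exact ⟨.nil, MorphismProperty.nil_mem_paths, rfl, rfl⟩
  | cons y L ih =>
    obtain ⟨hy, hnL⟩ := List.nodup_cons.1 hn
    obtain ⟨V', Y, rfl, hY, hV', ⟨e⟩, hs⟩ :=
      (isLabel_of_homLabel_eq h hV).basic.exists_split ((hL y).1 List.mem_cons_self)
    have hdis : AddDisjoint V' Y := by
      rw [addDisjoint_iff, hs, summandClasses_of_indecomposable hY]
      exact Set.disjoint_sdiff_left
    obtain ⟨B₁, f, g, hf, hg, rfl⟩ := exists_factorisation h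
      (hV.trans (IsoClass.mk_eq_mk.2 ⟨e⟩)) hV' (.of_indecomposable hY) hdis
    obtain ⟨p, hp, rfl, rfl⟩ := ih f hf hnL (fun x => by
      rw [hs, Set.mem_sdiff, ← hL, List.mem_cons, Set.mem_singleton_iff]
      exact ⟨fun hx => ⟨Or.inr hx, fun h' => hy (h' ▸ hx)⟩, fun hx => hx.1.resolve_left hx.2⟩)
    exact ⟨p.cons g, MorphismProperty.cons_mem_paths hp ((irreducibles_iff g).2 ⟨Y, hg, hY⟩), rfl,
      congrArg (· :: _) hg⟩

/-! ### The bijection -/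

/-- A basic presilting object of the reduction is the label of exactly one morphism out of
`C_U`. -/
lemma existsUnique_hom {U : C} (hU : IsPresilting U) {V : Reduction U} (hV : IsPresilting V)
    (hV' : IsBasic V) : ∃ (X : (perp U).FullSubcategory) (B' : TauObj C)
      (h : TauObj.of U hU ⟶ B'), AddDisjoint X.obj U ∧ Nonempty ((projFunctor U).obj X ≅ V) ∧
      homLabel h = IsoClass.mk X.obj ∧ ∀ (B'' : TauObj C) (h' : TauObj.of U hU ⟶ B''),
        Represents U (homLabel h') (IsoClass.mk V) → ∃ e : B' = B'', h' = h ≫ eqToHom e := by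
  obtain ⟨X, hX, hXU, ⟨e⟩⟩ := hV'.exists_lift
  have hpX : IsPresilting X.obj :=
    hV.of_retract (X := (projFunctor U).obj X) ⟨e.hom, e.inv, e.hom_inv_id⟩
  let B' : TauObj C := ⟨perp U ⊓ perp X.obj, U ⊞ X.obj, isPresilting_biprod hU hpX X.property,
    (perp_biprod _ _).symm⟩
  have hL : IsLabel (TauObj.of U hU) B' X.obj :=
    { mem := X.property
      presilting := hpX
      basic := hX
      disjoint := fun U' hU' hB => hXU.of_inAdd (inAdd_of_perp_eq hU hU' hB)
      target := rfl }
  obtain ⟨h, hh⟩ := exists_hom_of_isLabel hL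
  refine ⟨X, B', h, hXU, ⟨e⟩, hh, ?_⟩
  rintro B'' h' ⟨X', hX', hl, hVX'⟩
  have hL' := isLabel_of_homLabel_eq h' hl
  obtain ⟨e'⟩ := IsoClass.mk_eq_mk.1 hVX'
  obtain ⟨f⟩ := nonempty_iso_of_proj_iso (X := X) (Y := ⟨X', hX'⟩) hXU
    (hL'.disjoint U hU rfl) (e ≪≫ e')
  obtain rfl : B' = B'' := TauObj.ext_carrier (by
    rw [hL.target, hL'.target, perp_eq_of_iso f])
  refine ⟨rfl, hom_ext_label ?_⟩
  rw [eqToHom_refl, Category.comp_id, hl, hh]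
  exact IsoClass.mk_eq_mk.2 ⟨f.symm⟩

variable {U : C} {V : Reduction U} {X : (perp U).FullSubcategory} {B B' : TauObj C} {h : B ⟶ B'}
  {t : ℕ}

/-- The entries of a signed presilting sequence with sum `V` lift to the indecomposable summands of
`X`, in an order which is realised by a factorisation of the morphism with label `X`. -/
lemma exists_factorisation_of_seq (hU : IsPresilting U) (hV : IsPresilting V) (hV' : IsBasic V)
    (ht : numSummands V = t) (hX : AddDisjoint X.obj U) (e : (projFunctor U).obj X ≅ V)
    (hh : homLabel h = IsoClass.mk X.obj) (s : SignedPresiltingSeq V t) :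
    ∃ p : IrreducibleFactorisation h,
      List.Forall₂ (Represents U) (pathLabels p.1) (List.ofFn s.1) := by
  have := isReducedZeroAuslander_reduction hU
  obtain ⟨hs, hr⟩ := (isSignedPresilting_iff hV hV' ht s.1).1 s.2
  rw [← summandClasses_iso e] at hr
  have key : ∀ i, ∃ x ∈ summandClasses X.obj, Represents U x (s.1 i) := fun i =>
    exists_represents_of_mem_proj (by rw [← hr]; exact ⟨i, rfl⟩)
  choose x hx hxs using key
  obtain ⟨p, hp, hc, hpl⟩ := exists_path (List.ofFn x) h hh
    (List.nodup_ofFn.2 fun i j hij => hs ((hxs i).right_unique (hij ▸ hxs j))) (fun z => by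
      rw [List.mem_ofFn]
      refine ⟨by rintro ⟨i, rfl⟩; exact hx i, fun hz => ?_⟩
      obtain ⟨y, hy, hzy⟩ := exists_represents_of_mem hX hz
      rw [← hr] at hy
      obtain ⟨i, rfl⟩ := hy
      exact ⟨i, (hxs i).left_unique hX (hx i) hz hzy⟩)
  refine ⟨⟨p, hp, hc⟩, ?_⟩
  rw [hpl, List.forall₂_iff_get]
  exact ⟨by simp, fun i h₁ h₂ => by simpa using hxs ⟨i, by simpa using h₁⟩⟩

/-- The labels of a factorisation into irreducibles are sent by the reduction to a signed presilting
sequence. -/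
lemma exists_seq_of_factorisation (hU : IsPresilting U) (hV : IsPresilting V) (hV' : IsBasic V)
    (ht : numSummands V = t) (hX : AddDisjoint X.obj U) (e : (projFunctor U).obj X ≅ V)
    (hh : homLabel h = IsoClass.mk X.obj) (p : IrreducibleFactorisation h) :
    ∃ s : SignedPresiltingSeq V t,
      List.Forall₂ (Represents U) (pathLabels p.1) (List.ofFn s.1) := by
  classical
  have := isReducedZeroAuslander_reduction hU
  obtain ⟨p, hp, rfl⟩ := p
  obtain ⟨hn, hm⟩ := nodup_pathLabels p hp hh
  have key : ∀ i : Fin (pathLabels p).length,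
      ∃ y ∈ summandClasses V, Represents U ((pathLabels p).get i) y := fun i => by
    rw [← summandClasses_iso e]
    exact exists_represents_of_mem hX ((hm _).1 (List.get_mem _ _))
  choose y hy hyp using key
  have hinj : Function.Injective y := fun i j hij => hn.get_inj_iff.1
    ((hyp i).left_unique hX ((hm _).1 (List.get_mem _ _)) ((hm _).1 (List.get_mem _ _))
      (hij ▸ hyp j))
  have hr : Set.range y = summandClasses V := by
    refine Set.Subset.antisymm (by rintro - ⟨i, rfl⟩; exact hy i) fun z hz => ?_
    rw [← summandClasses_iso e] at hz
    obtain ⟨x, hx, hxz⟩ := exists_represents_of_mem_proj hz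
    obtain ⟨i, rfl⟩ := List.mem_iff_get.1 ((hm x).2 hx)
    exact ⟨i, (hyp i).right_unique hxz⟩
  obtain rfl : (pathLabels p).length = t := by
    rw [← ht]
    change _ = (summandClasses V).ncard
    rw [← hr, ← Set.image_univ, Set.ncard_image_of_injective _ hinj, Set.ncard_univ,
      Nat.card_eq_fintype_card, Fintype.card_fin]
  refine ⟨⟨y, (isSignedPresilting_iff hV hV' ht y).2 ⟨hinj, hr⟩⟩, ?_⟩
  rw [List.forall₂_iff_get]
  exact ⟨by simp, fun i h₁ h₂ => by simpa using hyp ⟨i, h₁⟩⟩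

/-- The correspondence is bijective because `Represents U` matches the indecomposable summands of
`X` with those of `V` one to one. -/
lemma exists_equiv_factorisations (hU : IsPresilting U) (hV : IsPresilting V) (hV' : IsBasic V)
    (ht : numSummands V = t) (hX : AddDisjoint X.obj U) (e : (projFunctor U).obj X ≅ V)
    (hh : homLabel h = IsoClass.mk X.obj) :
    ∃ Φ : SignedPresiltingSeq V t ≃ IrreducibleFactorisation h, ∀ s : SignedPresiltingSeq V t,
      List.Forall₂ (Represents U) (pathLabels (Φ s).1) (List.ofFn s.1) := by
  choose Φ hΦ using exists_factorisation_of_seq (h := h) hU hV hV' ht hX e hh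
  refine ⟨Equiv.ofBijective Φ ⟨fun s s' hss => ?_, fun p => ?_⟩, hΦ⟩
  · have h1 := hΦ s
    rw [hss] at h1
    exact Subtype.ext (List.ofFn_injective (List.right_unique_forall₂'
      (fun _ _ _ h h' => h.right_unique h') h1 (hΦ s')))
  · obtain ⟨s, hs⟩ := exists_seq_of_factorisation hU hV hV' ht hX e hh p
    refine ⟨s, ?_⟩
    have hm : ∀ q : IrreducibleFactorisation h, ∀ x ∈ pathLabels q.1, x ∈ summandClasses X.obj := by
      rintro ⟨q, hq, rfl⟩ x hx
      exact ((nodup_pathLabels q hq hh).2 x).1 hx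
    have hlab : pathLabels (Φ s).1 = pathLabels p.1 := by
      have h1 := List.forall₂_iff_get.1 (hΦ s)
      have h2 := List.forall₂_iff_get.1 hs
      refine List.ext_get (h1.1.trans h2.1.symm) fun i hi hi' => ?_
      exact (h1.2 i hi (h1.1 ▸ hi)).left_unique hX (hm _ _ (List.get_mem _ _))
        (hm _ _ (List.get_mem _ _)) (h2.2 i hi' (h1.1 ▸ hi))
    exact Subtype.ext (eq_of_heq (Sigma.mk.inj_iff.1 (path_ext _ _ hlab)).2)

end

end TauCategory

end TauCluster

open TauCluster

theorem mainTheorem8 {k : Type*} [Field k] (C : Type u) [Category.{v} C] [Preadditive C]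
    [HasFiniteBiproducts C] [Linear k C] (homFinite : ∀ X Y : C, Module.Finite k (X ⟶ Y))
    [IsKrullSchmidt C] [ExtriangulatedData.{w} C] [IsReducedZeroAuslander C]
    (P : C) (hP : ∀ X : C, IsProj X ↔ InAdd P X) :
    (∀ (U : C) (hU : IsPresilting U) (V : Reduction U), IsPresilting V → IsBasic V →
      ∀ t : ℕ, numSummands V = t →
        ∃ (B' : TauObj C) (h : TauObj.of U hU ⟶ B'),
          Represents U (homLabel h) (IsoClass.mk V) ∧
          (∀ (B'' : TauObj C) (h' : TauObj.of U hU ⟶ B''),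
            Represents U (homLabel h') (IsoClass.mk V) → ∃ e : B' = B'', h' = h ≫ eqToHom e) ∧
          ∃ Φ : SignedPresiltingSeq V t ≃ IrreducibleFactorisation h,
            ∀ s : SignedPresiltingSeq V t,
              List.Forall₂ (Represents U) (pathLabels (Φ s).1) (List.ofFn s.1)) ∧
    (∀ (B B' : TauObj C) (h : B ⟶ B'),
      irreducibles (TauObj C) h ↔ ∃ V : C, homLabel h = IsoClass.mk V ∧ Indecomposable V) := by
  have := hasFiniteApproximations_of_homFinite C homFinite
  refine ⟨fun U hU V hV hV' t ht => ?_, fun B B' h => irreducibles_iff h⟩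
  obtain ⟨X, B', h, hX, ⟨e⟩, hh, huniq⟩ := existsUnique_hom hU hV hV'
  exact ⟨B', h, ⟨X.obj, X.property, hh, IsoClass.mk_eq_mk.2 ⟨e.symm⟩⟩, huniq,
    exists_equiv_factorisations hU hV hV' ht hX e hh⟩
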